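/- Let $\mathbb{T}=\mathbb{R}/\mathbb{Z}$, $\mathbb{R}^-=]-\infty,0]$, and let $J_0(q,p)=(-p,q)$ be the standard complex structure of $\mathbb{R}^2$. For $A\in \mathrm{sp}(\mathbb{R}^2)$, viewed as a constant function on $\mathbb{R}^-\times\mathbb{T}$, consider the linear operator \[ T: H^2(\mathbb{R}^-\times\mathbb{T},\mathbb{R}^2)\to H^1(\mathbb{R}^-\times\mathbb{T},\mathbb{R}^2)\times H^{1/2}(\mathbb{T},\mathbb{R}),\qquad Tu=\bigl(\partial_s u+J_0\,\partial_t u-J_0Au,\ \partial_t(\pi\circ u)(0,\cdot)\bigr), \] where $\pi(q,p)=q$ and $(0,\cdot)$ denotes the trace on $\{0\}\times\mathbb{T}$. This operator is well defined. Write $\ker T$ and $\operatorname{coker} T=(H^1\times H^{1/2})/\operatorname{im}T$ for its kernel and cokernel as real vector spaces, and $\operatorname{ind}T=\dim\ker T-\dim\operatorname{coker}T$. Let $W:[0,1]\to \mathrm{Sp}(\mathbb{R}^2)$ be the solution of $W'(t)=AW(t)$, $W(0)=I$, and let $\mu_{CZ}(W)$ be its Conley-Zehnder index, with the sign normalized so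 that $t\mapsto e^{-atJ_0}$ has index $1$ for $0<a<2\pi$. (i) Let $A=-aJ_0$ with $a\in\mathbb{R}\setminus 2\pi\mathbb{Z}$. Then $\ker T$ and $\operatorname{coker}T$ are finite dimensional and \[ \dim\ker T=\begin{cases}2\lceil \frac{a}{2\pi}\rceil & \text{if } a>0,\\ 0 & \text{if } a<0,\end{cases}\qquad \dim\operatorname{coker} T=\begin{cases}1 & \text{if } a>0,\\ 2\lfloor -\frac{a}{2\pi}\rfloor+1 & \text{if } a<0.\end{cases} \] In particular $\operatorname{ind}T=2\lfloor \frac{a}{2\pi}\rfloor+1=\mu_{CZ}(W)$. (ii) Let $A=\begin{pmatrix}1&0\\0&-1\end{pmatrix}$. Then $\dim\ker T=\dim\operatorname{coker}T=1$. In particular $\operatorname{ind}T=0=\mu_{CZ}(W)$. -/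

import Mathlib

open MeasureTheory Set AddCircle

noncomputable section

namespace HalfCylinder

/-! ### The half-cylinder and smooth functions on it

`UnitAddCircle` is `𝕋 = ℝ/ℤ`, and `haarAddCircle` is the measure `dt` on it (of total mass one). -/

/-- The measure `ds dt` on the closed half-cylinder `ℝ⁻ × 𝕋 = ]-∞,0] × 𝕋`, seen as a measure on
the cylinder `ℝ × 𝕋`. -/
def cylMeasure : Measure (ℝ × UnitAddCircle) :=
  (volume.restrict (Iic (0 : ℝ))).prod (haarAddCircle (T := (1 : ℝ)))

/-- `L²(ℝ⁻ × 𝕋, F)`. -/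
abbrev L2Cyl (F : Type*) [NormedAddCommGroup F] := Lp F 2 cylMeasure

/-- `L²(𝕋, F)`. -/
abbrev L2Circ (F : Type*) [NormedAddCommGroup F] := Lp F 2 (haarAddCircle (T := (1 : ℝ)))

/-- `φ` is a real-valued smooth function with compact support on the cylinder `ℝ × 𝕋`: its lift
to the universal cover `ℝ × ℝ` is smooth. The restrictions of these functions to `ℝ⁻ × 𝕋` are the
smooth functions with compact support on the closed half-cylinder (the support may meet the
boundary). -/
def IsTest (φ : ℝ × UnitAddCircle → ℝ) : Prop :=
  ContDiff ℝ ((⊤ : ℕ∞) : WithTop ℕ∞) (fun p : ℝ × ℝ => φ (p.1, (p.2 : UnitAddCircle))) ∧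
    HasCompactSupport φ

/-- A smooth function with compact support in the open half-cylinder `]-∞,0[ × 𝕋`. -/
def IsInteriorTest (φ : ℝ × UnitAddCircle → ℝ) : Prop :=
  IsTest φ ∧ tsupport φ ⊆ {x | x.1 < 0}

/-- The classical derivative `∂_s φ`. -/
def partialS (φ : ℝ × UnitAddCircle → ℝ) (x : ℝ × UnitAddCircle) : ℝ :=
  deriv (fun s : ℝ => φ (s, x.2)) x.1

/-- The classical derivative `∂_t φ`. -/
def partialT (φ : ℝ × UnitAddCircle → ℝ) (x : ℝ × UnitAddCircle) : ℝ :=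
  deriv (fun τ : ℝ => φ (x.1, x.2 + (τ : UnitAddCircle))) 0

section Sobolev

variable {F : Type*} [NormedAddCommGroup F] [NormedSpace ℝ F]

/-- `v = ∂_s u` in the weak sense on the open half-cylinder. -/
def HasWeakS (u v : L2Cyl F) : Prop :=
  ∀ φ, IsInteriorTest φ →
    ∫ x, partialS φ x • u x ∂cylMeasure = - ∫ x, φ x • v x ∂cylMeasure

/-- `v = ∂_t u` in the weak sense on the open half-cylinder. -/
def HasWeakT (u v : L2Cyl F) : Prop :=
  ∀ φ, IsInteriorTest φ →
    ∫ x, partialT φ x • u x ∂cylMeasure = - ∫ x, φ x • v x ∂cylMeasure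

/-! Helper facts: integrals of test functions against `L²` functions converge. -/

instance : IsFiniteMeasureOnCompacts cylMeasure := by
  unfold cylMeasure; infer_instance

lemma IsTest.continuous {φ : ℝ × UnitAddCircle → ℝ} (h : IsTest φ) : Continuous φ := by
  have hq : IsOpenQuotientMap (Prod.map id ((↑) : ℝ → UnitAddCircle) : ℝ × ℝ → _) :=
    IsOpenQuotientMap.id.prodMap QuotientAddGroup.isOpenQuotientMap_mk
  exact hq.isQuotientMap.continuous_iff.2 h.1.continuous

lemma IsTest.partialS_comp {φ : ℝ × UnitAddCircle → ℝ} (h : IsTest φ) (p : ℝ × ℝ) :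
    partialS φ (p.1, (p.2 : UnitAddCircle)) =
      fderiv ℝ (fun p : ℝ × ℝ => φ (p.1, (p.2 : UnitAddCircle))) p (1, 0) := by
  have hd := (h.1.differentiable (by simp)) p
  have hc : HasDerivAt (fun s : ℝ => ((s, p.2) : ℝ × ℝ)) (1, 0) p.1 :=
    (hasDerivAt_id p.1).prodMk (hasDerivAt_const p.1 p.2)
  exact (HasFDerivAt.comp_hasDerivAt p.1 (f := fun s : ℝ => ((s, p.2) : ℝ × ℝ))
    hd.hasFDerivAt hc).deriv

lemma IsTest.partialT_comp {φ : ℝ × UnitAddCircle → ℝ} (h : IsTest φ) (p : ℝ × ℝ) :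
    partialT φ (p.1, (p.2 : UnitAddCircle)) =
      fderiv ℝ (fun p : ℝ × ℝ => φ (p.1, (p.2 : UnitAddCircle))) p (0, 1) := by
  have hd := (h.1.differentiable (by simp)) p
  have hc : HasDerivAt (fun τ : ℝ => ((p.1, p.2 + τ) : ℝ × ℝ)) (0, 1) 0 :=
    (hasDerivAt_const (0 : ℝ) p.1).prodMk ((hasDerivAt_id (0 : ℝ)).const_add p.2)
  have hd' : HasFDerivAt (fun p : ℝ × ℝ => φ (p.1, (p.2 : UnitAddCircle)))
      (fderiv ℝ (fun p : ℝ × ℝ => φ (p.1, (p.2 : UnitAddCircle))) p) (p.1, p.2 + 0) := by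
    simpa using hd.hasFDerivAt
  have := (HasFDerivAt.comp_hasDerivAt (0 : ℝ) (f := fun τ : ℝ => ((p.1, p.2 + τ) : ℝ × ℝ))
    hd' hc).deriv
  simpa [partialT, Function.comp_def] using this

lemma IsTest.continuous_partialS {φ : ℝ × UnitAddCircle → ℝ} (h : IsTest φ) :
    Continuous (partialS φ) := by
  have hq : IsOpenQuotientMap (Prod.map id ((↑) : ℝ → UnitAddCircle) : ℝ × ℝ → _) :=
    IsOpenQuotientMap.id.prodMap QuotientAddGroup.isOpenQuotientMap_mk
  refine hq.isQuotientMap.continuous_iff.2 ?_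
  have : partialS φ ∘ (Prod.map id ((↑) : ℝ → UnitAddCircle) : ℝ × ℝ → _) =
      fun p => fderiv ℝ (fun p : ℝ × ℝ => φ (p.1, (p.2 : UnitAddCircle))) p (1, 0) :=
    funext h.partialS_comp
  rw [this]
  exact (h.1.continuous_fderiv (by simp)).clm_apply continuous_const

lemma IsTest.continuous_partialT {φ : ℝ × UnitAddCircle → ℝ} (h : IsTest φ) :
    Continuous (partialT φ) := by
  have hq : IsOpenQuotientMap (Prod.map id ((↑) : ℝ → UnitAddCircle) : ℝ × ℝ → _) :=
    IsOpenQuotientMap.id.prodMap QuotientAddGroup.isOpenQuotientMap_mk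
  refine hq.isQuotientMap.continuous_iff.2 ?_
  have : partialT φ ∘ (Prod.map id ((↑) : ℝ → UnitAddCircle) : ℝ × ℝ → _) =
      fun p => fderiv ℝ (fun p : ℝ × ℝ => φ (p.1, (p.2 : UnitAddCircle))) p (0, 1) :=
    funext h.partialT_comp
  rw [this]
  exact (h.1.continuous_fderiv (by simp)).clm_apply continuous_const

lemma IsTest.hasCompactSupport_partialS {φ : ℝ × UnitAddCircle → ℝ} (h : IsTest φ) :
    HasCompactSupport (partialS φ) := by
  refine HasCompactSupport.intro h.2 fun x hx => ?_
  have h0 : φ =ᶠ[nhds x] 0 := notMem_tsupport_iff_eventuallyEq.1 hx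
  have hc : Continuous fun s : ℝ => ((s, x.2) : ℝ × UnitAddCircle) := by fun_prop
  have h1 : (fun s : ℝ => φ (s, x.2)) =ᶠ[nhds x.1] fun _ => 0 := hc.continuousAt.eventually h0
  simpa [partialS] using h1.deriv_eq

lemma IsTest.hasCompactSupport_partialT {φ : ℝ × UnitAddCircle → ℝ} (h : IsTest φ) :
    HasCompactSupport (partialT φ) := by
  refine HasCompactSupport.intro h.2 fun x hx => ?_
  have h0 : φ =ᶠ[nhds x] 0 := notMem_tsupport_iff_eventuallyEq.1 hx
  have hc : Continuous fun τ : ℝ => ((x.1, x.2 + (τ : UnitAddCircle)) : ℝ × UnitAddCircle) := by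
    have : Continuous ((↑) : ℝ → UnitAddCircle) := AddCircle.continuous_mk' 1
    fun_prop
  have h2 : Filter.Tendsto (fun τ : ℝ => ((x.1, x.2 + (τ : UnitAddCircle)) : ℝ × UnitAddCircle))
      (nhds 0) (nhds x) := by
    have := hc.tendsto 0
    simpa using this
  have h1 : (fun τ : ℝ => φ (x.1, x.2 + (τ : UnitAddCircle))) =ᶠ[nhds 0] fun _ => 0 :=
    h2.eventually h0
  simpa [partialT] using h1.deriv_eq

lemma integrable_smul_L2 {ψ : ℝ × UnitAddCircle → ℝ} (hc : Continuous ψ)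
    (hs : HasCompactSupport ψ) (u : L2Cyl F) :
    Integrable (fun x => ψ x • u x) cylMeasure := by
  have h1 : MemLp ψ 2 cylMeasure := hc.memLp_of_hasCompactSupport hs
  exact memLp_one_iff_integrable.1 ((Lp.memLp u).smul h1)

lemma integral_smul_add {ψ : ℝ × UnitAddCircle → ℝ} (hc : Continuous ψ)
    (hs : HasCompactSupport ψ) (u v : L2Cyl F) :
    ∫ x, ψ x • (u + v : L2Cyl F) x ∂cylMeasure =
      ∫ x, ψ x • u x ∂cylMeasure + ∫ x, ψ x • v x ∂cylMeasure := by
  rw [← integral_add (integrable_smul_L2 hc hs u) (integrable_smul_L2 hc hs v)]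
  refine integral_congr_ae ?_
  filter_upwards [Lp.coeFn_add u v] with x hx
  rw [hx, Pi.add_apply, smul_add]

lemma integral_smul_smul (ψ : ℝ × UnitAddCircle → ℝ) (c : ℝ) (u : L2Cyl F) :
    ∫ x, ψ x • (c • u : L2Cyl F) x ∂cylMeasure = c • ∫ x, ψ x • u x ∂cylMeasure := by
  rw [← integral_smul]
  refine integral_congr_ae ?_
  filter_upwards [Lp.coeFn_smul c u] with x hx
  simp only [hx, Pi.smul_apply]
  exact smul_comm _ _ _

lemma integral_smul_zero (ψ : ℝ × UnitAddCircle → ℝ) :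
    ∫ x, ψ x • (0 : L2Cyl F) x ∂cylMeasure = 0 := by
  rw [integral_eq_zero_of_ae]
  filter_upwards [Lp.coeFn_zero F 2 cylMeasure] with x hx
  rw [hx, Pi.zero_apply, smul_zero]

lemma HasWeakS.zero : HasWeakS (0 : L2Cyl F) 0 := fun φ _ => by
  rw [integral_smul_zero, integral_smul_zero, neg_zero]

lemma HasWeakT.zero : HasWeakT (0 : L2Cyl F) 0 := fun φ _ => by
  rw [integral_smul_zero, integral_smul_zero, neg_zero]

lemma HasWeakS.add {u u' v v' : L2Cyl F} (h : HasWeakS u v) (h' : HasWeakS u' v') :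
    HasWeakS (u + u') (v + v') := fun φ hφ => by
  rw [integral_smul_add hφ.1.continuous_partialS hφ.1.hasCompactSupport_partialS,
    integral_smul_add hφ.1.continuous hφ.1.2, h φ hφ, h' φ hφ, neg_add]

lemma HasWeakT.add {u u' v v' : L2Cyl F} (h : HasWeakT u v) (h' : HasWeakT u' v') :
    HasWeakT (u + u') (v + v') := fun φ hφ => by
  rw [integral_smul_add hφ.1.continuous_partialT hφ.1.hasCompactSupport_partialT,
    integral_smul_add hφ.1.continuous hφ.1.2, h φ hφ, h' φ hφ, neg_add]

lemma HasWeakS.smul {u v : L2Cyl F} (c : ℝ) (h : HasWeakS u v) :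
    HasWeakS (c • u) (c • v) := fun φ hφ => by
  rw [integral_smul_smul, integral_smul_smul, h φ hφ, smul_neg]

lemma HasWeakT.smul {u v : L2Cyl F} (c : ℝ) (h : HasWeakT u v) :
    HasWeakT (c • u) (c • v) := fun φ hφ => by
  rw [integral_smul_smul, integral_smul_smul, h φ hφ, smul_neg]

variable (F)

/-- The Sobolev space `H¹(ℝ⁻ × 𝕋, F)`. -/
def H1 : Submodule ℝ (L2Cyl F) where
  carrier := {u | (∃ v, HasWeakS u v) ∧ ∃ v, HasWeakT u v}
  zero_mem' := ⟨⟨0, HasWeakS.zero⟩, ⟨0, HasWeakT.zero⟩⟩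
  add_mem' := fun ⟨⟨_, h1⟩, ⟨_, h2⟩⟩ ⟨⟨_, h3⟩, ⟨_, h4⟩⟩ => ⟨⟨_, h1.add h3⟩, ⟨_, h2.add h4⟩⟩
  smul_mem' := fun c _ ⟨⟨_, h1⟩, ⟨_, h2⟩⟩ => ⟨⟨_, h1.smul c⟩, ⟨_, h2.smul c⟩⟩

/-- The Sobolev space `H²(ℝ⁻ × 𝕋, F)`: the first weak derivatives belong to `H¹`. -/
def H2 : Submodule ℝ (L2Cyl F) where
  carrier := {u | (∃ v ∈ H1 F, HasWeakS u v) ∧ ∃ v ∈ H1 F, HasWeakT u v}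
  zero_mem' := ⟨⟨0, zero_mem _, HasWeakS.zero⟩, ⟨0, zero_mem _, HasWeakT.zero⟩⟩
  add_mem' := fun ⟨⟨_, m1, h1⟩, ⟨_, m2, h2⟩⟩ ⟨⟨_, m3, h3⟩, ⟨_, m4, h4⟩⟩ =>
    ⟨⟨_, add_mem m1 m3, h1.add h3⟩, ⟨_, add_mem m2 m4, h2.add h4⟩⟩
  smul_mem' := fun c _ ⟨⟨_, m1, h1⟩, ⟨_, m2, h2⟩⟩ =>
    ⟨⟨_, Submodule.smul_mem _ c m1, h1.smul c⟩, ⟨_, Submodule.smul_mem _ c m2, h2.smul c⟩⟩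

variable {F}

/-- `g` is the trace `u(0,·)` on the boundary circle `{0} × 𝕋` of a function `u` with
`∂_s u ∈ L²`: Green's formula `∫_𝕋 φ(0,t) g(t) dt = ∫ (φ ∂_s u + ∂_s φ u) ds dt` holds for all
smooth functions `φ` with compact support on the closed half-cylinder. -/
def IsTrace (u : L2Cyl F) (g : L2Circ F) : Prop :=
  ∃ us : L2Cyl F, HasWeakS u us ∧ ∀ φ, IsTest φ →
    ∫ t, φ (0, t) • g t ∂(haarAddCircle (T := (1 : ℝ))) =
      ∫ x, (φ x • us x + partialS φ x • u x) ∂cylMeasure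

end Sobolev

/-- The `k`-th Fourier coefficient of the `i`-th component of `g ∈ L²(𝕋, ℝⁿ)`. -/
def coordFourier {n : ℕ} (g : L2Circ (EuclideanSpace ℝ (Fin n))) (i : Fin n) (k : ℤ) : ℂ :=
  fourierCoeff (T := (1 : ℝ)) (fun t => ((g t i : ℝ) : ℂ)) k

lemma integrable_coord {n : ℕ} (g : L2Circ (EuclideanSpace ℝ (Fin n))) (i : Fin n) :
    Integrable (fun t => ((g t i : ℝ) : ℂ)) (haarAddCircle (T := (1 : ℝ))) := by
  have h : Integrable g (haarAddCircle (T := (1 : ℝ))) := (Lp.memLp g).integrable (by norm_num)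
  have h2 := (Complex.ofRealCLM ∘L (EuclideanSpace.proj (𝕜 := ℝ) i)).integrable_comp h
  exact h2

lemma coordFourier_add {n : ℕ} (f g : L2Circ (EuclideanSpace ℝ (Fin n))) (i : Fin n) (k : ℤ) :
    coordFourier (f + g) i k = coordFourier f i k + coordFourier g i k := by
  have h := congrFun (fourierCoeff.add (integrable_coord f i) (integrable_coord g i)) k
  rw [Pi.add_apply] at h
  unfold coordFourier
  rw [← h]
  refine congrFun (fourierCoeff_congr_ae ?_) k
  filter_upwards [Lp.coeFn_add f g] with t ht
  rw [ht]
  simp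

lemma coordFourier_smul {n : ℕ} (c : ℝ) (g : L2Circ (EuclideanSpace ℝ (Fin n))) (i : Fin n)
    (k : ℤ) : coordFourier (c • g) i k = (c : ℂ) * coordFourier g i k := by
  unfold coordFourier
  rw [← smul_eq_mul, ← fourierCoeff.const_smul]
  refine congrFun (fourierCoeff_congr_ae ?_) k
  filter_upwards [Lp.coeFn_smul c g] with t ht
  simp [ht]

lemma coordFourier_zero {n : ℕ} (i : Fin n) (k : ℤ) :
    coordFourier (0 : L2Circ (EuclideanSpace ℝ (Fin n))) i k = 0 := by
  simpa using coordFourier_smul 0 (0 : L2Circ (EuclideanSpace ℝ (Fin n))) i k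

/-- The fractional Sobolev space `H^{1/2}(𝕋, ℝⁿ)`: the functions `g ∈ L²(𝕋, ℝⁿ)` whose Fourier
coefficients satisfy `∑_k |k| |ĝ(k)|² < ∞`. -/
def HHalf (n : ℕ) : Submodule ℝ (L2Circ (EuclideanSpace ℝ (Fin n))) where
  carrier := {g | ∀ i, Summable fun k : ℤ => |(k : ℝ)| * ‖coordFourier g i k‖ ^ 2}
  zero_mem' := fun i => by simp [coordFourier_zero]
  add_mem' := fun {f g} hf hg i => by
    refine Summable.of_nonneg_of_le (fun k => by positivity) (fun k => ?_)
      (((hf i).add (hg i)).mul_left 2)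
    rw [coordFourier_add]
    have h1 : ‖coordFourier f i k + coordFourier g i k‖ ^ 2 ≤
        2 * (‖coordFourier f i k‖ ^ 2 + ‖coordFourier g i k‖ ^ 2) :=
      (pow_le_pow_left₀ (norm_nonneg _) (norm_add_le _ _) 2).trans add_sq_le
    calc _ ≤ |(k : ℝ)| * (2 * (‖coordFourier f i k‖ ^ 2 + ‖coordFourier g i k‖ ^ 2)) := by gcongr
      _ = _ := by ring
  smul_mem' := fun c g hg i => by
    refine ((hg i).mul_left (c ^ 2)).congr fun k => ?_
    rw [coordFourier_smul, norm_mul, mul_pow, Complex.norm_real, Real.norm_eq_abs, sq_abs]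
    ring

/-! ### The operator `T` -/

/-- `T^*ℝⁿ = ℝⁿ × ℝⁿ = ℝ²ⁿ` with its Euclidean structure; the left summand of the index type
labels the coordinates `q` and the right one the coordinates `p`. The standard complex structure
`J₀ (q, p) = (-p, q)` is Mathlib's matrix `Matrix.J (Fin n) ℝ`. -/
abbrev PhaseSpace (n : ℕ) := EuclideanSpace ℝ (Fin n ⊕ Fin n)

/-- `L(ℝ²ⁿ)`. -/
abbrev PhaseMatrix (n : ℕ) := Matrix (Fin n ⊕ Fin n) (Fin n ⊕ Fin n) ℝ

/-- The projection `π (q, p) = q`. -/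
def proj {n : ℕ} (v : PhaseSpace n) : EuclideanSpace ℝ (Fin n) :=
  WithLp.toLp 2 fun i => v (Sum.inl i)

/-- `T` is the linear operator
`H²(ℝ⁻ × 𝕋, ℝ²ⁿ) → H¹(ℝ⁻ × 𝕋, ℝ²ⁿ) × H^{1/2}(𝕋, ℝⁿ)`,
`u ↦ (∂_s u + J ∂_t u - J A u, ∂_t (π ∘ u) (0,·) - α u(0,·))`, where `∂_s u = us`, `∂_t u = ut`
are weak derivatives and `g = u(0,·)`, `h = ∂_t u(0,·)` are traces. -/
def IsOperatorT {n : ℕ} (J A : ℝ × UnitAddCircle → PhaseMatrix n)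
    (α : UnitAddCircle → Matrix (Fin n) (Fin n ⊕ Fin n) ℝ)
    (T : H2 (PhaseSpace n) →ₗ[ℝ] H1 (PhaseSpace n) × HHalf n) : Prop :=
  ∀ u : H2 (PhaseSpace n), ∃ (us ut : L2Cyl (PhaseSpace n)) (g h : L2Circ (PhaseSpace n)),
    HasWeakS u.1 us ∧ HasWeakT u.1 ut ∧ IsTrace u.1 g ∧ IsTrace ut h ∧
    (∀ᵐ x ∂cylMeasure, (T u).1.1 x =
      us x + (J x).toEuclideanLin (ut x) - (J x).toEuclideanLin ((A x).toEuclideanLin (u.1 x))) ∧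
    (∀ᵐ t ∂(haarAddCircle (T := (1 : ℝ))), (T u).2.1 t =
      proj (h t) - (α t).toEuclideanLin (g t))

/-- The cokernel of a linear map. -/
abbrev Coker {V W : Type*} [AddCommGroup V] [Module ℝ V] [AddCommGroup W] [Module ℝ W]
    (T : V →ₗ[ℝ] W) := W ⧸ LinearMap.range T

/-- `ind T = dim ker T - dim coker T`, for an operator with finite dimensional kernel and
cokernel. -/
def index {V W : Type*} [AddCommGroup V] [Module ℝ V] [AddCommGroup W] [Module ℝ W]
    (T : V →ₗ[ℝ] W) : ℤ :=
  (Module.finrank ℝ (LinearMap.ker T) : ℤ) - (Module.finrank ℝ (Coker T) : ℤ)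

/-! ### The Conley-Zehnder index -/

/-- `W` solves `W'(t) = A(t) W(t)` on `[0,1]`, `W(0) = I`. -/
def IsFundamentalSolution {n : ℕ} (A W : ℝ → PhaseMatrix n) : Prop :=
  W 0 = 1 ∧ ∀ t ∈ Icc (0 : ℝ) 1, ∀ i j,
    HasDerivWithinAt (fun τ => W τ i j) ((A t * W t) i j) (Icc 0 1) t

/-- The complex determinant of the complex linear part `(M - J₀ M J₀) / 2` of `M`, as an
endomorphism of `ℂⁿ = ℝ²ⁿ`, `(q, p) ↦ q + i p`. If `M = U P` is the polar decomposition of a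
symplectic matrix, then this is a positive multiple of the determinant of the unitary `U`. -/
def complexDet {n : ℕ} (M : PhaseMatrix n) : ℂ :=
  Matrix.det (Matrix.of fun i j : Fin n =>
    (⟨(M (.inl i) (.inl j) + M (.inr i) (.inr j)) / 2,
      (M (.inr i) (.inl j) - M (.inl i) (.inr j)) / 2⟩ : ℂ))

/-- The symplectic matrix `diag(2, -1, …, -1, 1/2, -1, …, -1)`. -/
def refMatrix (n : ℕ) : PhaseMatrix n :=
  Matrix.diagonal (Sum.elim (fun i => if i.val = 0 then 2 else -1)
    (fun i => if i.val = 0 then 1 / 2 else -1))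

/-- `k` is the Conley-Zehnder index of the path `W : [0,1] → Sp(2n)`, with `W(0) = I` and `1` not
an eigenvalue of `W(1)`: extend `W` to a continuous symplectic path `γ` on `[0,2]` such that `1` is
not an eigenvalue of `γ(t)` for `t ∈ [1,2]` and `γ(2)` is one of the reference matrices `-I`,
`diag(2, -1, …, -1, 1/2, -1, …, -1)`; then `-k` is the number of half-turns made on `[0,2]` by the
unit complex number `det_ℂ U(t)`, `U(t)` being the unitary part of `γ(t)`, where `θ` is a continuous
argument of this number. The sign convention is the one for which `t ↦ e^{-a t J₀}` has index `1`
when `n = 1` and `0 < a < 2π`. -/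
def HasConleyZehnderIndex {n : ℕ} (W : ℝ → PhaseMatrix n) (k : ℤ) : Prop :=
  W 0 = 1 ∧ ∃ (γ : ℝ → PhaseMatrix n) (θ : ℝ → ℝ),
    ContinuousOn γ (Icc 0 2) ∧ ContinuousOn θ (Icc 0 2) ∧
    (∀ t ∈ Icc (0 : ℝ) 1, γ t = W t) ∧
    (∀ t ∈ Icc (0 : ℝ) 2, γ t ∈ Matrix.symplecticGroup (Fin n) ℝ) ∧
    (∀ t ∈ Icc (1 : ℝ) 2, (γ t - 1).det ≠ 0) ∧
    (γ 2 = -1 ∨ γ 2 = refMatrix n) ∧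
    (∀ t ∈ Icc (0 : ℝ) 2,
      complexDet (γ t) = (‖complexDet (γ t)‖ : ℂ) * Complex.exp (θ t * Complex.I)) ∧
    θ 2 - θ 0 = -(k : ℝ) * Real.pi

end HalfCylinder

end

open HalfCylinder

noncomputable section

namespace HalfCylinder

open Filter Topology
open scoped ContDiff ComplexConjugate InnerProductSpace

/-! ### Functions on the half-line -/

/-! Both matrices satisfy `J₀A = a + b (q ↔ p)`, with `b = 0` in case (i) and `a = 0`, `b = 1` in
case (ii). Expanding in `e^{2πikt}` turns `T u = (f, h)` into independent systems on the half-line,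
`q' = a q + z p + f_q`, `p' = z̄ q + a p + f_p` with `z = 2πik + b`, together with `2πik q(0) =
ĥ(k)`. The Hermitian matrix of the system has eigenvalues `a ± |z|` and eigencoordinates `q ± ζ p`,
where `ζ` is the phase of `z`. In them each mode becomes two scalar equations `w' = l w + F` in
`L²(ℝ⁻)`, coupled only by the boundary condition, which reads `πik (c₊ + c₋) = ĥ(k)` for the
boundary values `c±`.

A scalar equation with `l > 0` is solvable for every boundary value, the homogeneous solutions being
multiples of `e^{ls}`. With `l < 0` it has exactly one solution, whose boundary value is forced to
be `⟨e^{-ls}, F⟩`. Hence a mode `k ≠ 0` is uniquely solvable if the eigenvalues have opposite signs,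
has one complex dimension of kernel if both are positive, and one complex obstruction if both are
negative. In the mode `0` the boundary condition degenerates to `ĥ(0) = 0`, one real obstruction,
and each positive eigenvalue gives one real dimension of kernel. Since `u` is real, the mode `-k` is
conjugate to the mode `k`, so only `k ≥ 1` counts, with real weight `2`. This is
`finrank_ker_coker`; the rest of the dimension count is the list of signs of `a ± |z|`.

Solutions built mode by mode must lie in `H²`. For `|k|` large the eigenvalues have opposite signs
and modulus at least `|k|`, and energy estimates bound `k⁴ ‖u_k‖²` by `|k| |ĥ(k)|²` and `k² ‖f_k‖²`,
which are summable exactly because `h ∈ H^{1/2}` and `f ∈ H¹` (`solution_pair_estimate`,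
`exists_modeRel`). The equation then supplies the `s`-derivatives (`mem_H2_of_modes`).

For the index, a planar symplectic `M` with complex determinant `D` satisfies `det (M - 1) = 2 - 2
Re D` and `|D| ≥ 1`. On the nondegenerate part of an extended path `Re D - 1` keeps its sign, which
confines the argument and fixes its final value (`arg_end_of_lt_one`, `arg_end_of_one_lt`). -/

/-- The primitives of the real and imaginary parts are absolutely continuous; they are recombined
along `1` and `I`. -/
lemma absolutelyContinuousOnInterval_integral {f : ℝ → ℂ} {a b : ℝ}
    (h : IntervalIntegrable f volume a b) :
    AbsolutelyContinuousOnInterval (fun x => ∫ σ in b..x, f σ) a b := by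
  have hre : IntervalIntegrable (fun s => (f s).re) volume a b := by
    rw [intervalIntegrable_iff] at h ⊢
    exact Complex.reCLM.integrable_comp h
  have him : IntervalIntegrable (fun s => (f s).im) volume a b := by
    rw [intervalIntegrable_iff] at h ⊢
    exact Complex.imCLM.integrable_comp h
  have acc : ∀ e : ℂ, AbsolutelyContinuousOnInterval (fun _ : ℝ => e) a b := fun e =>
    (contDiffOn_const).absolutelyContinuousOnInterval
  have h1 := (hre.absolutelyContinuousOnInterval_intervalIntegral
    (c := b) right_mem_uIcc).fun_smul (acc 1)
  have h2 := (him.absolutelyContinuousOnInterval_intervalIntegral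
    (c := b) right_mem_uIcc).fun_smul (acc Complex.I)
  have h3 := h1.fun_add h2
  refine (absolutelyContinuousOnInterval_iff _ _ _).2 fun ε hε => ?_
  obtain ⟨δ, hδ, H⟩ := (absolutelyContinuousOnInterval_iff _ _ _).1 h3 ε hε
  refine ⟨δ, hδ, fun E hE hE' => lt_of_eq_of_lt (Finset.sum_congr rfl fun i hi => ?_) (H E hE hE')⟩
  have key : ∀ x ∈ uIcc a b, ∫ σ in b..x, f σ =
      (∫ σ in b..x, (f σ).re) • (1 : ℂ) + (∫ σ in b..x, (f σ).im) • Complex.I := by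
    intro x hx
    have hi : IntervalIntegrable f volume b x := h.mono_set (uIcc_subset_uIcc right_mem_uIcc hx)
    have r1 := Complex.reCLM.intervalIntegral_comp_comm hi
    have r2 := Complex.imCLM.intervalIntegral_comp_comm hi
    simp only [Complex.reCLM_apply, Complex.imCLM_apply] at r1 r2
    rw [r1, r2]
    apply Complex.ext <;> simp
  have hm := hE.1 i (Finset.mem_range.1 hi |> Finset.mem_range.2)
  rw [key _ hm.1, key _ hm.2]

/-- Product rule for absolutely continuous functions. -/
lemma AbsolutelyContinuousOnInterval.integral_mul_add_mul {Y Z v w : ℝ → ℂ} {a b : ℝ}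
    (acY : AbsolutelyContinuousOnInterval Y a b) (acZ : AbsolutelyContinuousOnInterval Z a b)
    (hv : IntervalIntegrable v volume a b) (hw : IntervalIntegrable w volume a b)
    (dY : ∀ᵐ x, x ∈ uIcc a b → HasDerivAt Y (v x) x)
    (dZ : ∀ᵐ x, x ∈ uIcc a b → HasDerivAt Z (w x) x) :
    ∫ s in a..b, (v s * Z s + Y s * w s) = Y b * Z b - Y a * Z a := by
  have hg : IntervalIntegrable (fun s => v s * Z s + Y s * w s) volume a b :=
    (hv.mul_continuousOn acZ.continuousOn).add (hw.continuousOn_mul acY.continuousOn)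
  have acG : AbsolutelyContinuousOnInterval (fun s => ∫ σ in b..s, (v σ * Z σ + Y σ * w σ)) a b :=
    absolutelyContinuousOnInterval_integral hg
  -- `Y Z` minus the primitive of its almost everywhere derivative is absolutely continuous with
  -- zero derivative, hence constant.
  obtain ⟨C, hC⟩ := ((acY.fun_smul acZ).fun_sub acG).const_of_ae_hasDerivAt_zero (by
    filter_upwards [dY, dZ, hg.ae_hasDerivAt_integral] with x h1 h2 h3 hx
    refine (((h1 hx).mul (h2 hx)).sub (h3 hx b (by simp))).congr_deriv ?_
    ring)
  have ha := hC a (by simp)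
  rw [← hC b (by simp)] at ha
  simp only [intervalIntegral.integral_same, smul_eq_mul, sub_zero] at ha
  rw [← ha, intervalIntegral.integral_symm a b]
  ring

/-- Product rule for two primitives on a compact interval. -/
lemma integral_primitive_mul {v w : ℝ → ℂ} {a b : ℝ} (hv : IntervalIntegrable v volume a b)
    (hw : IntervalIntegrable w volume a b) (c d : ℂ) :
    ∫ s in a..b, (v s * (d + ∫ σ in b..s, w σ) + (c + ∫ σ in b..s, v σ) * w s) =
      c * d - (c + ∫ σ in b..a, v σ) * (d + ∫ σ in b..a, w σ) := by
  have acc : ∀ e : ℂ, AbsolutelyContinuousOnInterval (fun _ : ℝ => e) a b := fun e =>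
    (contDiffOn_const).absolutelyContinuousOnInterval
  have acY : AbsolutelyContinuousOnInterval (fun s => c + ∫ σ in b..s, v σ) a b :=
    (acc c).fun_add (absolutelyContinuousOnInterval_integral hv)
  have acZ : AbsolutelyContinuousOnInterval (fun s => d + ∫ σ in b..s, w σ) a b :=
    (acc d).fun_add (absolutelyContinuousOnInterval_integral hw)
  have dY : ∀ᵐ x, x ∈ uIcc a b → HasDerivAt (fun s => c + ∫ σ in b..s, v σ) (v x) x := by
    filter_upwards [hv.ae_hasDerivAt_integral] with x h1 hx
    exact (h1 hx b (by simp)).const_add c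
  have dZ : ∀ᵐ x, x ∈ uIcc a b → HasDerivAt (fun s => d + ∫ σ in b..s, w σ) (w x) x := by
    filter_upwards [hw.ae_hasDerivAt_integral] with x h1 hx
    exact (h1 hx b (by simp)).const_add d
  have h := AbsolutelyContinuousOnInterval.integral_mul_add_mul acY acZ hv hw dY dZ
  rw [intervalIntegral.integral_same, intervalIntegral.integral_same, add_zero, add_zero] at h
  exact h

/-! ### Weak derivatives and boundary values on the half-line. -/

/-- `L²(ℝ⁻, ℂ)`. -/
abbrev LHalf := Lp ℂ 2 (volume.restrict (Iic (0 : ℝ)))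

lemma intervalIntegrable_LHalf (v : LHalf) {a b : ℝ} (ha : a ≤ 0) (hb : b ≤ 0) :
    IntervalIntegrable v volume a b := by
  have h := (Lp.memLp v).locallyIntegrable (by norm_num)
  rw [intervalIntegrable_iff]
  have h2 := h.integrableOn_isCompact (k := uIcc a b) isCompact_uIcc
  have h3 : IntegrableOn v (uIoc a b) (volume.restrict (Iic (0 : ℝ))) :=
    h2.mono_set uIoc_subset_uIcc
  rwa [IntegrableOn, Measure.restrict_restrict measurableSet_uIoc,
    inter_eq_left.2 (fun x hx => ?_)] at h3
  rcases mem_uIoc.1 hx with h | h <;> simp only [mem_Iic] <;> linarith [h.1, h.2]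

/-- `y` is represented by the primitive of `v` with value `c` at `0`. -/
def IsPrimitive (y v : LHalf) (c : ℂ) : Prop :=
  ∀ᵐ s ∂(volume.restrict (Iic (0 : ℝ))), y s = c + ∫ σ in (0 : ℝ)..s, v σ

/-- No decay of `G` is assumed: integrability of `g` makes `G` converge at `-∞`, and an integrable
function can only converge to `0` there, because the half-lines have infinite measure. -/
lemma integral_Iic_of_primitive {G g : ℝ → ℂ} {c : ℂ} (hG : IntegrableOn G (Iic 0))
    (hg : IntegrableOn g (Iic 0)) (h : ∀ s ≤ 0, ∫ σ in s..0, g σ = c - G s) :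
    ∫ s in Iic 0, g s = c := by
  have h1 := intervalIntegral_tendsto_integral_Iic 0 hg tendsto_id
  have h2 : Tendsto (fun s => c - ∫ σ in s..0, g σ) atBot (𝓝 (c - ∫ s in Iic 0, g s)) :=
    tendsto_const_nhds.sub h1
  have h3 : Tendsto G atBot (𝓝 (c - ∫ s in Iic 0, g s)) := by
    refine h2.congr' ?_
    filter_upwards [eventually_le_atBot (0 : ℝ)] with s hs
    rw [h s hs]; ring
  have h4 : IntegrableAtFilter G atBot := ⟨Iic 0, Iic_mem_atBot 0, hG⟩
  have h5 := h4.eq_zero_of_tendsto (fun s hs => ?_) h3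
  · exact (sub_eq_zero.1 h5).symm
  · obtain ⟨a, ha⟩ := mem_atBot_sets.1 hs
    refine top_unique ?_
    calc ⊤ = volume (Iic a) := by simp
      _ ≤ _ := measure_mono ha

lemma intervalIntegrable_conj_LHalf (v : LHalf) {a b : ℝ} (ha : a ≤ 0) (hb : b ≤ 0) :
    IntervalIntegrable (fun s => conj (v s)) volume a b := by
  have := intervalIntegrable_LHalf v ha hb
  rw [intervalIntegrable_iff] at this ⊢
  exact (Complex.conjCLE : ℂ →L[ℝ] ℂ).integrable_comp this

/-- Green's formula on the half-line. -/
lemma IsPrimitive.inner_add_inner {y v y' v' : LHalf} {c c' : ℂ} (h : IsPrimitive y v c)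
    (h' : IsPrimitive y' v' c') : ⟪y, v'⟫_ℂ + ⟪v, y'⟫_ℂ = conj c * c' := by
  have i1 := L2.integrable_inner (𝕜 := ℂ) y v'
  have i2 := L2.integrable_inner (𝕜 := ℂ) v y'
  have i3 := L2.integrable_inner (𝕜 := ℂ) y y'
  rw [L2.inner_def, L2.inner_def, ← integral_add i1 i2]
  have e : (fun s => ⟪y s, v' s⟫_ℂ + ⟪v s, y' s⟫_ℂ) =ᵐ[volume.restrict (Iic (0 : ℝ))]
      fun s => conj (v s) * (c' + ∫ σ in (0 : ℝ)..s, v' σ) +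
        (conj c + ∫ σ in (0 : ℝ)..s, conj (v σ)) * v' s := by
    filter_upwards [h, h'] with s h1 h2
    rw [intervalIntegral.intervalIntegral_conj]
    simp only [RCLike.inner_apply, h1, h2, map_add]
    ring
  have e3 : (fun s => ⟪y s, y' s⟫_ℂ) =ᵐ[volume.restrict (Iic (0 : ℝ))]
      fun s => (conj c + ∫ σ in (0 : ℝ)..s, conj (v σ)) * (c' + ∫ σ in (0 : ℝ)..s, v' σ) := by
    filter_upwards [h, h'] with s h1 h2
    rw [intervalIntegral.intervalIntegral_conj]
    simp only [RCLike.inner_apply, h1, h2, map_add]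
    ring
  rw [integral_congr_ae e]
  refine integral_Iic_of_primitive (i3.congr e3) ((i1.add i2).congr e) fun s hs => ?_
  exact integral_primitive_mul (intervalIntegrable_conj_LHalf v hs le_rfl)
    (intervalIntegrable_LHalf v' hs le_rfl) _ _

/-- Smooth compactly supported functions on the line. -/
def IsTestLine (χ : ℝ → ℝ) : Prop := ContDiff ℝ ∞ χ ∧ HasCompactSupport χ

namespace IsTestLine

variable {χ : ℝ → ℝ}

lemma deriv (h : IsTestLine χ) : IsTestLine (deriv χ) :=
  ⟨(contDiff_infty_iff_deriv.1 h.1).2, h.2.deriv⟩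

lemma memLp (h : IsTestLine χ) :
    MemLp (fun s => (χ s : ℂ)) 2 (volume.restrict (Iic (0 : ℝ))) := by
  have : MemLp χ 2 (volume.restrict (Iic (0 : ℝ))) := h.1.continuous.memLp_of_hasCompactSupport h.2
  exact this.ofReal

/-- A test function as an element of `L²(ℝ⁻, ℂ)`. -/
def toLp (h : IsTestLine χ) : LHalf := h.memLp.toLp _

lemma coeFn_toLp (h : IsTestLine χ) :
    h.toLp =ᵐ[volume.restrict (Iic (0 : ℝ))] fun s => (χ s : ℂ) := MemLp.coeFn_toLp _

lemma inner_toLp (h : IsTestLine χ) (y : LHalf) :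
    ⟪h.toLp, y⟫_ℂ = ∫ s in Iic (0 : ℝ), χ s • y s := by
  rw [L2.inner_def]
  refine integral_congr_ae ?_
  filter_upwards [h.coeFn_toLp] with s hs
  simp [hs, mul_comm]

lemma isPrimitive (h : IsTestLine χ) : IsPrimitive h.toLp h.deriv.toLp (χ 0) := by
  filter_upwards [h.coeFn_toLp, ae_restrict_mem measurableSet_Iic] with s hs hs0
  rw [hs]
  have e : ∫ σ in (0 : ℝ)..s, h.deriv.toLp σ = ∫ σ in (0 : ℝ)..s, ((_root_.deriv χ σ : ℝ) : ℂ) := by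
    refine intervalIntegral.integral_congr_ae ?_
    have := (ae_restrict_iff' measurableSet_Iic).1 h.deriv.coeFn_toLp
    filter_upwards [this] with x hx hx'
    refine hx ?_
    rcases mem_uIoc.1 hx' with h | h <;> simp only [mem_Iic] at * <;> linarith [h.1, h.2]
  rw [e, intervalIntegral.integral_ofReal, intervalIntegral.integral_deriv_eq_sub
    (fun x _ => (h.1.differentiable (by simp)) x)
    (h.deriv.1.continuous.intervalIntegrable _ _)]
  push_cast; ring

end IsTestLine

/-- `v` is the weak derivative of `y` and `c` the boundary value of `y` at `0`. -/
def HasDerivTrace (y v : LHalf) (c : ℂ) : Prop :=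
  ∀ χ (h : IsTestLine χ), ⟪h.deriv.toLp, y⟫_ℂ + ⟪h.toLp, v⟫_ℂ = χ 0 * c

lemma IsPrimitive.hasDerivTrace {y v : LHalf} {c : ℂ} (h : IsPrimitive y v c) :
    HasDerivTrace y v c := fun χ hχ => by
  have := hχ.isPrimitive.inner_add_inner h
  rw [add_comm, this, Complex.conj_ofReal]

lemma exists_isTestLine (s ε : ℝ) (hε : 0 < ε) :
    ∃ χ, IsTestLine χ ∧ tsupport χ ⊆ Icc (s - ε) (s + ε) ∧ χ s = 1 ∧ ∀ x, 0 ≤ χ x := by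
  let f : ContDiffBump s := ⟨ε / 2, ε, by positivity, by linarith⟩
  refine ⟨f, ⟨f.contDiff, f.hasCompactSupport⟩, ?_, f.one_of_mem_closedBall (by simp [f.rIn_pos.le]),
    fun x => f.nonneg⟩
  rw [f.tsupport_eq, Real.closedBall_eq_Icc]

lemma locallyIntegrable_LHalf (y : LHalf) :
    LocallyIntegrable y (volume.restrict (Iic (0 : ℝ))) :=
  (Lp.memLp y).locallyIntegrable (by norm_num)

/-- The boundary point is a null set, so information from test functions supported in the open
half-line is enough. -/
lemma ae_half_iff {p : ℝ → Prop} :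
    (∀ᵐ s ∂(volume.restrict (Iic (0 : ℝ))), p s) ↔
      ∀ᵐ s ∂(volume.restrict (Iic (0 : ℝ))), s ∈ Iio (0 : ℝ) → p s := by
  rw [← restrict_Iio_eq_restrict_Iic, ae_restrict_iff' measurableSet_Iio,
    ae_restrict_iff' measurableSet_Iio]
  refine eventually_congr (Eventually.of_forall fun s => ?_)
  tauto

/-- The fundamental lemma of the calculus of variations. -/
lemma eq_zero_of_inner_test {y : LHalf}
    (h : ∀ χ (hχ : IsTestLine χ), tsupport χ ⊆ Iio 0 → ⟪hχ.toLp, y⟫_ℂ = 0) : y = 0 := by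
  refine (Lp.eq_zero_iff_ae_eq_zero).2 ?_
  refine ae_half_iff.2 ?_
  refine isOpen_Iio.ae_eq_zero_of_integral_contDiff_smul_eq_zero
    ((locallyIntegrable_LHalf y).locallyIntegrableOn _) fun χ h1 h2 h3 => ?_
  rw [← IsTestLine.inner_toLp ⟨h1, h2⟩, h χ ⟨h1, h2⟩ h3]

/-- A test function with vanishing integral has a primitive which is a test function. -/
lemma exists_isTestLine_deriv_eq {χ : ℝ → ℝ} (h : IsTestLine χ) (hs : tsupport χ ⊆ Iio 0)
    (h0 : ∫ s, χ s = 0) : ∃ ψ, IsTestLine ψ ∧ tsupport ψ ⊆ Iio 0 ∧ deriv ψ = χ := by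
  have hd : ∀ x, HasDerivAt (fun s => ∫ σ in (0 : ℝ)..s, χ σ) (χ x) x := fun x =>
    intervalIntegral.integral_hasDerivAt_right (h.1.continuous.intervalIntegrable _ _)
      h.1.continuous.stronglyMeasurable.stronglyMeasurableAtFilter h.1.continuous.continuousAt
  have hde : deriv (fun s => ∫ σ in (0 : ℝ)..s, χ σ) = χ := funext fun x => (hd x).deriv
  have hcd : ContDiff ℝ ∞ (fun s => ∫ σ in (0 : ℝ)..s, χ σ) :=
    contDiff_infty_iff_deriv.2 ⟨fun x => (hd x).differentiableAt, by rw [hde]; exact h.1⟩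
  obtain ⟨m, M, hmM, hM0⟩ : ∃ m M : ℝ, tsupport χ ⊆ Icc m M ∧ M < 0 := by
    rcases (tsupport χ).eq_empty_or_nonempty with he | hne
    -- For an empty support, the empty interval from `0` to `-1` serves.
    · exact ⟨0, -1, by simp [he], by norm_num⟩
    · have hc : IsCompact (tsupport χ) := h.2
      obtain ⟨M, hM⟩ := hc.exists_isGreatest hne
      obtain ⟨m, hm⟩ := hc.exists_isLeast hne
      exact ⟨m, M, fun x hx => ⟨hm.2 hx, hM.2 hx⟩, hs hM.1⟩
  have hz : ∀ x, x ∉ Icc m M → χ x = 0 := fun x hx =>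
    image_eq_zero_of_notMem_tsupport fun hx' => hx (hmM hx')
  have hsupp : ∀ x, x ∉ Icc m M → (∫ σ in (0 : ℝ)..x, χ σ) = 0 := by
    intro x hx
    by_cases hxM : M < x
    · refine intervalIntegral.integral_zero_ae (Eventually.of_forall fun y hy => hz y fun hy' => ?_)
      rcases mem_uIoc.1 hy with h | h <;> linarith [h.1, h.2, hy'.2]
    · have hxm : x < m := by
        by_contra hc
        exact hx ⟨not_lt.1 hc, not_lt.1 hxM⟩
      by_cases hmM' : m ≤ M
      · rw [intervalIntegral.integral_symm, intervalIntegral.integral_eq_integral_of_support_subset,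
          h0, neg_zero]
        intro y hy
        have hy' : y ∈ Icc m M := by
          by_contra hc
          exact hy (hz y hc)
        exact ⟨by linarith [hy'.1], by linarith [hy'.2]⟩
      · have : ∀ y, χ y = 0 := fun y => hz y (by simp [hmM'])
        simp [this]
  have hts : tsupport (fun s => ∫ σ in (0 : ℝ)..s, χ σ) ⊆ Icc m M :=
    closure_minimal (fun x hx => by_contra fun hc => hx (hsupp x hc)) isClosed_Icc
  exact ⟨_, ⟨hcd, HasCompactSupport.intro isCompact_Icc hsupp⟩,
    hts.trans fun x hx => lt_of_le_of_lt hx.2 hM0, hde⟩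

/-- Cutting `v` off at `0` makes its primitive continuous on the whole line, so it can be multiplied
by test functions without restriction. -/
lemma continuous_primitive_LHalf (v : LHalf) :
    Continuous fun s => ∫ σ in (0 : ℝ)..s, (Iic (0 : ℝ)).indicator v σ := by
  refine intervalIntegral.continuous_primitive (fun a b => ?_) 0
  rw [intervalIntegrable_iff, integrableOn_indicator_iff measurableSet_Iic]
  have h2 := (locallyIntegrable_LHalf v).integrableOn_isCompact (k := uIcc a b) isCompact_uIcc
  have h3 : IntegrableOn v (uIoc a b) (volume.restrict (Iic (0 : ℝ))) :=
    h2.mono_set uIoc_subset_uIcc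
  rwa [IntegrableOn, Measure.restrict_restrict measurableSet_uIoc, inter_comm] at h3

lemma primitive_indicator (v : LHalf) {s : ℝ} (hs : s ≤ 0) :
    ∫ σ in (0 : ℝ)..s, (Iic (0 : ℝ)).indicator v σ = ∫ σ in (0 : ℝ)..s, v σ := by
  refine intervalIntegral.integral_congr fun x hx => ?_
  rw [uIcc_of_ge hs] at hx
  exact indicator_of_mem (by simpa using hx.2) _

/-- There is no boundary term even if `χ 0 ≠ 0`, since the primitive itself vanishes at `0`. -/
lemma integral_deriv_smul_primitive {χ : ℝ → ℝ} (h : IsTestLine χ) (v : LHalf) :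
    ∫ s in Iic (0 : ℝ), deriv χ s • (∫ σ in (0 : ℝ)..s, (Iic (0 : ℝ)).indicator v σ) =
      - ∫ s in Iic (0 : ℝ), χ s • v s := by
  have hV := continuous_primitive_LHalf v
  have i1 : IntegrableOn
      (fun s => deriv χ s • (∫ σ in (0 : ℝ)..s, (Iic (0 : ℝ)).indicator v σ)) (Iic 0) :=
    ((h.deriv.1.continuous.smul hV).integrable_of_hasCompactSupport h.deriv.2.smul_right).integrableOn
  have i2 : IntegrableOn (fun s => χ s • v s) (Iic 0) :=
    memLp_one_iff_integrable.1 ((Lp.memLp v).smul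
      (h.1.continuous.memLp_of_hasCompactSupport h.2 (p := 2)))
  have i3 : IntegrableOn
      (fun s => χ s • (∫ σ in (0 : ℝ)..s, (Iic (0 : ℝ)).indicator v σ)) (Iic 0) :=
    ((h.1.continuous.smul hV).integrable_of_hasCompactSupport h.2.smul_right).integrableOn
  rw [← add_eq_zero_iff_eq_neg, ← integral_add i1 i2]
  refine integral_Iic_of_primitive i3 (i1.add i2) fun s hs => ?_
  have hχ : IntervalIntegrable (fun σ => ((deriv χ σ : ℝ) : ℂ)) volume s 0 :=
    (Complex.continuous_ofReal.comp h.deriv.1.continuous).intervalIntegrable _ _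
  have hp : ∀ x, ((χ 0 : ℝ) : ℂ) + ∫ σ in (0 : ℝ)..x, ((deriv χ σ : ℝ) : ℂ) = χ x := fun x => by
    rw [intervalIntegral.integral_ofReal, intervalIntegral.integral_deriv_eq_sub
      (fun x _ => (h.1.differentiable (by simp)) x)
      (h.deriv.1.continuous.intervalIntegrable _ _)]
    push_cast; ring
  have := integral_primitive_mul hχ (intervalIntegrable_LHalf v hs le_rfl) (χ 0) 0
  simp only [hp, zero_add, mul_zero, zero_sub] at this
  rw [zero_sub, Complex.real_smul, primitive_indicator v hs, ← this]
  refine intervalIntegral.integral_congr fun x hx => ?_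
  rw [uIcc_of_le hs] at hx
  simp only [Complex.real_smul]
  rw [primitive_indicator v hx.2]

/-- The du Bois-Reymond lemma. -/
lemma exists_isPrimitive {y v : LHalf}
    (h : ∀ χ (hχ : IsTestLine χ), tsupport χ ⊆ Iio 0 →
      ⟪hχ.deriv.toLp, y⟫_ℂ + ⟪hχ.toLp, v⟫_ℂ = 0) : ∃ c, IsPrimitive y v c := by
  set V : ℝ → ℂ := fun s => ∫ σ in (0 : ℝ)..s, (Iic (0 : ℝ)).indicator v σ with hV
  have hVc : Continuous V := continuous_primitive_LHalf v
  have iy : ∀ χ, IsTestLine χ → IntegrableOn (fun s => χ s • y s) (Iic 0) := fun χ hχ =>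
    memLp_one_iff_integrable.1 ((Lp.memLp y).smul
      (hχ.1.continuous.memLp_of_hasCompactSupport hχ.2 (p := 2)))
  have iV : ∀ χ, IsTestLine χ → IntegrableOn (fun s => χ s • V s) (Iic 0) := fun χ hχ =>
    ((hχ.1.continuous.smul hVc).integrable_of_hasCompactSupport hχ.2.smul_right).integrableOn
  have ic : ∀ χ (c : ℂ), IsTestLine χ → IntegrableOn (fun s => χ s • c) (Iic 0) := fun χ c hχ =>
    ((hχ.1.continuous.smul continuous_const).integrable_of_hasCompactSupport
      hχ.2.smul_right).integrableOn
  have h1 : ∀ χ, IsTestLine χ → tsupport χ ⊆ Iio 0 →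
      ∫ s in Iic (0 : ℝ), deriv χ s • (y s - V s) = 0 := by
    intro χ hχ hs
    have := h χ hχ hs
    rw [IsTestLine.inner_toLp, IsTestLine.inner_toLp] at this
    simp only [smul_sub]
    rw [integral_sub (iy _ hχ.deriv) (iV _ hχ.deriv), integral_deriv_smul_primitive hχ, sub_neg_eq_add,
      this]
  -- A reference bump supported in `[-3, -1]`. The constant is the mean of `y - V` against this bump
  -- normalized to have integral one.
  obtain ⟨χ₁, hχ₁, hs₁, h1₁, hp₁⟩ := exists_isTestLine (-2) 1 one_pos
  have hpos : 0 < ∫ s, χ₁ s :=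
    hχ₁.1.continuous.integral_pos_of_hasCompactSupport_nonneg_nonzero hχ₁.2 hp₁
      (x := -2) (by rw [h1₁]; exact one_ne_zero)
  set m := ∫ s, χ₁ s with hm
  have hs₁' : tsupport χ₁ ⊆ Iio 0 := hs₁.trans fun x hx => by
    simp only [mem_Iio]; linarith [hx.2]
  refine ⟨m⁻¹ • ∫ s in Iic (0 : ℝ), χ₁ s • (y s - V s), ?_⟩
  set c : ℂ := m⁻¹ • ∫ s in Iic (0 : ℝ), χ₁ s • (y s - V s) with hc
  have hint : ∀ χ : ℝ → ℝ, tsupport χ ⊆ Iio (0 : ℝ) → ∫ s in Iic (0 : ℝ), χ s = ∫ s, χ s := fun χ hs =>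
    setIntegral_eq_integral_of_forall_compl_eq_zero fun x hx =>
      image_eq_zero_of_notMem_tsupport fun hx' => hx (mem_Iic.2 (le_of_lt (hs hx')))
  have key : ∀ χ, IsTestLine χ → tsupport χ ⊆ Iio 0 →
      ∫ s in Iic (0 : ℝ), χ s • (y s - V s - c) = 0 := by
    intro χ hχ hs
    -- `χ - r χ₁` has integral zero, so it is the derivative of a test function and `h1` applies to
    -- it.
    set r := (∫ s, χ s) * m⁻¹ with hr
    have hD : IsTestLine (fun s => χ s - r * χ₁ s) := by
      refine ⟨hχ.1.sub (contDiff_const.mul hχ₁.1), ?_⟩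
      exact HasCompactSupport.sub hχ.2 hχ₁.2.mul_left
    have hDs : tsupport (fun s => χ s - r * χ₁ s) ⊆ Iio 0 := by
      refine (tsupport_sub _ _).trans (union_subset hs ?_)
      exact (closure_mono (Function.support_mul_subset_right _ _)).trans hs₁'
    obtain ⟨ψ, hψ, hψs, hψd⟩ := exists_isTestLine_deriv_eq hD hDs (by
      rw [integral_sub (hχ.1.continuous.integrable_of_hasCompactSupport hχ.2)
        ((hχ₁.1.continuous.integrable_of_hasCompactSupport hχ₁.2).const_mul r),
        integral_const_mul, ← hm, hr]
      field_simp
      ring)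
    have h2 := h1 ψ hψ hψs
    rw [hψd] at h2
    have i3 : IntegrableOn (fun s => χ s • (y s - V s)) (Iic 0) := by
      simp only [smul_sub]; exact (iy χ hχ).sub (iV χ hχ)
    have i4 : IntegrableOn (fun s => χ₁ s • (y s - V s)) (Iic 0) := by
      simp only [smul_sub]; exact (iy χ₁ hχ₁).sub (iV χ₁ hχ₁)
    simp only [sub_smul, mul_smul] at h2
    rw [integral_sub i3 (Integrable.fun_smul r i4), integral_smul] at h2
    simp only [smul_sub (χ _) _ c]
    rw [integral_sub i3 (ic χ c hχ), integral_smul_const, hint χ hs, hc, smul_smul, ← hr]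
    exact h2
  have := isOpen_Iio.ae_eq_zero_of_integral_contDiff_smul_eq_zero (U := Iio (0 : ℝ))
    (μ := volume.restrict (Iic (0 : ℝ))) (f := fun s => y s - V s - c) (by
      refine LocallyIntegrable.locallyIntegrableOn ?_ _
      exact ((locallyIntegrable_LHalf y).sub hVc.locallyIntegrable).sub
        (continuous_const.locallyIntegrable))
    fun χ a b d => key χ ⟨a, b⟩ d
  filter_upwards [ae_half_iff.2 this, ae_restrict_mem measurableSet_Iic] with s hs hs0
  rw [← primitive_indicator v hs0]
  linear_combination hs

/-- Test functions supported in the open half-line give a primitive with some constant; a bump equal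
to `1` at `0` then identifies this constant with `c`. -/
lemma hasDerivTrace_iff {y v : LHalf} {c : ℂ} : HasDerivTrace y v c ↔ IsPrimitive y v c := by
  refine ⟨fun h => ?_, IsPrimitive.hasDerivTrace⟩
  obtain ⟨c', hc'⟩ := exists_isPrimitive fun χ hχ hs => by
    rw [h χ hχ, image_eq_zero_of_notMem_tsupport fun h0 => lt_irrefl (0 : ℝ) (mem_Iio.1 (hs h0))]; simp
  obtain ⟨χ, hχ, -, h1, -⟩ := exists_isTestLine 0 1 one_pos
  have e := (h χ hχ).symm.trans (hc'.hasDerivTrace χ hχ)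
  rw [h1] at e
  simp only [Complex.ofReal_one, one_mul] at e
  rwa [e]

/-- The weak derivative on the open half-line determines a boundary value. -/
lemma exists_hasDerivTrace {y v : LHalf}
    (h : ∀ χ (hχ : IsTestLine χ), tsupport χ ⊆ Iio 0 →
      ⟪hχ.deriv.toLp, y⟫_ℂ + ⟪hχ.toLp, v⟫_ℂ = 0) : ∃ c, HasDerivTrace y v c :=
  (exists_isPrimitive h).imp fun _ => IsPrimitive.hasDerivTrace

namespace HasDerivTrace

variable {y v y' v' : LHalf} {c c' : ℂ}

lemma inner_add_inner (h : HasDerivTrace y v c) (h' : HasDerivTrace y' v' c') :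
    ⟪y, v'⟫_ℂ + ⟪v, y'⟫_ℂ = conj c * c' :=
  (hasDerivTrace_iff.1 h).inner_add_inner (hasDerivTrace_iff.1 h')

lemma add (h : HasDerivTrace y v c) (h' : HasDerivTrace y' v' c') :
    HasDerivTrace (y + y') (v + v') (c + c') := fun χ hχ => by
  rw [inner_add_right, inner_add_right, mul_add, ← h χ hχ, ← h' χ hχ]; ring

lemma smul (a : ℂ) (h : HasDerivTrace y v c) : HasDerivTrace (a • y) (a • v) (a * c) :=
  fun χ hχ => by
  rw [inner_smul_right, inner_smul_right, mul_left_comm, ← h χ hχ]; ring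

lemma sub (h : HasDerivTrace y v c) (h' : HasDerivTrace y' v' c') :
    HasDerivTrace (y - y') (v - v') (c - c') := fun χ hχ => by
  rw [inner_sub_right, inner_sub_right, mul_sub, ← h χ hχ, ← h' χ hχ]; ring

lemma zero : HasDerivTrace 0 0 0 := fun χ hχ => by simp

/-- Interior test functions determine `v`; once `v` is known, a bump at `0` determines `c`. -/
lemma unique (h : HasDerivTrace y v c) (h' : HasDerivTrace y v' c') : v = v' ∧ c = c' := by
  have h0 := h.sub h'
  rw [sub_self] at h0
  have hv : v - v' = 0 := eq_zero_of_inner_test fun χ hχ hs => by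
    have := h0 χ hχ
    rw [inner_zero_right, zero_add, image_eq_zero_of_notMem_tsupport fun h0 => lt_irrefl (0 : ℝ) (mem_Iio.1 (hs h0))]
      at this
    simpa using this
  rw [hv] at h0
  obtain ⟨χ, hχ, -, h1, -⟩ := exists_isTestLine 0 1 one_pos
  have := h0 χ hχ
  rw [h1] at this
  simp only [inner_zero_right, add_zero, Complex.ofReal_one, one_mul] at this
  exact ⟨sub_eq_zero.1 hv, sub_eq_zero.1 this.symm⟩

/-- Green's formula of `y` with itself: the integral of `(|y|²)'` is `|y(0)|²`. -/
lemma energy (h : HasDerivTrace y v c) : 2 * (⟪y, v⟫_ℂ).re = ‖c‖ ^ 2 := by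
  have := congrArg Complex.re (h.inner_add_inner h)
  rw [← inner_conj_symm v y, Complex.add_re, Complex.conj_re, Complex.conj_mul'] at this
  rw [two_mul, this]
  norm_cast

lemma norm_trace_sq_le (h : HasDerivTrace y v c) : ‖c‖ ^ 2 ≤ 2 * (‖y‖ * ‖v‖) := by
  rw [← h.energy]
  have := (Complex.re_le_norm _).trans (norm_inner_le_norm (𝕜 := ℂ) y v)
  linarith

end HasDerivTrace

/-! ### The equation `w' = l w + f` on the half-line -/

lemma exists_exponential {l : ℝ} (hl : 0 < l) :
    ∃ e : LHalf, HasDerivTrace e ((l : ℂ) • e) 1 := by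
  have hm : MemLp (fun s : ℝ => (Real.exp (l * s) : ℂ)) 2 (volume.restrict (Iic (0 : ℝ))) := by
    have hc : Continuous fun s : ℝ => Real.exp (l * s) := by fun_prop
    refine MemLp.ofReal ((memLp_two_iff_integrable_sq hc.aestronglyMeasurable).2 ?_)
    refine (integrableOn_exp_mul_Iic (a := 2 * l) (by positivity) 0).congr_fun (fun s _ => ?_)
      measurableSet_Iic
    simp only [← Real.exp_nat_mul]
    ring_nf
  refine ⟨hm.toLp _, IsPrimitive.hasDerivTrace ?_⟩
  filter_upwards [hm.coeFn_toLp, ae_restrict_mem measurableSet_Iic] with s hs hs0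
  have e : ∫ σ in (0 : ℝ)..s, ((l : ℂ) • hm.toLp _ : LHalf) σ =
      ∫ σ in (0 : ℝ)..s, ((l * Real.exp (l * σ) : ℝ) : ℂ) := by
    refine intervalIntegral.integral_congr_ae ?_
    filter_upwards [(ae_restrict_iff' measurableSet_Iic).1 hm.coeFn_toLp,
      (ae_restrict_iff' measurableSet_Iic).1 (Lp.coeFn_smul (l : ℂ) (hm.toLp _))] with x h1 h2 hx
    have hx0 : x ∈ Iic (0 : ℝ) := by
      rw [uIoc_of_ge hs0] at hx
      exact hx.2
    rw [h2 hx0, Pi.smul_apply, h1 hx0]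
    simp
  have hd : ∀ x : ℝ, HasDerivAt (fun s => Real.exp (l * s)) (l * Real.exp (l * x)) x := fun x => by
    have := ((hasDerivAt_id x).const_mul l).exp
    simpa [mul_comm] using this
  rw [hs, e, intervalIntegral.integral_ofReal, intervalIntegral.integral_eq_sub_of_hasDerivAt
    (fun x _ => hd x) (Continuous.intervalIntegrable (by fun_prop) _ _)]
  simp

open Classical in
/-- The function `s ↦ e^{l s}` in `L²(ℝ⁻, ℂ)`, for `l > 0`. -/
def expHalf (l : ℝ) : LHalf :=
  -- For `l ≤ 0` the energy identity would give `2 l ‖e‖² = 1`, which is impossible, so the value is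
  -- then `0`.
  if h : ∃ e : LHalf, HasDerivTrace e ((l : ℂ) • e) 1 then h.choose else 0

lemma hasDerivTrace_expHalf {l : ℝ} (hl : 0 < l) :
    HasDerivTrace (expHalf l) ((l : ℂ) • expHalf l) 1 := by
  have h := exists_exponential hl
  rw [expHalf, dif_pos h]
  exact h.choose_spec

namespace HasDerivTrace

variable {w f : LHalf} {c : ℂ} {l : ℝ}

/-- The identity behind all estimates for the scalar equation: the sign of `l` decides on which side
the boundary term helps. -/
lemma energy_ode (h : HasDerivTrace w ((l : ℂ) • w + f) c) :
    2 * l * ‖w‖ ^ 2 + 2 * (⟪w, f⟫_ℂ).re = ‖c‖ ^ 2 := by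
  have := h.energy
  have hs : (⟪w, w⟫_ℂ).re = ‖w‖ ^ 2 := by rw [← inner_self_eq_norm_sq (𝕜 := ℂ)]; rfl
  rw [inner_add_right, inner_smul_right, Complex.add_re, Complex.re_ofReal_mul, hs] at this
  rw [← this]; ring

lemma abs_re_inner_le (w f : LHalf) : |(⟪w, f⟫_ℂ).re| ≤ ‖w‖ * ‖f‖ :=
  (Complex.abs_re_le_norm _).trans (norm_inner_le_norm _ _)

/-- If `l > 0` the boundary term is zero by hypothesis; if `l ≤ 0` it has the favourable sign. In
both cases the bound does not involve `c`. -/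
lemma abs_mul_norm_le (h : HasDerivTrace w ((l : ℂ) • w + f) c) (hc : 0 < l → c = 0) :
    |l| * ‖w‖ ≤ ‖f‖ := by
  have e := h.energy_ode
  have b := abs_le.1 (abs_re_inner_le w f)
  rcases (norm_nonneg w).eq_or_lt with hw | hw
  · rw [← hw, mul_zero]; exact norm_nonneg _
  refine le_of_mul_le_mul_left ?_ hw
  rcases lt_or_ge 0 l with hl | hl
  · rw [hc hl, norm_zero] at e
    rw [abs_of_pos hl]
    nlinarith [b.1]
  · rw [abs_of_nonpos hl]
    nlinarith [b.2, sq_nonneg ‖c‖]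

/-- Trace estimate for the decaying equation. -/
lemma abs_mul_norm_trace_sq_le (h : HasDerivTrace w ((l : ℂ) • w + f) c) (hl : l < 0) :
    |l| * ‖c‖ ^ 2 ≤ 2 * ‖f‖ ^ 2 := by
  have e := h.energy_ode
  have b := abs_le.1 (abs_re_inner_le w f)
  have n := h.abs_mul_norm_le fun h' => absurd h' hl.not_gt
  have h1 : ‖c‖ ^ 2 ≤ 2 * (‖w‖ * ‖f‖) := by nlinarith [b.2, sq_nonneg ‖w‖]
  calc |l| * ‖c‖ ^ 2 ≤ |l| * (2 * (‖w‖ * ‖f‖)) := by gcongr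
    _ = 2 * ((|l| * ‖w‖) * ‖f‖) := by ring
    _ ≤ 2 * (‖f‖ * ‖f‖) := by gcongr
    _ = _ := by ring

/-- Estimate for the equation with a given boundary value. -/
lemma sq_mul_norm_sq_le (h : HasDerivTrace w ((l : ℂ) • w + f) c) (hl : 0 < l) :
    l ^ 2 * ‖w‖ ^ 2 ≤ l * ‖c‖ ^ 2 + ‖f‖ ^ 2 := by
  have e := h.energy_ode
  have b := abs_le.1 (abs_re_inner_le w f)
  have h1 : 2 * l * ‖w‖ ^ 2 ≤ ‖c‖ ^ 2 + 2 * (‖w‖ * ‖f‖) := by linarith [b.1]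
  nlinarith [sq_nonneg (l * ‖w‖ - ‖f‖), mul_le_mul_of_nonneg_left h1 hl.le]

lemma eq_zero (h : HasDerivTrace w ((l : ℂ) • w) c) (hl : l ≠ 0) (hc : 0 < l → c = 0) :
    w = 0 := by
  rw [← add_zero ((l : ℂ) • w)] at h
  have := h.abs_mul_norm_le hc
  rw [norm_zero] at this
  have h0 : 0 < |l| := abs_pos.2 hl
  have := norm_nonneg w
  exact norm_eq_zero.1 (by nlinarith)

lemma eq_smul_expHalf (h : HasDerivTrace w ((l : ℂ) • w) c) (hl : 0 < l) :
    w = c • expHalf l := by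
  have := h.sub ((hasDerivTrace_expHalf hl).smul c)
  rw [smul_comm c, ← smul_sub, mul_one, sub_self] at this
  exact sub_eq_zero.1 (this.eq_zero hl.ne' fun _ => rfl)

/-- The boundary value of a decaying solution. -/
lemma trace_eq_inner_expHalf (h : HasDerivTrace w ((l : ℂ) • w + f) c) (hl : l < 0) :
    c = ⟪expHalf (-l), f⟫_ℂ := by
  have := (hasDerivTrace_expHalf (neg_pos.2 hl)).inner_add_inner h
  rw [inner_add_right, inner_smul_right, inner_smul_left, Complex.conj_ofReal] at this
  simp only [map_one, one_mul] at this
  rw [← this]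
  push_cast
  ring

end HasDerivTrace

lemma IsTestLine.hasDerivTrace {χ : ℝ → ℝ} (h : IsTestLine χ) :
    HasDerivTrace h.toLp h.deriv.toLp (χ 0) := h.isPrimitive.hasDerivTrace

/-- The graph of the derivative with domain `{w | l > 0 → w(0) = 0}`. -/
def derivGraph (l : ℝ) : Submodule ℂ (LHalf × LHalf × ℂ) where
  carrier := {p | HasDerivTrace p.1 p.2.1 p.2.2 ∧ (0 < l → p.2.2 = 0)}
  zero_mem' := ⟨HasDerivTrace.zero, fun _ => rfl⟩
  add_mem' := fun h h' => ⟨h.1.add h'.1, fun hl => by simp [h.2 hl, h'.2 hl]⟩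
  smul_mem' := fun a _ h => ⟨h.1.smul a, fun hl => by simp [h.2 hl]⟩

/-- For each test function the weak formulation is a closed linear condition on the triple of
function, derivative and trace. -/
lemma isClosed_derivGraph (l : ℝ) : IsClosed (derivGraph l : Set (LHalf × LHalf × ℂ)) := by
  have : (derivGraph l : Set (LHalf × LHalf × ℂ)) =
      (⋂ χ, ⋂ hχ : IsTestLine χ,
        {p : LHalf × LHalf × ℂ | ⟪hχ.deriv.toLp, p.1⟫_ℂ + ⟪hχ.toLp, p.2.1⟫_ℂ = χ 0 * p.2.2}) ∩
      ⋂ _ : 0 < l, {p : LHalf × LHalf × ℂ | p.2.2 = 0} := by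
    ext p
    simp [derivGraph, HasDerivTrace]
  rw [this]
  refine (isClosed_iInter fun χ => isClosed_iInter fun hχ => isClosed_eq ?_ ?_).inter
    (isClosed_iInter fun _ => isClosed_eq ?_ ?_) <;> fun_prop

/-- The operator `w ↦ w' - l w` on its domain. -/
def odeMap (l : ℝ) : derivGraph l →L[ℂ] LHalf :=
  ((ContinuousLinearMap.fst ℂ LHalf ℂ).comp (ContinuousLinearMap.snd ℂ LHalf (LHalf × ℂ)) -
    (l : ℂ) • ContinuousLinearMap.fst ℂ LHalf (LHalf × ℂ)).comp (derivGraph l).subtypeL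

lemma odeMap_apply (l : ℝ) (p : derivGraph l) : odeMap l p = p.1.2.1 - (l : ℂ) • p.1.1 := rfl

lemma isClosed_range_odeMap {l : ℝ} (hl : l ≠ 0) : IsClosed (range (odeMap l)) := by
  have : CompleteSpace (derivGraph l) := (isClosed_derivGraph l).completeSpace_coe
  have hl' : 0 < |l| := abs_pos.2 hl
  -- With `f` the image, `‖w‖ ≤ ‖f‖ / |l|` and `‖v‖ ≤ 2 ‖f‖`, while `‖c‖² ≤ 2 ‖w‖ ‖v‖` gives `‖c‖ ≤
  -- ‖w‖ + ‖v‖`. The constant is the sum of the two factors.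
  refine AntilipschitzWith.isClosed_range (K := (1 / |l| + 2).toNNReal) ?_
    (odeMap l).uniformContinuous
  refine AddMonoidHomClass.antilipschitz_of_bound _ fun p => ?_
  rw [Real.coe_toNNReal _ (by positivity)]
  obtain ⟨⟨w, v, c⟩, h, hc⟩ := p
  simp only [odeMap_apply] at h hc ⊢
  set f := v - (l : ℂ) • w with hf
  have hv : v = (l : ℂ) • w + f := by rw [hf]; abel
  have h' := h
  rw [hv] at h'
  have n1 := h'.abs_mul_norm_le hc
  have n1' : ‖w‖ ≤ 1 / |l| * ‖f‖ := by
    rw [one_div, inv_mul_eq_div, le_div_iff₀ hl']; linarith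
  have n2 : ‖v‖ ≤ 2 * ‖f‖ := by
    calc ‖v‖ ≤ ‖(l : ℂ) • w‖ + ‖f‖ := by rw [hv]; exact norm_add_le _ _
      _ ≤ 2 * ‖f‖ := by rw [norm_smul, Complex.norm_real, Real.norm_eq_abs]; linarith
  have n3 : ‖c‖ ≤ ‖w‖ + ‖v‖ := by
    refine (sq_le_sq₀ (norm_nonneg _) (by positivity)).1 (h.norm_trace_sq_le.trans ?_)
    nlinarith [sq_nonneg ‖w‖, sq_nonneg ‖v‖]
  have p1 : 0 ≤ 1 / |l| * ‖f‖ := by positivity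
  have p2 := norm_nonneg f
  change max ‖w‖ (max ‖v‖ ‖c‖) ≤ _
  refine max_le ?_ (max_le ?_ ?_) <;> linarith

/-- The range is closed, so it remains to see that an orthogonal `g` is zero. Such a `g` solves the
adjoint equation `g' = -l g`. If `l > 0` this has no nonzero solution in `L²`. If `l < 0` the domain
contains functions with arbitrary trace, which forces `g` to vanish at `0`, and again `g = 0`. -/
lemma odeMap_surjective {l : ℝ} (hl : l ≠ 0) : Function.Surjective (odeMap l) := by
  have hc : IsClosed (LinearMap.range (odeMap l).toLinearMap : Set LHalf) := isClosed_range_odeMap hl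
  have : CompleteSpace (LinearMap.range (odeMap l).toLinearMap) := hc.completeSpace_coe
  refine LinearMap.range_eq_top.1 (Submodule.orthogonal_eq_bot_iff.1 ?_)
  refine (Submodule.eq_bot_iff _).2 fun g hg => ?_
  have hg' : ∀ w v c, HasDerivTrace w v c → (0 < l → c = 0) → ⟪g, v⟫_ℂ = l * ⟪g, w⟫_ℂ := by
    intro w v c h h0
    have := (Submodule.mem_orthogonal' _ _).1 hg (odeMap l ⟨(w, v, c), h, h0⟩) ⟨_, rfl⟩
    rw [odeMap_apply, inner_sub_right, inner_smul_right] at this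
    exact sub_eq_zero.1 this
  obtain ⟨c', hc'⟩ := exists_hasDerivTrace (y := g) (v := ((-l : ℝ) : ℂ) • g) fun χ hχ hs => by
    have h0 : χ 0 = 0 := image_eq_zero_of_notMem_tsupport fun h0 =>
      lt_irrefl (0 : ℝ) (mem_Iio.1 (hs h0))
    have := congrArg conj (hg' _ _ _ hχ.hasDerivTrace fun _ => by simp [h0])
    rw [map_mul, inner_conj_symm, inner_conj_symm, Complex.conj_ofReal] at this
    rw [inner_smul_right, this]
    push_cast; ring
  refine hc'.eq_zero (by simpa using hl) fun hl0 => ?_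
  obtain ⟨χ, hχ, -, h1, -⟩ := exists_isTestLine 0 1 one_pos
  have e := hg' _ _ _ hχ.hasDerivTrace fun h' => absurd hl0 (by linarith)
  have e2 := hc'.inner_add_inner hχ.hasDerivTrace
  rw [e, inner_smul_left, Complex.conj_ofReal, h1] at e2
  push_cast at e2
  have : conj c' = 0 := by linear_combination -e2
  simpa using this

/-- Solvability of the decaying equation. -/
lemma exists_solution_neg {l : ℝ} (hl : l < 0) (f : LHalf) :
    ∃ w c, HasDerivTrace w ((l : ℂ) • w + f) c := by
  obtain ⟨⟨⟨w, v, c⟩, h, -⟩, rfl⟩ := odeMap_surjective hl.ne f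
  refine ⟨w, c, ?_⟩
  simpa [odeMap_apply] using h

/-- Solvability of the growing equation, with any boundary value. -/
lemma exists_solution_pos {l : ℝ} (hl : 0 < l) (f : LHalf) (c : ℂ) :
    ∃ w, HasDerivTrace w ((l : ℂ) • w + f) c := by
  obtain ⟨⟨⟨w, v, c'⟩, h, h0⟩, rfl⟩ := odeMap_surjective hl.ne' f
  -- The solution in the domain has trace zero; the exponential adds the prescribed one.
  refine ⟨w + c • expHalf l, ?_⟩
  have := h.add ((hasDerivTrace_expHalf hl).smul c)
  simp only at h0
  rw [h0 hl, zero_add, mul_one] at this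
  convert this using 1
  simp only [odeMap_apply, smul_add, smul_comm c]
  abel

/-! ### Fourier modes on the half-cylinder -/

lemma memLp_mul_fourier (y : LHalf) (k : ℤ) :
    MemLp (fun x : ℝ × UnitAddCircle => y x.1 * fourier k x.2) 2 cylMeasure := by
  have h : MemLp (fun x : ℝ × UnitAddCircle => y x.1) 2 cylMeasure :=
    (Lp.memLp y).comp_fst _
  have hc : Continuous fun x : ℝ × UnitAddCircle => fourier k x.2 := by fun_prop
  refine h.of_le (h.1.mul hc.aestronglyMeasurable) (Eventually.of_forall fun x => ?_)
  rw [norm_mul, fourier_apply, Circle.norm_coe, mul_one]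

/-- The function `y(s) e^{2πikt}`, as a linear map in `y`. -/
def cylModeₗ (k : ℤ) : LHalf →ₗ[ℂ] L2Cyl ℂ where
  toFun y := (memLp_mul_fourier y k).toLp _
  map_add' y z := by
    refine Lp.ext ?_
    have h : ∀ᵐ x ∂cylMeasure, (y + z : LHalf) x.1 = y x.1 + z x.1 :=
      Measure.quasiMeasurePreserving_fst.ae (Lp.coeFn_add y z)
    filter_upwards [(memLp_mul_fourier (y + z) k).coeFn_toLp, (memLp_mul_fourier y k).coeFn_toLp,
      (memLp_mul_fourier z k).coeFn_toLp, h, Lp.coeFn_add ((memLp_mul_fourier y k).toLp _)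
      ((memLp_mul_fourier z k).toLp _)] with x h1 h2 h3 h4 h5
    rw [h1, h5, Pi.add_apply, h2, h3, h4, add_mul]
  map_smul' a y := by
    refine Lp.ext ?_
    have h : ∀ᵐ x ∂cylMeasure, (a • y : LHalf) x.1 = a • y x.1 :=
      Measure.quasiMeasurePreserving_fst.ae (Lp.coeFn_smul a y)
    filter_upwards [(memLp_mul_fourier (a • y) k).coeFn_toLp, (memLp_mul_fourier y k).coeFn_toLp,
      h, Lp.coeFn_smul a ((memLp_mul_fourier y k).toLp _)] with x h1 h2 h3 h4
    rw [h1, RingHom.id_apply, h4, Pi.smul_apply, h2, h3, smul_eq_mul, smul_eq_mul, mul_assoc]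

lemma coeFn_cylModeₗ (k : ℤ) (y : LHalf) :
    cylModeₗ k y =ᵐ[cylMeasure] fun x => y x.1 * fourier k x.2 :=
  (memLp_mul_fourier y k).coeFn_toLp

lemma integral_conj_fourier_mul_fourier (j k : ℤ) :
    ∫ t, conj (fourier j t) * fourier k t ∂(haarAddCircle (T := (1 : ℝ))) =
      if j = k then 1 else 0 := by
  have := congrFun (fourierCoeff_fourier (T := (1 : ℝ)) k) j
  rw [fourierCoeff] at this
  simp only [smul_eq_mul, fourier_neg, Pi.single_apply] at this
  exact this

lemma inner_cylModeₗ (j k : ℤ) (y z : LHalf) :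
    ⟪cylModeₗ j y, cylModeₗ k z⟫_ℂ = if j = k then ⟪y, z⟫_ℂ else 0 := by
  rw [L2.inner_def]
  have : (fun x => ⟪cylModeₗ j y x, cylModeₗ k z x⟫_ℂ) =ᵐ[cylMeasure]
      fun x => ⟪y x.1, z x.1⟫_ℂ * (conj (fourier j x.2) * fourier k x.2) := by
    filter_upwards [coeFn_cylModeₗ j y, coeFn_cylModeₗ k z] with x h1 h2
    simp only [h1, h2, RCLike.inner_apply, map_mul]
    ring
  rw [integral_congr_ae this, cylMeasure, integral_prod_mul (fun s => ⟪y s, z s⟫_ℂ)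
    (fun t => conj (fourier j t) * fourier k t), integral_conj_fourier_mul_fourier, L2.inner_def]
  split_ifs <;> simp

/-- The isometric embedding `y ↦ y(s) e^{2πikt}`. -/
def cylMode (k : ℤ) : LHalf →ₗᵢ[ℂ] L2Cyl ℂ where
  toLinearMap := cylModeₗ k
  norm_map' y := by
    have := inner_cylModeₗ k k y y
    rw [if_pos rfl, inner_self_eq_norm_sq_to_K, inner_self_eq_norm_sq_to_K] at this
    norm_cast at this
    exact (sq_eq_sq₀ (norm_nonneg _) (norm_nonneg _)).1 this

lemma coeFn_cylMode (k : ℤ) (y : LHalf) :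
    cylMode k y =ᵐ[cylMeasure] fun x => y x.1 * fourier k x.2 := coeFn_cylModeₗ k y

lemma orthogonalFamily_cylMode : OrthogonalFamily ℂ (fun _ : ℤ => LHalf) cylMode :=
  fun j k hjk y z => (inner_cylModeₗ j k y z).trans (if_neg hjk)

/-- Completeness of the modes. Pairing with indicators in `s` shows that each Fourier coefficient of
the slice `u(s,·)` vanishes for almost every `s`. There are countably many coefficients, so almost
every slice is zero by completeness of the Fourier basis. -/
lemma eq_zero_of_forall_inner_cylMode {u : L2Cyl ℂ}
    (h : ∀ k y, ⟪cylMode k y, u⟫_ℂ = 0) : u = 0 := by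
  have hu : MemLp u 2 cylMeasure := Lp.memLp u
  -- the modes of `u` vanish almost everywhere
  have h1 : ∀ k : ℤ, ∀ᵐ s ∂(volume.restrict (Iic (0 : ℝ))),
      ∫ t, conj (fourier k t) * u (s, t) ∂(haarAddCircle (T := (1 : ℝ))) = 0 := by
    intro k
    have hint : ∀ A : Set ℝ, MeasurableSet A → volume.restrict (Iic (0 : ℝ)) A < ⊤ →
        Integrable (fun x : ℝ × UnitAddCircle =>
          A.indicator (fun _ => (1 : ℂ)) x.1 * (conj (fourier k x.2) * u x)) cylMeasure ∧
        ∫ x : ℝ × UnitAddCircle,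
          A.indicator (fun _ => (1 : ℂ)) x.1 * (conj (fourier k x.2) * u x) ∂cylMeasure = 0 := by
      intro A hA hA'
      have h2 := h k (indicatorConstLp 2 hA hA'.ne 1)
      rw [L2.inner_def] at h2
      have h3 : (fun x => ⟪cylMode k (indicatorConstLp 2 hA hA'.ne (1 : ℂ)) x, u x⟫_ℂ)
          =ᵐ[cylMeasure] fun x => A.indicator (fun _ => (1 : ℂ)) x.1 *
            (conj (fourier k x.2) * u x) := by
        have h4 : ∀ᵐ x ∂cylMeasure, (indicatorConstLp 2 hA hA'.ne (1 : ℂ) : LHalf) x.1 =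
            A.indicator (fun _ => (1 : ℂ)) x.1 :=
          Measure.quasiMeasurePreserving_fst.ae indicatorConstLp_coeFn
        filter_upwards [coeFn_cylMode k (indicatorConstLp 2 hA hA'.ne (1 : ℂ)), h4] with x e1 e2
        rw [e1, e2, RCLike.inner_apply, map_mul]
        by_cases hx : x.1 ∈ A <;> simp [hx, mul_comm]
      exact ⟨(L2.integrable_inner (𝕜 := ℂ) _ u).congr h3, (integral_congr_ae h3).symm.trans h2⟩
    have hfub : ∀ A : Set ℝ, MeasurableSet A → volume.restrict (Iic (0 : ℝ)) A < ⊤ →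
        Integrable (fun s => A.indicator (fun _ => (1 : ℂ)) s *
          ∫ t, conj (fourier k t) * u (s, t) ∂(haarAddCircle (T := (1 : ℝ))))
          (volume.restrict (Iic (0 : ℝ))) ∧
        ∫ s in Iic (0 : ℝ), A.indicator (fun _ => (1 : ℂ)) s *
          ∫ t, conj (fourier k t) * u (s, t) ∂(haarAddCircle (T := (1 : ℝ))) = 0 := by
      intro A hA hA'
      obtain ⟨i1, i2⟩ := hint A hA hA'
      change Integrable _ (Measure.prod _ _) at i1
      replace i2 := (integral_prod _ i1).symm.trans i2
      have i3 := i1.integral_prod_left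
      simp only [integral_const_mul] at i2 i3
      exact ⟨i3, i2⟩
    have conv : ∀ A : Set ℝ, (fun s => A.indicator (fun _ => (1 : ℂ)) s *
          ∫ t, conj (fourier k t) * u (s, t) ∂(haarAddCircle (T := (1 : ℝ)))) =
        A.indicator fun s => ∫ t, conj (fourier k t) * u (s, t) ∂(haarAddCircle (T := (1 : ℝ))) := by
      intro A
      ext s
      by_cases hs : s ∈ A <;> simp [hs]
    refine ae_eq_zero_of_forall_setIntegral_eq_of_sigmaFinite (fun A hA hA' => ?_)
      fun A hA hA' => ?_
    · have := (hfub A hA hA').1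
      rwa [conv, integrable_indicator_iff hA] at this
    · have := (hfub A hA hA').2
      rwa [conv, integral_indicator hA] at this
  -- almost every slice is in `L²`
  have h5 : ∀ᵐ s ∂(volume.restrict (Iic (0 : ℝ))),
      MemLp (fun t => u (s, t)) 2 (haarAddCircle (T := (1 : ℝ))) := by
    have i1 : Integrable (fun x => ‖u x‖ ^ 2) cylMeasure :=
      (memLp_two_iff_integrable_sq_norm hu.1).1 hu
    have m1 := hu.1
    change Integrable _ (Measure.prod _ _) at i1
    change AEStronglyMeasurable _ (Measure.prod _ _) at m1
    filter_upwards [i1.prod_right_ae, m1.prodMk_left] with s e1 e2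
    exact (memLp_two_iff_integrable_sq_norm e2).2 e1
  have h6 : ∀ᵐ s ∂(volume.restrict (Iic (0 : ℝ))), ∀ᵐ t ∂(haarAddCircle (T := (1 : ℝ))),
      u (s, t) = 0 := by
    filter_upwards [ae_all_iff.2 h1, h5] with s e1 e2
    have : e2.toLp _ = 0 := by
      refine (fourierBasis (T := (1 : ℝ))).repr.injective ?_
      ext k
      rw [fourierBasis_repr, map_zero, fourierCoeff_congr_ae e2.coeFn_toLp, fourierCoeff]
      simpa [fourier_neg] using e1 k
    have e3 := e2.coeFn_toLp
    rw [this] at e3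
    filter_upwards [e3, Lp.coeFn_zero ℂ 2 (haarAddCircle (T := (1 : ℝ)))] with t f1 f2
    rw [← f1, f2, Pi.zero_apply]
  refine (Lp.eq_zero_iff_ae_eq_zero).2 ?_
  have m1 := hu.1
  -- Passing from almost every slice to almost every point requires a measurable zero set, hence a
  -- strongly measurable representative.
  obtain ⟨u', hu', huu'⟩ := m1
  have h7 : ∀ᵐ s ∂(volume.restrict (Iic (0 : ℝ))), ∀ᵐ t ∂(haarAddCircle (T := (1 : ℝ))),
      u' (s, t) = 0 := by
    have huu2 : ∀ᵐ x ∂((volume.restrict (Iic (0 : ℝ))).prod (haarAddCircle (T := (1 : ℝ)))),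
      u x = u' x := huu'
    filter_upwards [h6, Measure.ae_ae_of_ae_prod huu2] with s e1 e2
    filter_upwards [e1, e2] with t f1 f2
    rw [← f2, f1]
  have h8 : ∀ᵐ x ∂cylMeasure, u' x = 0 :=
    (Measure.ae_prod_iff_ae_ae (hu'.measurable (measurableSet_singleton 0))).2 h7
  filter_upwards [huu', h8] with x f1 f2
  rw [f1, f2, Pi.zero_apply]

lemma isHilbertSum_cylMode : IsHilbertSum ℂ (fun _ : ℤ => LHalf) cylMode := by
  refine IsHilbertSum.mk orthogonalFamily_cylMode ?_
  refine le_of_eq (Submodule.topologicalClosure_eq_top_iff.2 ?_).symm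
  refine (Submodule.eq_bot_iff _).2 fun u hu => eq_zero_of_forall_inner_cylMode fun k y => ?_
  exact (Submodule.mem_orthogonal _ _).1 hu _
    (Submodule.mem_iSup_of_mem k (LinearMap.mem_range_self _ y))

/-- The `k`-th Fourier mode of a function on the half-cylinder. -/
def mode (k : ℤ) : L2Cyl ℂ →L[ℂ] LHalf :=
  ContinuousLinearMap.adjoint (cylMode k).toContinuousLinearMap

lemma inner_cylMode (k : ℤ) (y : LHalf) (u : L2Cyl ℂ) : ⟪cylMode k y, u⟫_ℂ = ⟪y, mode k u⟫_ℂ := by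
  rw [mode, ContinuousLinearMap.adjoint_inner_right]
  rfl

lemma linearIsometryEquiv_apply (u : L2Cyl ℂ) (k : ℤ) :
    isHilbertSum_cylMode.linearIsometryEquiv u k = mode k u := by
  refine ext_inner_left ℂ fun y => ?_
  refine (lp.inner_single_left (𝕜 := ℂ) (G := fun _ : ℤ => LHalf) k y
    (isHilbertSum_cylMode.linearIsometryEquiv u)).symm.trans ?_
  rw [← LinearIsometryEquiv.inner_map_map isHilbertSum_cylMode.linearIsometryEquiv.symm,
    LinearIsometryEquiv.symm_apply_apply, IsHilbertSum.linearIsometryEquiv_symm_apply_single,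
    inner_cylMode]

lemma hasSum_cylMode (u : L2Cyl ℂ) : HasSum (fun k => cylMode k (mode k u)) u := by
  have := isHilbertSum_cylMode.hasSum_linearIsometryEquiv_symm
    (isHilbertSum_cylMode.linearIsometryEquiv u)
  simpa only [linearIsometryEquiv_apply, LinearIsometryEquiv.symm_apply_apply] using this

lemma ext_mode {u v : L2Cyl ℂ} (h : ∀ k, mode k u = mode k v) : u = v :=
  (hasSum_cylMode u).unique (by simpa only [h] using hasSum_cylMode v)

lemma summable_norm_mode_sq (u : L2Cyl ℂ) : Summable fun k => ‖mode k u‖ ^ 2 := by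
  have := (lp.memℓp (isHilbertSum_cylMode.linearIsometryEquiv u)).summable (by norm_num)
  simpa [linearIsometryEquiv_apply] using this

lemma exists_mode_eq {y : ℤ → LHalf} (h : Summable fun k => ‖y k‖ ^ 2) :
    ∃ u : L2Cyl ℂ, ∀ k, mode k u = y k := by
  have hm : Memℓp y 2 := memℓp_gen (by simpa using h)
  refine ⟨isHilbertSum_cylMode.linearIsometryEquiv.symm ⟨y, hm⟩, fun k => ?_⟩
  rw [← linearIsometryEquiv_apply, LinearIsometryEquiv.apply_symm_apply]

/-! ### Conjugation and the symmetry between the modes `k` and `-k`. -/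

/-- Complex conjugation on `L²`. -/
def conjL2 {α : Type*} [MeasurableSpace α] (μ : Measure α) : Lp ℂ 2 μ →L[ℝ] Lp ℂ 2 μ :=
  (Complex.conjCLE : ℂ →L[ℝ] ℂ).compLpL 2 μ

lemma coeFn_conjL2 {α : Type*} [MeasurableSpace α] {μ : Measure α} (u : Lp ℂ 2 μ) :
    conjL2 μ u =ᵐ[μ] fun x => conj (u x) :=
  (Complex.conjCLE : ℂ →L[ℝ] ℂ).coeFn_compLpL u

lemma inner_conjL2 {α : Type*} [MeasurableSpace α] {μ : Measure α} (u v : Lp ℂ 2 μ) :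
    ⟪conjL2 μ u, v⟫_ℂ = conj ⟪u, conjL2 μ v⟫_ℂ := by
  rw [L2.inner_def, L2.inner_def, ← integral_conj]
  refine integral_congr_ae ?_
  filter_upwards [coeFn_conjL2 u, coeFn_conjL2 v] with x h1 h2
  simp [h1, h2]

/-- Conjugation maps `e^{2πikt}` to `e^{-2πikt}`. Consequently a real function is determined by its
modes with `k ≥ 0`. -/
lemma mode_conjL2 (k : ℤ) (u : L2Cyl ℂ) :
    mode k (conjL2 cylMeasure u) = conjL2 _ (mode (-k) u) := by
  refine ext_inner_left ℂ fun y => ?_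
  have h : conjL2 cylMeasure (cylMode k y) = cylMode (-k) (conjL2 _ y) := by
    refine Lp.ext ?_
    have h4 : ∀ᵐ x ∂cylMeasure, (conjL2 _ y) x.1 = conj (y x.1) :=
      Measure.quasiMeasurePreserving_fst.ae (coeFn_conjL2 y)
    filter_upwards [coeFn_conjL2 (cylMode k y), coeFn_cylMode k y,
      coeFn_cylMode (-k) (conjL2 _ y), h4] with x h1 h2 h3 h5
    rw [h1, h2, h3, h5, map_mul, fourier_neg]
  rw [← inner_cylMode, ← Complex.conj_conj (⟪cylMode k y, _⟫_ℂ), ← inner_conjL2, h, inner_cylMode,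
    inner_conjL2, Complex.conj_conj]

lemma IsTestLine.inner_conjL2 {χ : ℝ → ℝ} (hχ : IsTestLine χ) (v : LHalf) :
    ⟪hχ.toLp, conjL2 _ v⟫_ℂ = conj ⟪hχ.toLp, v⟫_ℂ := by
  have e : conjL2 _ hχ.toLp = hχ.toLp := by
    refine Lp.ext ?_
    filter_upwards [coeFn_conjL2 hχ.toLp, hχ.coeFn_toLp] with s h1 h2
    rw [h1, h2, Complex.conj_ofReal]
  rw [← Complex.conj_conj (⟪hχ.toLp, conjL2 _ v⟫_ℂ), ← HalfCylinder.inner_conjL2, e]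

lemma HasDerivTrace.conj {y v : LHalf} {c : ℂ} (h : HasDerivTrace y v c) :
    HasDerivTrace (conjL2 _ y) (conjL2 _ v) (starRingEnd ℂ c) := fun χ hχ => by
  have := congrArg (starRingEnd ℂ) (h χ hχ)
  rwa [map_add, map_mul, Complex.conj_ofReal, ← hχ.inner_conjL2, ← hχ.deriv.inner_conjL2] at this

/-! ### Weak derivatives and traces in terms of Fourier modes -/

/-- The test function `χ(s) Re(w e^{2πikt})`. -/
def testMode (χ : ℝ → ℝ) (w : ℂ) (k : ℤ) (x : ℝ × UnitAddCircle) : ℝ :=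
  χ x.1 * (w * fourier k x.2).re

lemma isTest_testMode {χ : ℝ → ℝ} (h : IsTestLine χ) (w : ℂ) (k : ℤ) :
    IsTest (testMode χ w k) := by
  constructor
  · have h1 : ContDiff ℝ ∞ fun p : ℝ × ℝ => χ p.1 := h.1.comp contDiff_fst
    have h2 : ContDiff ℝ ∞ fun p : ℝ × ℝ =>
        (w * Complex.exp (2 * Real.pi * Complex.I * k * (p.2 : ℝ) / (1 : ℝ))).re := by
      refine Complex.reCLM.contDiff.comp (contDiff_const.mul (Complex.contDiff_exp.comp ?_))
      exact (contDiff_const.mul (Complex.ofRealCLM.contDiff.comp contDiff_snd)).div_const _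
    have e : (fun p : ℝ × ℝ => testMode χ w k (p.1, (p.2 : UnitAddCircle))) = fun p => χ p.1 *
        (w * Complex.exp (2 * Real.pi * Complex.I * k * (p.2 : ℝ) / (1 : ℝ))).re := by
      ext p
      simp only [testMode, fourier_coe_apply]
    rw [e]
    exact h1.mul h2
  · refine HasCompactSupport.intro (h.2.isCompact.prod isCompact_univ) fun x hx => ?_
    have : x.1 ∉ tsupport χ := fun h' => hx ⟨h', mem_univ _⟩
    rw [testMode, image_eq_zero_of_notMem_tsupport this, zero_mul]

lemma isInteriorTest_testMode {χ : ℝ → ℝ} (h : IsTestLine χ) (hs : tsupport χ ⊆ Iio 0) (w : ℂ)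
    (k : ℤ) : IsInteriorTest (testMode χ w k) := by
  refine ⟨isTest_testMode h w k, fun x hx => hs ?_⟩
  have : tsupport (testMode χ w k) ⊆ Prod.fst ⁻¹' tsupport χ := by
    refine closure_minimal (fun y hy => subset_tsupport _ fun h0 => hy ?_)
      ((isClosed_tsupport χ).preimage continuous_fst)
    rw [testMode, h0, zero_mul]
  exact this hx

lemma partialS_testMode {χ : ℝ → ℝ} (h : IsTestLine χ) (w : ℂ) (k : ℤ) :
    partialS (testMode χ w k) = testMode (deriv χ) w k := by
  ext x
  have hd : HasDerivAt χ (deriv χ x.1) x.1 := ((h.1.differentiable (by simp)) x.1).hasDerivAt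
  exact (hd.mul_const ((w * fourier k x.2).re)).deriv

lemma partialT_testMode (χ : ℝ → ℝ) (w : ℂ) (k : ℤ) :
    partialT (testMode χ w k) = testMode χ (2 * Real.pi * Complex.I * k * w) k := by
  ext x
  have h1 := (hasDerivAt_fourier 1 k 0).const_mul (w * fourier k x.2)
  have h2 := (Complex.reCLM.hasFDerivAt.comp_hasDerivAt (0 : ℝ) h1).const_mul (χ x.1)
  have : partialT (testMode χ w k) x = deriv (fun y : ℝ => χ x.1 *
      (Complex.reCLM ∘ fun y : ℝ => w * fourier k x.2 * fourier k (y : UnitAddCircle)) y) 0 := by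
    simp only [partialT, testMode, fourier_apply, smul_add, toCircle_add, Circle.coe_mul, mul_assoc,
      Function.comp_apply, Complex.reCLM_apply]
  rw [this, h2.deriv, testMode]
  simp only [AddCircle.coe_zero, fourier_eval_zero, Complex.reCLM_apply, Complex.ofReal_one]
  ring_nf

/-- The weights `1` and `-I` give the cosine and the sine of `2πkt`, times `χ`. The derivative in
`t` exchanges them up to the factor `∓2πk`. -/
lemma testMode_two_pi_I (χ : ℝ → ℝ) (k : ℤ) (x : ℝ × UnitAddCircle) :
    testMode χ (2 * Real.pi * Complex.I * k * 1) k x =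
      (-(2 * Real.pi * k)) * testMode χ (-Complex.I) k x := by
  simp [testMode]
  ring

lemma testMode_two_pi (χ : ℝ → ℝ) (k : ℤ) (x : ℝ × UnitAddCircle) :
    testMode χ (2 * Real.pi * Complex.I * k * (-Complex.I)) k x =
      (2 * Real.pi * k) * testMode χ 1 k x := by
  have : 2 * Real.pi * Complex.I * k * (-Complex.I) = ((2 * Real.pi * k : ℝ) : ℂ) := by
    push_cast
    linear_combination (-2 * Real.pi * k : ℂ) * Complex.I_mul_I
  rw [testMode, this, Complex.re_ofReal_mul, testMode, one_mul]
  ring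

/-- Weak derivatives are tested on real functions only; the conjugate of a complex mode is the
cosine minus `i` times the sine. -/
lemma inner_cylMode_toLp {χ : ℝ → ℝ} (h : IsTestLine χ) (k : ℤ) (u : L2Cyl ℂ) :
    ⟪h.toLp, mode k u⟫_ℂ = ∫ x, testMode χ 1 k x • u x ∂cylMeasure -
      Complex.I * ∫ x, testMode χ (-Complex.I) k x • u x ∂cylMeasure := by
  have i1 := integrable_smul_L2 (isTest_testMode h 1 k).continuous (isTest_testMode h 1 k).2 u
  have i2 := integrable_smul_L2 (isTest_testMode h (-Complex.I) k).continuous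
    (isTest_testMode h (-Complex.I) k).2 u
  rw [← inner_cylMode, L2.inner_def, ← integral_const_mul, ← integral_sub i1 (i2.const_mul _)]
  refine integral_congr_ae ?_
  have h4 : ∀ᵐ x ∂cylMeasure, h.toLp x.1 = (χ x.1 : ℂ) :=
    Measure.quasiMeasurePreserving_fst.ae h.coeFn_toLp
  filter_upwards [coeFn_cylMode k h.toLp, h4] with x h1 h2
  have e : conj (fourier k x.2) = ((fourier k x.2).re : ℂ) - Complex.I * ((fourier k x.2).im : ℂ) := by
    apply Complex.ext <;> simp
  simp only [RCLike.inner_apply, h1, h2, map_mul, Complex.conj_ofReal, e, testMode,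
    Complex.real_smul]
  simp
  ring

section Circle

/-- The test function `χ(0) Re(w e^{2πikt})` on the boundary. -/
lemma integral_boundary_testMode (χ : ℝ → ℝ) (k : ℤ) (g : L2Circ ℂ) :
    ∫ t, testMode χ 1 k (0, t) • g t ∂(haarAddCircle (T := (1 : ℝ))) -
      Complex.I * ∫ t, testMode χ (-Complex.I) k (0, t) • g t ∂(haarAddCircle (T := (1 : ℝ))) =
      χ 0 * fourierCoeff g k := by
  have hg : Integrable g (haarAddCircle (T := (1 : ℝ))) := (Lp.memLp g).integrable (by norm_num)
  have hi : ∀ w : ℂ, Integrable (fun t => testMode χ w k (0, t) • g t)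
      (haarAddCircle (T := (1 : ℝ))) := fun w => by
    have hc : Continuous fun t : UnitAddCircle => testMode χ w k (0, t) := by
      change Continuous fun t : UnitAddCircle => χ 0 * (w * fourier k t).re
      fun_prop
    have := hg.bdd_mul (c := |χ 0| * ‖w‖) (f := fun t => ((testMode χ w k (0, t) : ℝ) : ℂ))
      (Complex.continuous_ofReal.comp hc).aestronglyMeasurable (Eventually.of_forall fun t => by
        rw [Complex.norm_real, testMode, norm_mul, Real.norm_eq_abs, Real.norm_eq_abs]
        refine mul_le_mul_of_nonneg_left ((Complex.abs_re_le_norm _).trans ?_) (abs_nonneg _)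
        rw [norm_mul, fourier_apply, Circle.norm_coe, mul_one])
    simpa only [Complex.real_smul] using this
  rw [fourierCoeff, ← integral_const_mul, ← integral_const_mul, ← integral_sub (hi 1)
    ((hi _).const_mul _)]
  refine integral_congr_ae (Eventually.of_forall fun t => ?_)
  have e : fourier (-k) t = ((fourier k t).re : ℂ) - Complex.I * ((fourier k t).im : ℂ) := by
    rw [fourier_neg]
    apply Complex.ext <;> simp
  simp only [e, testMode, Complex.real_smul, smul_eq_mul]
  simp
  ring

end Circle

lemma HasWeakS.exists_hasDerivTrace {u v : L2Cyl ℂ} (h : HasWeakS u v) (k : ℤ) :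
    ∃ c, HasDerivTrace (mode k u) (mode k v) c := by
  refine HalfCylinder.exists_hasDerivTrace fun χ hχ hs => ?_
  have h1 := h _ (isInteriorTest_testMode hχ hs 1 k)
  have h2 := h _ (isInteriorTest_testMode hχ hs (-Complex.I) k)
  rw [partialS_testMode hχ] at h1 h2
  rw [inner_cylMode_toLp, inner_cylMode_toLp, h1, h2]
  ring

lemma HasWeakT.mode_eq {u v : L2Cyl ℂ} (h : HasWeakT u v) (k : ℤ) :
    mode k v = (2 * Real.pi * Complex.I * k : ℂ) • mode k u := by
  refine sub_eq_zero.1 (eq_zero_of_inner_test fun χ hχ hs => ?_)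
  have h1 := h _ (isInteriorTest_testMode hχ hs 1 k)
  have h2 := h _ (isInteriorTest_testMode hχ hs (-Complex.I) k)
  rw [partialT_testMode] at h1 h2
  have e1 : ∫ x, testMode χ (2 * Real.pi * Complex.I * k * 1) k x • u x ∂cylMeasure =
      (-(2 * Real.pi * k)) • ∫ x, testMode χ (-Complex.I) k x • u x ∂cylMeasure := by
    rw [← integral_smul]
    exact integral_congr_ae (Eventually.of_forall fun x => by
      simp only [testMode_two_pi_I]; rw [mul_smul])
  have e2 : ∫ x, testMode χ (2 * Real.pi * Complex.I * k * (-Complex.I)) k x • u x ∂cylMeasure =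
      (2 * Real.pi * k) • ∫ x, testMode χ 1 k x • u x ∂cylMeasure := by
    rw [← integral_smul]
    exact integral_congr_ae (Eventually.of_forall fun x => by
      simp only [testMode_two_pi]; rw [mul_smul])
  rw [e1] at h1
  rw [e2] at h2
  rw [inner_sub_right, inner_smul_right, inner_cylMode_toLp, inner_cylMode_toLp]
  simp only [Complex.real_smul] at h1 h2 ⊢
  push_cast at h1 h2
  linear_combination h1 - Complex.I * h2 + (2 * Real.pi * k *
    ∫ x, (testMode χ (-Complex.I) k x : ℂ) * u x ∂cylMeasure) * Complex.I_mul_I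

/-- Green's formula, for the modes. -/
lemma hasDerivTrace_of_green {u us : L2Cyl ℂ} {g : L2Circ ℂ}
    (h : ∀ φ, IsTest φ → ∫ t, φ (0, t) • g t ∂(haarAddCircle (T := (1 : ℝ))) =
      ∫ x, (φ x • us x + partialS φ x • u x) ∂cylMeasure) (k : ℤ) :
    HasDerivTrace (mode k u) (mode k us) (fourierCoeff g k) := fun χ hχ => by
  have i : ∀ w, ∫ x, (testMode χ w k x • us x + partialS (testMode χ w k) x • u x) ∂cylMeasure =
      ∫ x, testMode χ w k x • us x ∂cylMeasure + ∫ x, testMode (deriv χ) w k x • u x ∂cylMeasure := by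
    intro w
    have ht := isTest_testMode hχ w k
    rw [integral_add (integrable_smul_L2 ht.continuous ht.2 us)
      (integrable_smul_L2 ht.continuous_partialS ht.hasCompactSupport_partialS u),
      partialS_testMode hχ]
  rw [← integral_boundary_testMode, h _ (isTest_testMode hχ _ _), h _ (isTest_testMode hχ _ _), i, i,
    inner_cylMode_toLp, inner_cylMode_toLp]
  ring

/-! The converse direction. -/

lemma IsTest.isTestLine {φ : ℝ × UnitAddCircle → ℝ} (h : IsTest φ) (t : UnitAddCircle) :
    IsTestLine fun s => φ (s, t) := by
  obtain ⟨τ, rfl⟩ := QuotientAddGroup.mk_surjective t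
  refine ⟨h.1.comp (contDiff_id.prodMk contDiff_const : ContDiff ℝ ∞ fun s : ℝ => (s, τ)), ?_⟩
  refine HasCompactSupport.intro (h.2.isCompact.image continuous_fst) fun s hs => ?_
  exact image_eq_zero_of_notMem_tsupport fun h' => hs ⟨_, h', rfl⟩

lemma integral_smul_cylMode {φ : ℝ × UnitAddCircle → ℝ} (hc : Continuous φ)
    (hs : HasCompactSupport φ) (k : ℤ) (y : LHalf) :
    Integrable (fun x : ℝ × UnitAddCircle => φ x • (y x.1 * fourier k x.2)) cylMeasure ∧
    ∫ x, φ x • cylMode k y x ∂cylMeasure = ∫ x, φ x • (y x.1 * fourier k x.2) ∂cylMeasure := by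
  have e : (fun x => φ x • cylMode k y x) =ᵐ[cylMeasure] fun x => φ x • (y x.1 * fourier k x.2) := by
    filter_upwards [coeFn_cylMode k y] with x hx
    rw [hx]
  exact ⟨(integrable_smul_L2 hc hs _).congr e, integral_congr_ae e⟩

/-- Green's formula for a single mode. -/
lemma HasDerivTrace.green_cylMode {y v : LHalf} {c : ℂ} (h : HasDerivTrace y v c) (k : ℤ)
    {φ : ℝ × UnitAddCircle → ℝ} (hφ : IsTest φ) :
    ∫ x, partialS φ x • cylMode k y x ∂cylMeasure + ∫ x, φ x • cylMode k v x ∂cylMeasure =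
      c * ∫ t, φ (0, t) • fourier k t ∂(haarAddCircle (T := (1 : ℝ))) := by
  obtain ⟨i1, e1⟩ := integral_smul_cylMode hφ.continuous_partialS hφ.hasCompactSupport_partialS k y
  obtain ⟨i2, e2⟩ := integral_smul_cylMode hφ.continuous hφ.2 k v
  rw [e1, e2, ← integral_add i1 i2, cylMeasure, integral_prod_symm _ (Integrable.fun_add i1 i2),
    ← integral_const_mul]
  refine integral_congr_ae (Eventually.of_forall fun t => ?_)
  have h1 := h _ (hφ.isTestLine t)
  rw [IsTestLine.inner_toLp, IsTestLine.inner_toLp, ← integral_add] at h1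
  · simp only
    rw [Complex.real_smul, mul_left_comm, ← mul_assoc, ← h1, ← integral_mul_const]
    refine integral_congr_ae (Eventually.of_forall fun s => ?_)
    simp only [Complex.real_smul, partialS]
    ring
  · exact memLp_one_iff_integrable.1 ((Lp.memLp y).smul
      ((hφ.isTestLine t).deriv.1.continuous.memLp_of_hasCompactSupport
        (hφ.isTestLine t).deriv.2 (p := 2)))
  · exact memLp_one_iff_integrable.1 ((Lp.memLp v).smul
      ((hφ.isTestLine t).1.continuous.memLp_of_hasCompactSupport (hφ.isTestLine t).2 (p := 2)))

/-- Integration by parts on the circle. -/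
lemma IsTest.integral_partialT_smul_fourier {φ : ℝ × UnitAddCircle → ℝ} (hφ : IsTest φ) (k : ℤ)
    (s : ℝ) :
    ∫ t, partialT φ (s, t) • fourier k t ∂(haarAddCircle (T := (1 : ℝ))) =
      -(2 * Real.pi * Complex.I * k) * ∫ t, φ (s, t) • fourier k t ∂(haarAddCircle (T := (1 : ℝ))) := by
  have conv : ∀ ψ : UnitAddCircle → ℝ, ∫ t, ψ t • fourier k t ∂(haarAddCircle (T := (1 : ℝ))) =
      ∫ τ in (0 : ℝ)..1, (ψ τ : ℂ) * fourier k (τ : UnitAddCircle) := by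
    intro ψ
    have := fourierCoeff_eq_intervalIntegral (T := (1 : ℝ)) (fun t => (ψ t : ℂ)) (-k) 0
    rw [fourierCoeff] at this
    simp only [neg_neg, smul_eq_mul, zero_add, one_div, inv_one, one_smul] at this
    simp only [Complex.real_smul]
    simp only [mul_comm _ (fourier k _)]
    exact this
  rw [conv, conv]
  have hd : ∀ τ : ℝ, HasDerivAt (fun τ : ℝ => ((φ (s, (τ : UnitAddCircle)) : ℝ) : ℂ))
      ((partialT φ (s, (τ : UnitAddCircle)) : ℝ) : ℂ) τ := by
    intro τ
    have h1 := ((hφ.1.differentiable (by simp)) (s, τ)).hasFDerivAt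
    have hc : HasDerivAt (fun τ : ℝ => ((s, τ) : ℝ × ℝ)) (0, 1) τ :=
      (hasDerivAt_const τ s).prodMk (hasDerivAt_id τ)
    have h2 := HasFDerivAt.comp_hasDerivAt τ (f := fun τ : ℝ => ((s, τ) : ℝ × ℝ)) h1 hc
    rw [← hφ.partialT_comp (s, τ)] at h2
    exact h2.ofReal_comp
  have hd2 : ∀ τ : ℝ, HasDerivAt (fun τ : ℝ => fourier k (τ : UnitAddCircle))
      (2 * Real.pi * Complex.I * k * fourier k (τ : UnitAddCircle)) τ := fun τ => by
    simpa using hasDerivAt_fourier 1 k τ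
  have hmk : Continuous fun τ : ℝ => (τ : UnitAddCircle) := AddCircle.continuous_mk' 1
  have c1 : Continuous fun τ : ℝ => ((partialT φ (s, (τ : UnitAddCircle)) : ℝ) : ℂ) :=
    Complex.continuous_ofReal.comp (hφ.continuous_partialT.comp (continuous_const.prodMk hmk))
  have c2 : Continuous fun τ : ℝ => 2 * Real.pi * Complex.I * k * fourier k (τ : UnitAddCircle) :=
    continuous_const.mul ((fourier k).continuous.comp hmk)
  have := intervalIntegral.integral_mul_deriv_eq_deriv_mul (a := 0) (b := 1)
    (fun τ _ => hd τ) (fun τ _ => hd2 τ) (c1.intervalIntegrable _ _) (c2.intervalIntegrable _ _)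
  have e10 : ((1 : ℝ) : UnitAddCircle) = ((0 : ℝ) : UnitAddCircle) := by
    rw [AddCircle.coe_zero]; exact AddCircle.coe_period 1
  rw [e10, sub_self, zero_sub] at this
  rw [← neg_eq_iff_eq_neg.2 this, ← intervalIntegral.integral_const_mul,
    ← intervalIntegral.integral_neg]
  refine intervalIntegral.integral_congr fun τ _ => ?_
  ring

lemma integral_partialT_smul_cylMode {φ : ℝ × UnitAddCircle → ℝ} (hφ : IsTest φ) (k : ℤ)
    (y : LHalf) :
    ∫ x, partialT φ x • cylMode k y x ∂cylMeasure =
      -(2 * Real.pi * Complex.I * k) * ∫ x, φ x • cylMode k y x ∂cylMeasure := by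
  obtain ⟨i1, e1⟩ := integral_smul_cylMode hφ.continuous_partialT hφ.hasCompactSupport_partialT k y
  obtain ⟨i2, e2⟩ := integral_smul_cylMode hφ.continuous hφ.2 k y
  rw [e1, e2, cylMeasure, integral_prod _ i1, integral_prod _ i2, ← integral_const_mul]
  refine integral_congr_ae (Eventually.of_forall fun s => ?_)
  have r : ∀ ψ : UnitAddCircle → ℝ,
      ∫ t, ψ t • (y s * fourier k t) ∂(haarAddCircle (T := (1 : ℝ))) =
      y s * ∫ t, ψ t • fourier k t ∂(haarAddCircle (T := (1 : ℝ))) := by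
    intro ψ
    rw [← integral_const_mul]
    refine integral_congr_ae (Eventually.of_forall fun t => ?_)
    simp only [Complex.real_smul]
    ring
  simp only
  rw [r, r, hφ.integral_partialT_smul_fourier]
  ring

lemma hasSum_integral_smul_cylMode {φ : ℝ × UnitAddCircle → ℝ} (hc : Continuous φ)
    (hs : HasCompactSupport φ) (u : L2Cyl ℂ) :
    HasSum (fun k => ∫ x, φ x • cylMode k (mode k u) x ∂cylMeasure) (∫ x, φ x • u x ∂cylMeasure) := by
  have hm : MemLp (fun x => (φ x : ℂ)) 2 cylMeasure :=
    MemLp.ofReal (hc.memLp_of_hasCompactSupport hs)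
  have e : ∀ v : L2Cyl ℂ, ∫ x, φ x • v x ∂cylMeasure = ⟪hm.toLp _, v⟫_ℂ := by
    intro v
    rw [L2.inner_def]
    refine integral_congr_ae ?_
    filter_upwards [hm.coeFn_toLp] with x hx
    simp [hx, mul_comm]
  simp only [e]
  exact (hasSum_cylMode u).mapL (innerSL ℂ (hm.toLp _))

lemma hasSum_integral_smul_circle {ψ : UnitAddCircle → ℝ} (hc : Continuous ψ) (g : L2Circ ℂ) :
    HasSum (fun k => fourierCoeff g k * ∫ t, ψ t • fourier k t ∂(haarAddCircle (T := (1 : ℝ))))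
      (∫ t, ψ t • g t ∂(haarAddCircle (T := (1 : ℝ)))) := by
  have hm : MemLp (fun t => (ψ t : ℂ)) 2 (haarAddCircle (T := (1 : ℝ))) :=
    MemLp.ofReal (hc.memLp_of_hasCompactSupport (HasCompactSupport.of_compactSpace ψ))
  have e : ∀ v : L2Circ ℂ, ∫ t, ψ t • v t ∂(haarAddCircle (T := (1 : ℝ))) = ⟪hm.toLp _, v⟫_ℂ := by
    intro v
    rw [L2.inner_def]
    refine integral_congr_ae ?_
    filter_upwards [hm.coeFn_toLp] with x hx
    simp [hx, mul_comm]
  have h := (hasSum_fourier_series_L2 g).mapL (innerSL ℂ (hm.toLp _))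
  rw [e]
  refine h.congr_fun fun k => ?_
  rw [innerSL_apply_apply, inner_smul_right, ← e]
  congr 1
  refine integral_congr_ae ?_
  filter_upwards [coeFn_fourierLp (T := (1 : ℝ)) 2 k] with t ht
  rw [ht]

/-- The sum over `k` of Green's formula for single modes. With `φ` vanishing on the boundary it
yields the weak derivative, and in general the trace. -/
lemma green_of_modes {u v : L2Cyl ℂ} {c : ℤ → ℂ}
    (h : ∀ k, HasDerivTrace (mode k u) (mode k v) (c k)) {φ : ℝ × UnitAddCircle → ℝ}
    (hφ : IsTest φ) :
    HasSum (fun k => c k * ∫ t, φ (0, t) • fourier k t ∂(haarAddCircle (T := (1 : ℝ))))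
      (∫ x, partialS φ x • u x ∂cylMeasure + ∫ x, φ x • v x ∂cylMeasure) := by
  simp only [← fun k => (h k).green_cylMode k hφ]
  exact (hasSum_integral_smul_cylMode hφ.continuous_partialS hφ.hasCompactSupport_partialS u).add
    (hasSum_integral_smul_cylMode hφ.continuous hφ.2 v)

/-- The boundary values need not be summable: interior test functions vanish on the boundary and
remove these terms. -/
lemma hasWeakS_iff {u v : L2Cyl ℂ} :
    HasWeakS u v ↔ ∀ k, ∃ c, HasDerivTrace (mode k u) (mode k v) c := by
  refine ⟨HasWeakS.exists_hasDerivTrace, fun h φ hφ => ?_⟩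
  choose c hc using h
  have h0 : ∀ t, φ (0, t) = 0 := fun t => image_eq_zero_of_notMem_tsupport fun h' =>
    lt_irrefl (0 : ℝ) (hφ.2 h')
  have := green_of_modes hc hφ.1
  simp only [h0, zero_smul, integral_zero, mul_zero] at this
  exact eq_neg_of_add_eq_zero_left (this.unique hasSum_zero)

lemma hasWeakT_iff {u v : L2Cyl ℂ} :
    HasWeakT u v ↔ ∀ k : ℤ, mode k v = (2 * Real.pi * Complex.I * k : ℂ) • mode k u := by
  refine ⟨HasWeakT.mode_eq, fun h φ hφ => ?_⟩
  refine (hasSum_integral_smul_cylMode hφ.1.continuous_partialT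
    hφ.1.hasCompactSupport_partialT u).unique ?_
  refine (hasSum_integral_smul_cylMode hφ.1.continuous hφ.1.2 v).neg.congr_fun fun k => ?_
  rw [integral_partialT_smul_cylMode hφ.1, h k, map_smul, neg_mul, ← integral_const_mul]
  congr 1
  refine integral_congr_ae ?_
  filter_upwards [Lp.coeFn_smul (2 * Real.pi * Complex.I * k : ℂ) (cylMode k (mode k u))] with x hx
  rw [hx, Pi.smul_apply, smul_eq_mul, Complex.real_smul, Complex.real_smul]
  ring

lemma isTrace_iff {u : L2Cyl ℂ} {g : L2Circ ℂ} :
    IsTrace u g ↔ ∃ us, ∀ k, HasDerivTrace (mode k u) (mode k us) (fourierCoeff g k) := by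
  constructor
  · rintro ⟨us, -, h⟩
    exact ⟨us, hasDerivTrace_of_green h⟩
  · rintro ⟨us, h⟩
    refine ⟨us, hasWeakS_iff.2 fun k => ⟨_, h k⟩, fun φ hφ => ?_⟩
    have hc : Continuous fun t => φ (0, t) := hφ.continuous.comp (Continuous.prodMk_right _)
    rw [(hasSum_integral_smul_circle hc g).unique (green_of_modes h hφ),
      integral_add (integrable_smul_L2 hφ.continuous hφ.2 us)
      (integrable_smul_L2 hφ.continuous_partialS hφ.hasCompactSupport_partialS u), add_comm]

/-! ### Vector-valued functions -/

section Map

variable {F G : Type*} [NormedAddCommGroup F] [NormedSpace ℝ F]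
  [NormedAddCommGroup G] [NormedSpace ℝ G]

lemma integral_smul_compLpL [CompleteSpace F] [CompleteSpace G] (L : F →L[ℝ] G)
    {ψ : ℝ × UnitAddCircle → ℝ} (hc : Continuous ψ)
    (hs : HasCompactSupport ψ) (u : L2Cyl F) :
    ∫ x, ψ x • L.compLpL 2 cylMeasure u x ∂cylMeasure = L (∫ x, ψ x • u x ∂cylMeasure) := by
  rw [← L.integral_comp_comm (integrable_smul_L2 hc hs u)]
  refine integral_congr_ae ?_
  filter_upwards [L.coeFn_compLpL (p := 2) (μ := cylMeasure) u] with x hx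
  rw [hx, map_smul]

lemma HasWeakS.map [CompleteSpace F] [CompleteSpace G] (L : F →L[ℝ] G) {u v : L2Cyl F}
    (h : HasWeakS u v) :
    HasWeakS (L.compLpL 2 cylMeasure u) (L.compLpL 2 cylMeasure v) := fun φ hφ => by
  rw [integral_smul_compLpL L hφ.1.continuous_partialS hφ.1.hasCompactSupport_partialS,
    integral_smul_compLpL L hφ.1.continuous hφ.1.2, h φ hφ, map_neg]

lemma HasWeakT.map [CompleteSpace F] [CompleteSpace G] (L : F →L[ℝ] G) {u v : L2Cyl F}
    (h : HasWeakT u v) :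
    HasWeakT (L.compLpL 2 cylMeasure u) (L.compLpL 2 cylMeasure v) := fun φ hφ => by
  rw [integral_smul_compLpL L hφ.1.continuous_partialT hφ.1.hasCompactSupport_partialT,
    integral_smul_compLpL L hφ.1.continuous hφ.1.2, h φ hφ, map_neg]

lemma integrable_smul_circle {ψ : UnitAddCircle → ℝ} (hc : Continuous ψ) (g : L2Circ F) :
    Integrable (fun t => ψ t • g t) (haarAddCircle (T := (1 : ℝ))) :=
  memLp_one_iff_integrable.1 ((Lp.memLp g).smul
    (hc.memLp_of_hasCompactSupport (HasCompactSupport.of_compactSpace ψ) (p := 2)))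

lemma IsTest.continuous_boundary {φ : ℝ × UnitAddCircle → ℝ} (h : IsTest φ) :
    Continuous fun t => φ (0, t) := h.continuous.comp (Continuous.prodMk_right _)

lemma integral_green {φ : ℝ × UnitAddCircle → ℝ} (h : IsTest φ) (u us : L2Cyl F) :
    ∫ x, (φ x • us x + partialS φ x • u x) ∂cylMeasure =
      ∫ x, φ x • us x ∂cylMeasure + ∫ x, partialS φ x • u x ∂cylMeasure :=
  integral_add (integrable_smul_L2 h.continuous h.2 us)
    (integrable_smul_L2 h.continuous_partialS h.hasCompactSupport_partialS u)

lemma IsTrace.map [CompleteSpace F] [CompleteSpace G] (L : F →L[ℝ] G) {u : L2Cyl F}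
    {g : L2Circ F} (h : IsTrace u g) :
    IsTrace (L.compLpL 2 cylMeasure u) (L.compLpL 2 _ g) := by
  obtain ⟨us, h1, h2⟩ := h
  refine ⟨_, h1.map L, fun φ hφ => ?_⟩
  rw [integral_green hφ, integral_smul_compLpL L hφ.continuous hφ.2,
    integral_smul_compLpL L hφ.continuous_partialS hφ.hasCompactSupport_partialS, ← map_add,
    ← integral_green hφ, ← h2 φ hφ,
    ← L.integral_comp_comm (integrable_smul_circle hφ.continuous_boundary g)]
  refine integral_congr_ae ?_
  filter_upwards [L.coeFn_compLpL (p := 2) (μ := haarAddCircle (T := (1 : ℝ))) g] with x hx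
  rw [hx, map_smul]

lemma IsTrace.add {u u' : L2Cyl F} {g g' : L2Circ F} (h : IsTrace u g) (h' : IsTrace u' g') :
    IsTrace (u + u') (g + g') := by
  obtain ⟨us, h1, h2⟩ := h
  obtain ⟨us', h1', h2'⟩ := h'
  refine ⟨_, h1.add h1', fun φ hφ => ?_⟩
  rw [integral_green hφ, integral_smul_add hφ.continuous hφ.2,
    integral_smul_add hφ.continuous_partialS hφ.hasCompactSupport_partialS, add_add_add_comm,
    ← integral_green hφ, ← integral_green hφ, ← h2 φ hφ, ← h2' φ hφ,
    ← integral_add (integrable_smul_circle hφ.continuous_boundary g)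
      (integrable_smul_circle hφ.continuous_boundary g')]
  refine integral_congr_ae ?_
  filter_upwards [Lp.coeFn_add g g'] with x hx
  rw [hx, Pi.add_apply, smul_add]

lemma mem_H1_map [CompleteSpace F] [CompleteSpace G] (L : F →L[ℝ] G) {u : L2Cyl F} (h : u ∈ H1 F) :
    L.compLpL 2 cylMeasure u ∈ H1 G := by
  obtain ⟨⟨v, hv⟩, ⟨w, hw⟩⟩ := h
  exact ⟨⟨_, hv.map L⟩, ⟨_, hw.map L⟩⟩

lemma mem_H2_map [CompleteSpace F] [CompleteSpace G] (L : F →L[ℝ] G) {u : L2Cyl F} (h : u ∈ H2 F) :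
    L.compLpL 2 cylMeasure u ∈ H2 G := by
  obtain ⟨⟨v, mv, hv⟩, ⟨w, mw, hw⟩⟩ := h
  exact ⟨⟨_, mem_H1_map L mv, hv.map L⟩, ⟨_, mem_H1_map L mw, hw.map L⟩⟩

end Map

/-! ### Real vector-valued functions and their complexified coordinates. -/

section Coord

variable {α : Type*} [MeasurableSpace α] (μ : Measure α) {ι : Type*}

/-- A coordinate of a vector, as a complex number. -/
def coordCLM (i : ι) : EuclideanSpace ℝ ι →L[ℝ] ℂ :=
  Complex.ofRealCLM ∘L (EuclideanSpace.proj (𝕜 := ℝ) i)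

variable [Fintype ι]

/-- The vector with one non-zero coordinate, the real part of a complex number. -/
def ofCoordCLM [DecidableEq ι] (i : ι) : ℂ →L[ℝ] EuclideanSpace ℝ ι :=
  LinearMap.toContinuousLinearMap
    ((LinearMap.toSpanSingleton ℝ (EuclideanSpace ℝ ι) (EuclideanSpace.single i 1)) ∘ₗ
      Complex.reCLM.toLinearMap)


lemma ofCoordCLM_apply [DecidableEq ι] (i j : ι) (z : ℂ) :
    ofCoordCLM i z j = if i = j then z.re else 0 := by
  have : ofCoordCLM i z = z.re • EuclideanSpace.single i (1 : ℝ) := rfl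
  rw [this]
  by_cases h : i = j
  · subst h; simp
  · simp [h, Ne.symm h]

/-- A coordinate of a vector-valued `L²` function, as a complex-valued function. -/
def coordL2 (i : ι) : Lp (EuclideanSpace ℝ ι) 2 μ →L[ℝ] Lp ℂ 2 μ := (coordCLM i).compLpL 2 μ

/-- The vector-valued `L²` function with one non-zero coordinate. -/
def ofCoordL2 [DecidableEq ι] (i : ι) : Lp ℂ 2 μ →L[ℝ] Lp (EuclideanSpace ℝ ι) 2 μ :=
  (ofCoordCLM i).compLpL 2 μ

variable {μ}

lemma coeFn_coordL2 (i : ι) (u : Lp (EuclideanSpace ℝ ι) 2 μ) :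
    coordL2 μ i u =ᵐ[μ] fun x => (u x i : ℂ) := (coordCLM i).coeFn_compLpL u

lemma coordL2_ext {u v : Lp (EuclideanSpace ℝ ι) 2 μ} (h : ∀ i, coordL2 μ i u = coordL2 μ i v) :
    u = v := by
  refine Lp.ext ?_
  have h1 : ∀ᵐ x ∂μ, ∀ i, (u x i : ℂ) = v x i := by
    refine ae_all_iff.2 fun i => ?_
    filter_upwards [coeFn_coordL2 i u, coeFn_coordL2 i v] with x e1 e2
    rw [← e1, ← e2, h i]
  filter_upwards [h1] with x hx
  ext i
  exact_mod_cast hx i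

lemma conjL2_coordL2 (i : ι) (u : Lp (EuclideanSpace ℝ ι) 2 μ) :
    conjL2 μ (coordL2 μ i u) = coordL2 μ i u := by
  refine Lp.ext ?_
  filter_upwards [coeFn_coordL2 i u, coeFn_conjL2 (coordL2 μ i u)] with x e1 e2
  rw [e2, e1, Complex.conj_ofReal]

lemma coordL2_ofCoordL2 [DecidableEq ι] (i j : ι) (u : Lp ℂ 2 μ) :
    coordL2 μ j (ofCoordL2 μ i u) = if i = j then (1 / 2 : ℂ) • (u + conjL2 μ u) else 0 := by
  refine Lp.ext ?_
  have e1 := coeFn_coordL2 j (ofCoordL2 μ i u)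
  have e2 : ofCoordL2 μ i u =ᵐ[μ] fun x => ofCoordCLM i (u x) := (ofCoordCLM i).coeFn_compLpL u
  split_ifs with h
  · filter_upwards [e1, e2, Lp.coeFn_smul (1 / 2 : ℂ) (u + conjL2 μ u),
      Lp.coeFn_add u (conjL2 μ u), coeFn_conjL2 u] with x h1 h2 h3 h4 h5
    rw [h1, h2, h3, Pi.smul_apply, h4, Pi.add_apply, h5, ofCoordCLM_apply, if_pos h,
      Complex.re_eq_add_conj]
    simp only [smul_eq_mul]
    ring
  · filter_upwards [e1, e2, Lp.coeFn_zero ℂ 2 μ] with x h1 h2 h3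
    rw [h1, h2, h3, ofCoordCLM_apply, if_neg h, Complex.ofReal_zero, Pi.zero_apply]

end Coord

/-- The index of the coordinate `q` in the phase space `ℝ²`. -/
abbrev iq : Fin 1 ⊕ Fin 1 := Sum.inl 0

/-- The index of the coordinate `p` in the phase space `ℝ²`. -/
abbrev ip : Fin 1 ⊕ Fin 1 := Sum.inr 0

lemma coord_cases {P : Fin 1 ⊕ Fin 1 → Prop} (hq : P iq) (hp : P ip) (i) : P i := by
  rcases i with i | i <;> rw [Subsingleton.elim i 0] <;> assumption

/-- The `q`-component of a function. -/
abbrev cq : L2Cyl (PhaseSpace 1) →L[ℝ] L2Cyl ℂ := coordL2 cylMeasure iq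

/-- The `p`-component of a function. -/
abbrev cp : L2Cyl (PhaseSpace 1) →L[ℝ] L2Cyl ℂ := coordL2 cylMeasure ip

lemma ofCoord_add_ofCoord {α : Type*} [MeasurableSpace α] {μ : Measure α}
    (u : Lp (PhaseSpace 1) 2 μ) :
    ofCoordL2 μ iq (coordL2 μ iq u) + ofCoordL2 μ ip (coordL2 μ ip u) = u := by
  have key : ∀ i, (1 / 2 : ℂ) • (coordL2 μ i u + conjL2 μ (coordL2 μ i u)) = coordL2 μ i u := by
    intro i
    rw [conjL2_coordL2, ← two_smul ℂ, smul_smul]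
    norm_num
  refine coordL2_ext (coord_cases ?_ ?_)
  · rw [map_add, coordL2_ofCoordL2, coordL2_ofCoordL2, if_pos rfl, if_neg (by simp), add_zero, key]
  · rw [map_add, coordL2_ofCoordL2, coordL2_ofCoordL2, if_pos rfl, if_neg (by simp), zero_add, key]

/-- The trace of a function in `H¹`. -/
lemma exists_isTrace_complex {u : L2Cyl ℂ} (h : u ∈ H1 ℂ) : ∃ g, IsTrace u g := by
  obtain ⟨⟨v, hv⟩, -⟩ := h
  choose c hc using hasWeakS_iff.1 hv
  -- The bound `‖c k‖² ≤ 2 ‖u_k‖ ‖v_k‖` makes the boundary values the Fourier coefficients of an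
  -- `L²` function.
  have hs : Summable fun k => ‖c k‖ ^ 2 := by
    refine Summable.of_nonneg_of_le (fun k => by positivity) (fun k => ?_)
      ((summable_norm_mode_sq u).add (summable_norm_mode_sq v))
    refine (hc k).norm_trace_sq_le.trans ?_
    nlinarith [sq_nonneg (‖mode k u‖ - ‖mode k v‖)]
  have hm : Memℓp c 2 := memℓp_gen (by simpa using hs)
  refine ⟨(fourierBasis (T := (1 : ℝ))).repr.symm ⟨c, hm⟩, isTrace_iff.2 ⟨v, fun k => ?_⟩⟩
  rw [← fourierBasis_repr, LinearIsometryEquiv.apply_symm_apply]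
  exact hc k

lemma exists_isTrace {u : L2Cyl (PhaseSpace 1)} (h : u ∈ H1 (PhaseSpace 1)) :
    ∃ g, IsTrace u g := by
  obtain ⟨g, hg⟩ := exists_isTrace_complex (mem_H1_map (coordCLM iq) h)
  obtain ⟨g', hg'⟩ := exists_isTrace_complex (mem_H1_map (coordCLM ip) h)
  rw [← ofCoord_add_ofCoord u]
  exact ⟨_, (hg.map (ofCoordCLM iq)).add (hg'.map (ofCoordCLM ip))⟩

lemma norm_two_pi_I_mul (k : ℤ) :
    ‖(2 * Real.pi * Complex.I * k : ℂ)‖ = 2 * Real.pi * |(k : ℝ)| := by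
  rw [norm_mul, norm_mul, norm_mul, Complex.norm_I, Complex.norm_intCast, Complex.norm_real,
    Real.norm_of_nonneg Real.pi_pos.le]
  simp

/-- The trace of a function in `H¹` belongs to `H^{1/2}`. -/
lemma summable_abs_mul_fourierCoeff_trace {u : L2Cyl ℂ} {g : L2Circ ℂ} (h : u ∈ H1 ℂ)
    (hg : IsTrace u g) : Summable fun k : ℤ => |(k : ℝ)| * ‖fourierCoeff g k‖ ^ 2 := by
  obtain ⟨us, hus⟩ := isTrace_iff.1 hg
  obtain ⟨-, w, hw⟩ := h
  refine Summable.of_nonneg_of_le (fun k => by positivity) (fun k => ?_)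
    ((summable_norm_mode_sq w).add (summable_norm_mode_sq us))
  have h1 := (hus k).norm_trace_sq_le
  have h2 : ‖mode k w‖ = 2 * Real.pi * |(k : ℝ)| * ‖mode k u‖ := by
    rw [hasWeakT_iff.1 hw k, norm_smul, norm_two_pi_I_mul]
  -- The weight `|k|` of `H^{1/2}` is absorbed by the `t`-derivative `w`, the other factor of the
  -- trace estimate being the `s`-derivative.
  have h3 : |(k : ℝ)| * ‖mode k u‖ ≤ ‖mode k w‖ := by
    rw [h2, mul_assoc]
    have : 0 ≤ |(k : ℝ)| * ‖mode k u‖ := by positivity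
    nlinarith [Real.pi_gt_three]
  calc |(k : ℝ)| * ‖fourierCoeff g k‖ ^ 2 ≤ |(k : ℝ)| * (2 * (‖mode k u‖ * ‖mode k us‖)) := by gcongr
    _ = 2 * ((|(k : ℝ)| * ‖mode k u‖) * ‖mode k us‖) := by ring
    _ ≤ 2 * (‖mode k w‖ * ‖mode k us‖) := by gcongr
    _ ≤ _ := by nlinarith [sq_nonneg (‖mode k w‖ - ‖mode k us‖)]

/-! ### The operator in terms of Fourier modes -/

lemma ofReal_smul_L2 {α : Type*} [MeasurableSpace α] {μ : Measure α} (r : ℝ) (U : Lp ℂ 2 μ) :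
    (r : ℂ) • U = r • U := by
  refine Lp.ext ?_
  filter_upwards [Lp.coeFn_smul (r : ℂ) U, Lp.coeFn_smul r U] with x h1 h2
  rw [h1, h2, Pi.smul_apply, Pi.smul_apply, Complex.coe_smul]

/-- The coefficient `2πik + b`. -/
def zmode (b : ℝ) (k : ℤ) : ℂ := 2 * Real.pi * Complex.I * k + b

lemma conj_zmode (b : ℝ) (k : ℤ) : conj (zmode b k) = -(2 * Real.pi * Complex.I * k) + b := by
  simp [zmode, map_ofNat]

/-- The relation `T u = (f, h)` mode by mode, for `J A = a + b (q ↔ p)`. -/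
def ModeRel (a b : ℝ) (u f : L2Cyl (PhaseSpace 1)) (h : L2Circ (EuclideanSpace ℝ (Fin 1))) : Prop :=
  ∀ k : ℤ, ∃ c d,
    HasDerivTrace (mode k (cq u))
      ((a : ℂ) • mode k (cq u) + zmode b k • mode k (cp u) + mode k (cq f)) c ∧
    HasDerivTrace (mode k (cp u))
      (conj (zmode b k) • mode k (cq u) + (a : ℂ) • mode k (cp u) + mode k (cp f)) d ∧
    coordFourier h 0 k = 2 * Real.pi * Complex.I * k * c

lemma coordFourier_eq {n : ℕ} (h : L2Circ (EuclideanSpace ℝ (Fin n))) (i : Fin n) (k : ℤ) :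
    coordFourier h i k = fourierCoeff (coordL2 _ i h) k :=
  congrFun (fourierCoeff_congr_ae (coeFn_coordL2 i h).symm) k

lemma ext_fourierCoeff {g g' : L2Circ ℂ} (h : ∀ k, fourierCoeff g k = fourierCoeff g' k) :
    g = g' := by
  refine (fourierBasis (T := (1 : ℝ))).repr.injective ?_
  ext k
  rw [fourierBasis_repr, fourierBasis_repr, h]

lemma ext_coordFourier {h h' : L2Circ (EuclideanSpace ℝ (Fin 1))}
    (e : ∀ k, coordFourier h 0 k = coordFourier h' 0 k) : h = h' :=
  coordL2_ext fun i => ext_fourierCoeff fun k => by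
    rw [Subsingleton.elim i 0, ← coordFourier_eq, ← coordFourier_eq, e]

namespace ModeRel

variable {a b : ℝ} {u f u' f' : L2Cyl (PhaseSpace 1)} {h h' : L2Circ (EuclideanSpace ℝ (Fin 1))}

/-- Derivative and trace of each mode are unique, so the relation is the graph of a map. This makes
`T` well defined and linear whatever weak derivatives and traces are chosen. -/
lemma unique (h1 : ModeRel a b u f h) (h2 : ModeRel a b u f' h') : f = f' ∧ h = h' := by
  have key : ∀ k, mode k (cq f) = mode k (cq f') ∧ mode k (cp f) = mode k (cp f') ∧
      coordFourier h 0 k = coordFourier h' 0 k := by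
    intro k
    obtain ⟨c, d, e1, e2, e3⟩ := h1 k
    obtain ⟨c', d', e1', e2', e3'⟩ := h2 k
    refine ⟨add_left_cancel (e1.unique e1').1, add_left_cancel (e2.unique e2').1, ?_⟩
    rw [e3, e3', (e1.unique e1').2]
  exact ⟨coordL2_ext (coord_cases (ext_mode fun k => (key k).1) (ext_mode fun k => (key k).2.1)),
    ext_coordFourier fun k => (key k).2.2⟩

lemma add (h1 : ModeRel a b u f h) (h2 : ModeRel a b u' f' h') :
    ModeRel a b (u + u') (f + f') (h + h') := fun k => by
  obtain ⟨c, d, e1, e2, e3⟩ := h1 k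
  obtain ⟨c', d', e1', e2', e3'⟩ := h2 k
  refine ⟨c + c', d + d', ?_, ?_, ?_⟩
  · convert e1.add e1' using 1
    · simp only [map_add]
    · simp only [map_add, smul_add]; abel
  · convert e2.add e2' using 1
    · simp only [map_add]
    · simp only [map_add, smul_add]; abel
  · rw [coordFourier_add, e3, e3']; ring

lemma smul (r : ℝ) (h1 : ModeRel a b u f h) : ModeRel a b (r • u) (r • f) (r • h) := fun k => by
  obtain ⟨c, d, e1, e2, e3⟩ := h1 k
  have hm : ∀ U : L2Cyl ℂ, mode k (r • U) = (r : ℂ) • mode k U := fun U => by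
    rw [← ofReal_smul_L2, map_smul]
  refine ⟨r * c, r * d, ?_, ?_, ?_⟩
  · convert e1.smul r using 1
    · simp only [map_smul, hm]
    · simp only [map_smul, hm, smul_add, smul_comm (r : ℂ)]
  · convert e2.smul r using 1
    · simp only [map_smul, hm]
    · simp only [map_smul, hm, smul_add, smul_comm (r : ℂ)]
  · rw [coordFourier_smul, e3]; ring

end ModeRel

/-- The relation defining the operator `T`, for constant `A` and `α = 0`. -/
def OpRel (A : PhaseMatrix 1) (u f : L2Cyl (PhaseSpace 1))
    (h : L2Circ (EuclideanSpace ℝ (Fin 1))) : Prop :=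
  ∃ (us ut : L2Cyl (PhaseSpace 1)) (g h' : L2Circ (PhaseSpace 1)),
    HasWeakS u us ∧ HasWeakT u ut ∧ IsTrace u g ∧ IsTrace ut h' ∧
    (∀ᵐ x ∂cylMeasure, f x = us x + (Matrix.J (Fin 1) ℝ).toEuclideanLin (ut x) -
      (Matrix.J (Fin 1) ℝ).toEuclideanLin (A.toEuclideanLin (u x))) ∧
    (∀ᵐ t ∂(haarAddCircle (T := (1 : ℝ))), h t =
      proj (h' t) - (0 : Matrix (Fin 1) (Fin 1 ⊕ Fin 1) ℝ).toEuclideanLin (g t))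

lemma isOperatorT_iff {A : PhaseMatrix 1}
    {T : H2 (PhaseSpace 1) →ₗ[ℝ] H1 (PhaseSpace 1) × HHalf 1} :
    IsOperatorT (fun _ => Matrix.J (Fin 1) ℝ) (fun _ => A) (fun _ => 0) T ↔
      ∀ u : H2 (PhaseSpace 1), OpRel A u.1 (T u).1.1 (T u).2.1 := Iff.rfl

/-- `J A = a + b (q ↔ p)`. -/
def IsSwapForm (A : PhaseMatrix 1) (a b : ℝ) : Prop :=
  ∀ x : PhaseSpace 1,
    (Matrix.J (Fin 1) ℝ).toEuclideanLin (A.toEuclideanLin x) iq = a * x iq + b * x ip ∧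
    (Matrix.J (Fin 1) ℝ).toEuclideanLin (A.toEuclideanLin x) ip = b * x iq + a * x ip

lemma toEuclideanLin_J (x : PhaseSpace 1) :
    (Matrix.J (Fin 1) ℝ).toEuclideanLin x iq = - x ip ∧
    (Matrix.J (Fin 1) ℝ).toEuclideanLin x ip = x iq := by
  constructor <;>
  simp [Matrix.J, Matrix.toLpLin_apply, Matrix.mulVec, dotProduct, iq, ip]

/-- In coordinates the equation reads `q_s = p_t + a q + b p + f_q` and `p_s = -q_t + b q + a p +
f_p`, and on modes `∂_t` is multiplication by `2πik`. -/
lemma OpRel.modeRel {A : PhaseMatrix 1} {a b : ℝ} (hA : IsSwapForm A a b)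
    {u f : L2Cyl (PhaseSpace 1)} {h : L2Circ (EuclideanSpace ℝ (Fin 1))} (H : OpRel A u f h) :
    ModeRel a b u f h := by
  obtain ⟨us, ut, g, h', hs, ht, -, hh, e1, e2⟩ := H
  have fq : cq us = cp ut + (a : ℂ) • cq u + (b : ℂ) • cp u + cq f := by
    refine Lp.ext ?_
    filter_upwards [e1, coeFn_coordL2 iq us, coeFn_coordL2 ip ut, coeFn_coordL2 iq u,
      coeFn_coordL2 ip u, coeFn_coordL2 iq f, Lp.coeFn_smul (a : ℂ) (cq u),
      Lp.coeFn_smul (b : ℂ) (cp u), Lp.coeFn_add (cp ut) ((a : ℂ) • cq u),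
      Lp.coeFn_add (cp ut + (a : ℂ) • cq u) ((b : ℂ) • cp u),
      Lp.coeFn_add (cp ut + (a : ℂ) • cq u + (b : ℂ) • cp u) (cq f)]
      with x e h1 h2 h3 h4 h5 h6 h7 h8 h9 h10
    rw [h10, Pi.add_apply, h9, Pi.add_apply, h8, Pi.add_apply, h7, h6, Pi.smul_apply, Pi.smul_apply,
      h1, h2, h3, h4, h5, e]
    simp only [PiLp.sub_apply, PiLp.add_apply, (hA _).1, (toEuclideanLin_J _).1, smul_eq_mul]
    push_cast
    ring
  have fp : cp us = -cq ut + (b : ℂ) • cq u + (a : ℂ) • cp u + cp f := by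
    refine Lp.ext ?_
    filter_upwards [e1, coeFn_coordL2 ip us, coeFn_coordL2 iq ut, coeFn_coordL2 iq u,
      coeFn_coordL2 ip u, coeFn_coordL2 ip f, Lp.coeFn_smul (b : ℂ) (cq u),
      Lp.coeFn_smul (a : ℂ) (cp u), Lp.coeFn_neg (cq ut), Lp.coeFn_add (-cq ut) ((b : ℂ) • cq u),
      Lp.coeFn_add (-cq ut + (b : ℂ) • cq u) ((a : ℂ) • cp u),
      Lp.coeFn_add (-cq ut + (b : ℂ) • cq u + (a : ℂ) • cp u) (cp f)]
      with x e h1 h2 h3 h4 h5 h6 h7 hn h8 h9 h10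
    rw [h10, Pi.add_apply, h9, Pi.add_apply, h8, Pi.add_apply, h7, h6, hn, Pi.smul_apply,
      Pi.smul_apply, Pi.neg_apply, h1, h2, h3, h4, h5, e]
    simp only [PiLp.sub_apply, PiLp.add_apply, (hA _).2, (toEuclideanLin_J _).2, smul_eq_mul]
    push_cast
    ring
  have hh0 : coordL2 _ 0 h = coordL2 _ iq h' := by
    refine Lp.ext ?_
    filter_upwards [e2, coeFn_coordL2 0 h, coeFn_coordL2 iq h'] with t e h1 h2
    rw [h1, h2, e]
    simp [proj, iq]
  intro k
  have tq := hasWeakT_iff.1 (ht.map (coordCLM iq)) k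
  have tp := hasWeakT_iff.1 (ht.map (coordCLM ip)) k
  obtain ⟨c, hc⟩ := hasWeakS_iff.1 (hs.map (coordCLM iq)) k
  obtain ⟨d, hd⟩ := hasWeakS_iff.1 (hs.map (coordCLM ip)) k
  obtain ⟨uts, huts⟩ := isTrace_iff.1 (hh.map (coordCLM iq))
  have hk := huts k
  change HasDerivTrace (mode k (cq u)) (mode k (cq us)) c at hc
  change HasDerivTrace (mode k (cp u)) (mode k (cp us)) d at hd
  change mode k (cq ut) = _ • mode k (cq u) at tq
  change mode k (cp ut) = _ • mode k (cp u) at tp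
  change HasDerivTrace (mode k (cq ut)) (mode k uts) (fourierCoeff (coordL2 _ iq h') k) at hk
  refine ⟨c, d, ?_, ?_, ?_⟩
  · rw [fq] at hc
    simp only [map_add, map_smul] at hc
    rw [tp] at hc
    convert hc using 1
    rw [zmode, add_smul]
    abel
  · rw [fp] at hd
    simp only [map_add, map_smul, map_neg] at hd
    rw [tq] at hd
    convert hd using 1
    rw [conj_zmode, add_smul, neg_smul]
  -- The trace was taken of `∂_t q`; uniqueness of traces in the mode `k` shows that it is `2πik`
  -- times the trace of `q`.
  · rw [tq] at hk
    rw [coordFourier_eq, hh0, (hk.unique (hc.smul _)).2]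

/-- `T` takes values in the stated space: `u`, `∂_s u`, `∂_t u` are in `H¹`, and traces of `H¹`
functions are in `H^{1/2}`. -/
lemma exists_opRel (A : PhaseMatrix 1) {u : L2Cyl (PhaseSpace 1)} (hu : u ∈ H2 (PhaseSpace 1)) :
    ∃ w : H1 (PhaseSpace 1) × HHalf 1, OpRel A u w.1.1 w.2.1 := by
  obtain ⟨⟨us, mus, hus⟩, ⟨ut, mT, hut⟩⟩ := hu
  have mu : u ∈ H1 (PhaseSpace 1) := ⟨⟨us, hus⟩, ⟨ut, hut⟩⟩
  obtain ⟨g, hg⟩ := exists_isTrace mu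
  obtain ⟨h', hh'⟩ := exists_isTrace mT
  set LJ : PhaseSpace 1 →L[ℝ] PhaseSpace 1 :=
    LinearMap.toContinuousLinearMap (Matrix.J (Fin 1) ℝ).toEuclideanLin with hLJ
  set LA : PhaseSpace 1 →L[ℝ] PhaseSpace 1 :=
    LinearMap.toContinuousLinearMap A.toEuclideanLin with hLA
  set h : L2Circ (EuclideanSpace ℝ (Fin 1)) := ofCoordL2 _ 0 (coordL2 _ iq h') with hh
  have hc : coordL2 _ 0 h = coordL2 _ iq h' := by
    rw [hh, coordL2_ofCoordL2, if_pos rfl, conjL2_coordL2, ← two_smul ℂ, smul_smul]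
    norm_num
  have hmem : h ∈ HHalf 1 := fun i => by
    simp only [coordFourier_eq]
    rw [Subsingleton.elim i 0, hc]
    exact summable_abs_mul_fourierCoeff_trace (mem_H1_map (coordCLM iq) mT)
      (hh'.map (coordCLM iq))
  refine ⟨⟨⟨us + LJ.compLpL 2 cylMeasure ut -
    LJ.compLpL 2 cylMeasure (LA.compLpL 2 cylMeasure u), ?_⟩, ⟨h, hmem⟩⟩,
    us, ut, g, h', hus, hut, hg, hh', ?_, ?_⟩
  · exact sub_mem (add_mem mus (mem_H1_map _ mT)) (mem_H1_map _ (mem_H1_map _ mu))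
  · filter_upwards [Lp.coeFn_sub (us + LJ.compLpL 2 cylMeasure ut)
      (LJ.compLpL 2 cylMeasure (LA.compLpL 2 cylMeasure u)),
      Lp.coeFn_add us (LJ.compLpL 2 cylMeasure ut), LJ.coeFn_compLpL (p := 2) ut,
      LJ.coeFn_compLpL (p := 2) (LA.compLpL 2 cylMeasure u), LA.coeFn_compLpL (p := 2) u]
      with x h1 h2 h3 h4 h5
    rw [h1, Pi.sub_apply, h2, Pi.add_apply, h3, h4, h5]
    rfl
  · filter_upwards [coeFn_coordL2 0 h, coeFn_coordL2 iq h'] with t h1 h2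
    ext i
    rw [hc, h2] at h1
    have : h' t iq = h t 0 := by exact_mod_cast h1
    rw [Subsingleton.elim i 0]
    simp [proj, ← this, iq]

/-- The operator `T` exists, is unique, and is characterized by the Fourier modes. -/
lemma exists_operatorT {A : PhaseMatrix 1} {a b : ℝ} (hA : IsSwapForm A a b) :
    ∃ T : H2 (PhaseSpace 1) →ₗ[ℝ] H1 (PhaseSpace 1) × HHalf 1,
      (∀ T', IsOperatorT (fun _ => Matrix.J (Fin 1) ℝ) (fun _ => A) (fun _ => 0) T' ↔ T' = T) ∧
      ∀ u w, T u = w ↔ ModeRel a b u.1 w.1.1 w.2.1 := by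
  choose w hw using fun u : H2 (PhaseSpace 1) => exists_opRel A u.2
  have hm : ∀ u, ModeRel a b u.1 (w u).1.1 (w u).2.1 := fun u => (hw u).modeRel hA
  have huniq : ∀ {u : H2 (PhaseSpace 1)} {v : H1 (PhaseSpace 1) × HHalf 1},
      ModeRel a b u.1 v.1.1 v.2.1 → w u = v := fun {u v} h => by
    obtain ⟨e1, e2⟩ := (hm u).unique h
    exact Prod.ext (Subtype.ext e1) (Subtype.ext e2)
  let T : H2 (PhaseSpace 1) →ₗ[ℝ] H1 (PhaseSpace 1) × HHalf 1 :=
    { toFun := w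
      map_add' := fun u u' => huniq ((hm u).add (hm u'))
      map_smul' := fun r u => huniq ((hm u).smul r) }
  refine ⟨T, fun T' => ⟨fun h => ?_, fun h => ?_⟩, fun u v => ⟨?_, fun h => huniq h⟩⟩
  · ext1 u
    exact (huniq ((isOperatorT_iff.1 h u).modeRel hA)).symm
  · rw [h]
    exact isOperatorT_iff.2 hw
  · rintro rfl
    exact hm u

/-! ### Regularity -/

lemma exists_hasWeakT {U : L2Cyl ℂ} (h : Summable fun k : ℤ => (k : ℝ) ^ 2 * ‖mode k U‖ ^ 2) :
    ∃ V, HasWeakT U V := by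
  obtain ⟨V, hV⟩ := exists_mode_eq (y := fun k => (2 * Real.pi * Complex.I * k : ℂ) • mode k U) (by
    refine (h.mul_left ((2 * Real.pi) ^ 2)).congr fun k => ?_
    rw [norm_smul, norm_two_pi_I_mul]
    linear_combination -(2 * Real.pi * ‖mode k U‖) ^ 2 * sq_abs (k : ℝ))
  exact ⟨V, hasWeakT_iff.2 hV⟩

/-- The second derivatives in the direction of the circle. -/
lemma exists_hasWeakT_hasWeakT {U : L2Cyl ℂ}
    (h : Summable fun k : ℤ => (k : ℝ) ^ 4 * ‖mode k U‖ ^ 2) :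
    ∃ V W, HasWeakT U V ∧ HasWeakT V W := by
  obtain ⟨V, hV⟩ := exists_hasWeakT (U := U) (by
    refine Summable.of_nonneg_of_le (fun k => by positivity) (fun k => ?_) h
    have : (k : ℝ) ^ 2 ≤ (k : ℝ) ^ 4 := by
      have : k ^ 2 ≤ k ^ 4 := by
        rcases eq_or_ne k 0 with rfl | hk
        · simp
        · have : 1 ≤ k ^ 2 := Int.one_le_abs hk |> fun h => by rw [← sq_abs]; nlinarith
          nlinarith
      exact_mod_cast this
    gcongr)
  obtain ⟨W, hW⟩ := exists_hasWeakT (U := V) (by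
    refine (h.mul_left ((2 * Real.pi) ^ 2)).congr fun k => ?_
    rw [hasWeakT_iff.1 hV, norm_smul, norm_two_pi_I_mul]
    linear_combination -(k * 2 * Real.pi * ‖mode k U‖) ^ 2 * sq_abs (k : ℝ))
  exact ⟨V, W, hV, hW⟩

/-- Only regularity along the circle has to be assumed. The equations express `U_s` and `V_s`
through `U`, `V`, their `t`-derivatives and the `H¹` data, so the remaining second derivatives come
for free. -/
lemma mem_H2_of_modes {a b : ℝ} {U V F G : L2Cyl ℂ} (hF : F ∈ H1 ℂ) (hG : G ∈ H1 ℂ)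
    (h1 : ∀ k, ∃ c, HasDerivTrace (mode k U)
      ((a : ℂ) • mode k U + zmode b k • mode k V + mode k F) c)
    (h2 : ∀ k, ∃ d, HasDerivTrace (mode k V)
      (conj (zmode b k) • mode k U + (a : ℂ) • mode k V + mode k G) d)
    (sU : Summable fun k : ℤ => (k : ℝ) ^ 4 * ‖mode k U‖ ^ 2)
    (sV : Summable fun k : ℤ => (k : ℝ) ^ 4 * ‖mode k V‖ ^ 2) : U ∈ H2 ℂ ∧ V ∈ H2 ℂ := by
  obtain ⟨Ut, Utt, hUt, hUtt⟩ := exists_hasWeakT_hasWeakT sU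
  obtain ⟨Vt, Vtt, hVt, hVtt⟩ := exists_hasWeakT_hasWeakT sV
  have hm : ∀ (r : ℝ) (k : ℤ) (X : L2Cyl ℂ), mode k (r • X) = (r : ℂ) • mode k X := fun r k X => by
    rw [← ofReal_smul_L2, map_smul]
  have hUs : HasWeakS U (a • U + Vt + b • V + F) := hasWeakS_iff.2 fun k => by
    obtain ⟨c, hc⟩ := h1 k
    refine ⟨c, ?_⟩
    simp only [map_add, hm, hasWeakT_iff.1 hVt k]
    convert hc using 1
    rw [zmode, add_smul]
    abel
  have hVs : HasWeakS V ((-1 : ℝ) • Ut + b • U + a • V + G) := hasWeakS_iff.2 fun k => by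
    obtain ⟨d, hd⟩ := h2 k
    refine ⟨d, ?_⟩
    simp only [map_add, hm, hasWeakT_iff.1 hUt k]
    convert hd using 1
    rw [conj_zmode, add_smul, smul_smul]
    congr 4
    push_cast
    ring
  obtain ⟨Ft, hFt⟩ := hF.2
  obtain ⟨Gt, hGt⟩ := hG.2
  have hUst : HasWeakT (a • U + Vt + b • V + F) (a • Ut + Vtt + b • Vt + Ft) :=
    (((hUt.smul a).add hVtt).add (hVt.smul b)).add hFt
  have hVst : HasWeakT ((-1 : ℝ) • Ut + b • U + a • V + G) ((-1 : ℝ) • Utt + b • Ut + a • Vt + Gt) :=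
    (((hUtt.smul (-1)).add (hUt.smul b)).add (hVt.smul a)).add hGt
  -- Mixed derivatives commute, since on each mode `∂_t` is a scalar.
  have comm : ∀ {X Xs Xt Xst : L2Cyl ℂ}, HasWeakS X Xs → HasWeakT X Xt → HasWeakT Xs Xst →
      HasWeakS Xt Xst := fun hs ht hst => hasWeakS_iff.2 fun k => by
    obtain ⟨c, hc⟩ := hasWeakS_iff.1 hs k
    rw [hasWeakT_iff.1 ht k, hasWeakT_iff.1 hst k]
    exact ⟨_, hc.smul _⟩
  have mU : U ∈ H1 ℂ := ⟨⟨_, hUs⟩, ⟨_, hUt⟩⟩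
  have mV : V ∈ H1 ℂ := ⟨⟨_, hVs⟩, ⟨_, hVt⟩⟩
  have mUt : Ut ∈ H1 ℂ := ⟨⟨_, comm hUs hUt hUst⟩, ⟨_, hUtt⟩⟩
  have mVt : Vt ∈ H1 ℂ := ⟨⟨_, comm hVs hVt hVst⟩, ⟨_, hVtt⟩⟩
  refine ⟨⟨⟨_, ?_, hUs⟩, ⟨_, mUt, hUt⟩⟩, ⟨⟨_, ?_, hVs⟩, ⟨_, mVt, hVt⟩⟩⟩
  · exact add_mem (add_mem (add_mem (Submodule.smul_mem _ _ mU) mVt) (Submodule.smul_mem _ _ mV)) hF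
  · exact add_mem (add_mem (add_mem (Submodule.smul_mem _ _ mUt) (Submodule.smul_mem _ _ mU))
      (Submodule.smul_mem _ _ mV)) hG

/-! ### Real parts -/

lemma mode_neg_coordL2 (i : Fin 1 ⊕ Fin 1) (u : L2Cyl (PhaseSpace 1)) (k : ℤ) :
    mode (-k) (coordL2 cylMeasure i u) = conjL2 _ (mode k (coordL2 cylMeasure i u)) := by
  have := mode_conjL2 (-k) (coordL2 cylMeasure i u)
  rwa [conjL2_coordL2, neg_neg] at this

lemma fourierCoeff_conjL2 (g : L2Circ ℂ) (k : ℤ) :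
    fourierCoeff (conjL2 _ g) k = conj (fourierCoeff g (-k)) := by
  rw [fourierCoeff_congr_ae (coeFn_conjL2 g), fourierCoeff, fourierCoeff, ← integral_conj]
  refine integral_congr_ae (Eventually.of_forall fun t => ?_)
  simp

lemma coordFourier_neg {n : ℕ} (h : L2Circ (EuclideanSpace ℝ (Fin n))) (i : Fin n) (k : ℤ) :
    coordFourier h i (-k) = conj (coordFourier h i k) := by
  rw [coordFourier_eq, coordFourier_eq]
  nth_rewrite 1 [← conjL2_coordL2]
  rw [fourierCoeff_conjL2, neg_neg]

lemma conjL2_smul {α : Type*} [MeasurableSpace α] {μ : Measure α} (c : ℂ) (u : Lp ℂ 2 μ) :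
    conjL2 μ (c • u) = conj c • conjL2 μ u := by
  refine Lp.ext ?_
  filter_upwards [coeFn_conjL2 (c • u), Lp.coeFn_smul c u, coeFn_conjL2 u,
    Lp.coeFn_smul (conj c) (conjL2 μ u)] with x h1 h2 h3 h4
  rw [h1, h2, h4, Pi.smul_apply, Pi.smul_apply, h3]
  simp

lemma zmode_neg (b : ℝ) (k : ℤ) : zmode b (-k) = conj (zmode b k) := by
  rw [conj_zmode, zmode]
  push_cast
  ring

/-- The function with given complex components, after taking the real part. -/
def realPair (U V : L2Cyl ℂ) : L2Cyl (PhaseSpace 1) := ofCoordL2 _ iq U + ofCoordL2 _ ip V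

lemma mode_cq_realPair (U V : L2Cyl ℂ) (k : ℤ) :
    mode k (cq (realPair U V)) = (1 / 2 : ℂ) • (mode k U + conjL2 _ (mode (-k) U)) := by
  rw [realPair, map_add, coordL2_ofCoordL2, coordL2_ofCoordL2, if_pos rfl, if_neg (by simp),
    add_zero, map_smul, map_add, mode_conjL2]

lemma mode_cp_realPair (U V : L2Cyl ℂ) (k : ℤ) :
    mode k (cp (realPair U V)) = (1 / 2 : ℂ) • (mode k V + conjL2 _ (mode (-k) V)) := by
  rw [realPair, map_add, coordL2_ofCoordL2, coordL2_ofCoordL2, if_pos rfl, if_neg (by simp),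
    zero_add, map_smul, map_add, mode_conjL2]

lemma mem_H2_realPair {U V : L2Cyl ℂ} (hU : U ∈ H2 ℂ) (hV : V ∈ H2 ℂ) :
    realPair U V ∈ H2 (PhaseSpace 1) := add_mem (mem_H2_map _ hU) (mem_H2_map _ hV)

/-- Conjugating the equations of the mode `-k` gives those of the mode `k`, because `f` and `h` are
real and `zmode b (-k)` is the conjugate of `zmode b k`. The average of the two solutions is
therefore a real solution. -/
lemma modeRel_realPair {a b : ℝ} {U V : L2Cyl ℂ} {f : L2Cyl (PhaseSpace 1)}
    {h : L2Circ (EuclideanSpace ℝ (Fin 1))}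
    (H : ∀ k : ℤ, ∃ c d,
      HasDerivTrace (mode k U) ((a : ℂ) • mode k U + zmode b k • mode k V + mode k (cq f)) c ∧
      HasDerivTrace (mode k V)
        (conj (zmode b k) • mode k U + (a : ℂ) • mode k V + mode k (cp f)) d ∧
      coordFourier h 0 k = 2 * Real.pi * Complex.I * k * c) :
    ModeRel a b (realPair U V) f h := fun k => by
  obtain ⟨c, d, h1, h2, h3⟩ := H k
  obtain ⟨c', d', h1', h2', h3'⟩ := H (-k)
  refine ⟨(1 / 2) * (c + conj c'), (1 / 2) * (d + conj d'), ?_, ?_, ?_⟩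
  · have := (h1.add h1'.conj).smul (1 / 2)
    rw [mode_neg_coordL2] at this
    simp only [map_add, conjL2_smul, zmode_neg, Complex.conj_conj, Complex.conj_ofReal] at this
    rw [mode_cq_realPair, mode_cp_realPair]
    convert this using 1
    rw [show conjL2 (volume.restrict (Iic (0 : ℝ))) (conjL2 _ (mode k (cq f))) = mode k (cq f) by
      rw [← mode_neg_coordL2, ← mode_conjL2, conjL2_coordL2]]
    module
  · have := (h2.add h2'.conj).smul (1 / 2)
    rw [mode_neg_coordL2] at this
    simp only [map_add, conjL2_smul, zmode_neg, Complex.conj_conj, Complex.conj_ofReal] at this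
    rw [mode_cq_realPair, mode_cp_realPair]
    convert this using 1
    rw [show conjL2 (volume.restrict (Iic (0 : ℝ))) (conjL2 _ (mode k (cp f))) = mode k (cp f) by
      rw [← mode_neg_coordL2, ← mode_conjL2, conjL2_coordL2]]
    module
  · have e : coordFourier h 0 k = 2 * Real.pi * Complex.I * k * conj c' := by
      rw [← Complex.conj_conj (coordFourier h 0 k), ← coordFourier_neg, h3']
      simp [map_ofNat]
    linear_combination (1 / 2) * h3 + (1 / 2) * e

/-! ### Diagonalization -/

/-- The sign of a Boolean. -/
def sg (β : Bool) : ℝ := if β then 1 else -1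

lemma sg_true : sg true = 1 := rfl

lemma sg_false : sg false = -1 := rfl

lemma sg_mul_self (β : Bool) : sg β * sg β = 1 := by cases β <;> simp [sg]

/-- The phase of `2πik + b`. -/
def zeta (b : ℝ) (k : ℤ) : ℂ := if zmode b k = 0 then 1 else zmode b k / ‖zmode b k‖

/-- The default value `1` of the phase keeps both this identity and `|ζ| = 1` valid when `zmode b k
= 0`, which happens for `b = 0`, `k = 0`. -/
lemma norm_mul_zeta (b : ℝ) (k : ℤ) : ‖zmode b k‖ * zeta b k = zmode b k := by
  unfold zeta
  split_ifs with h
  · simp [h]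
  · have : (‖zmode b k‖ : ℂ) ≠ 0 := by exact_mod_cast norm_ne_zero_iff.2 h
    field_simp

lemma conj_zmode_eq (b : ℝ) (k : ℤ) :
    conj (zmode b k) = ‖zmode b k‖ * conj (zeta b k) := by
  nth_rewrite 1 [← norm_mul_zeta]
  rw [map_mul, Complex.conj_ofReal]

lemma norm_zeta (b : ℝ) (k : ℤ) : ‖zeta b k‖ = 1 := by
  unfold zeta
  split_ifs with h
  · simp
  · rw [norm_div, Complex.norm_real, norm_norm, div_self (norm_ne_zero_iff.2 h)]

lemma zeta_neg (b : ℝ) (k : ℤ) : zeta b (-k) = conj (zeta b k) := by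
  unfold zeta
  rw [zmode_neg]
  by_cases h : zmode b k = 0 <;> simp [h]

lemma zeta_mul_conj (b : ℝ) (k : ℤ) : zeta b k * conj (zeta b k) = 1 := by
  rw [Complex.mul_conj', norm_zeta]
  simp

/-- The eigenvalues `a ± |2πik + b|`. -/
def lam (a b : ℝ) (k : ℤ) (β : Bool) : ℝ := a + sg β * ‖zmode b k‖

lemma lam_neg (a b : ℝ) (k : ℤ) (β : Bool) : lam a b (-k) β = lam a b k β := by
  rw [lam, zmode_neg, RCLike.norm_conj, lam]

/-- The eigencoordinates `q ± ζ p`. -/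
def eig {E : Type*} [AddCommGroup E] [Module ℂ E] (b : ℝ) (k : ℤ) (β : Bool) (q p : E) : E :=
  q + (sg β * zeta b k) • p

/-- `(1, ± ζ)` are left eigenvectors of the matrix with rows `(a, z)` and `(z̄, a)`, with
eigenvalues `a ± |z|`. -/
lemma HasDerivTrace.eig {a b : ℝ} {k : ℤ} {q p f g : LHalf} {c d : ℂ}
    (h1 : HasDerivTrace q ((a : ℂ) • q + zmode b k • p + f) c)
    (h2 : HasDerivTrace p (conj (zmode b k) • q + (a : ℂ) • p + g) d) (β : Bool) :
    HasDerivTrace (eig b k β q p) ((lam a b k β : ℂ) • HalfCylinder.eig b k β q p +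
      HalfCylinder.eig b k β f g) (HalfCylinder.eig b k β c d) := by
  have := h1.add (h2.smul (sg β * zeta b k))
  unfold HalfCylinder.eig
  convert this using 1
  swap
  · rw [smul_eq_mul]
  have e1 : zmode b k = sg β * (sg β * (‖zmode b k‖ * zeta b k)) := by
    rw [norm_mul_zeta, ← mul_assoc, ← Complex.ofReal_mul, sg_mul_self]
    simp
  have e2 : (sg β * zeta b k) * conj (zmode b k) = sg β * ‖zmode b k‖ := by
    rw [conj_zmode_eq]
    linear_combination (sg β : ℂ) * ‖zmode b k‖ * zeta_mul_conj b k
  have e3 : (sg β * zeta b k) • (conj (zmode b k) • q + (a : ℂ) • p + g) =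
      (sg β * ‖zmode b k‖ : ℂ) • q + (sg β * zeta b k * a) • p + (sg β * zeta b k) • g := by
    rw [smul_add, smul_add, smul_smul, smul_smul, e2]
  have e4 : zmode b k • p = (sg β * (sg β * (‖zmode b k‖ * zeta b k)) : ℂ) • p := by rw [← e1]
  rw [e3, e4, lam]
  push_cast
  module

lemma norm_zmode_ge (b : ℝ) (k : ℤ) : 2 * Real.pi * |(k : ℝ)| ≤ ‖zmode b k‖ := by
  have h : (zmode b k).im = 2 * Real.pi * k := by simp [zmode]
  have := Complex.abs_im_le_norm (zmode b k)
  rwa [h, abs_mul, abs_of_pos Real.two_pi_pos] at this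

/-- Back from the eigencoordinates. -/
lemma HasDerivTrace.of_eig {a b : ℝ} {k : ℤ} {w v f g : LHalf} {c d : ℂ}
    (h1 : HasDerivTrace w ((lam a b k true : ℂ) • w + HalfCylinder.eig b k true f g) c)
    (h2 : HasDerivTrace v ((lam a b k false : ℂ) • v + HalfCylinder.eig b k false f g) d) :
    HasDerivTrace ((1 / 2 : ℂ) • (w + v)) ((a : ℂ) • ((1 / 2 : ℂ) • (w + v)) +
      zmode b k • ((conj (zeta b k) / 2) • (w - v)) + f) (1 / 2 * (c + d)) ∧
    HasDerivTrace ((conj (zeta b k) / 2) • (w - v)) (conj (zmode b k) • ((1 / 2 : ℂ) • (w + v)) +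
      (a : ℂ) • ((conj (zeta b k) / 2) • (w - v)) + g) (conj (zeta b k) / 2 * (c - d)) := by
  have hz := zeta_mul_conj b k
  constructor
  · convert (h1.add h2).smul (1 / 2) using 1
    simp only [HalfCylinder.eig, lam, sg_true, sg_false]
    have e : zmode b k * (conj (zeta b k) / 2) = ‖zmode b k‖ / 2 := by
      nth_rewrite 1 [← norm_mul_zeta]
      linear_combination (‖zmode b k‖ / 2 : ℂ) * hz
    rw [smul_smul (zmode b k), e]
    push_cast
    module
  · convert (h1.sub h2).smul (conj (zeta b k) / 2) using 1
    simp only [HalfCylinder.eig, lam, sg_true, sg_false]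
    have e2 : g = (conj (zeta b k) * zeta b k) • g := by rw [mul_comm, hz, one_smul]
    nth_rewrite 1 [e2]
    rw [conj_zmode_eq]
    push_cast
    module

/-- A pair of scalar equations with a condition on the sum of the boundary values. -/
lemma exists_solution_pair {l m : ℝ} (hl : l ≠ 0) (hm : m ≠ 0) (F G : LHalf) (S : ℂ)
    (hc : l < 0 → m < 0 → ⟪expHalf (-l), F⟫_ℂ + ⟪expHalf (-m), G⟫_ℂ = S) :
    ∃ w v c d, HasDerivTrace w ((l : ℂ) • w + F) c ∧ HasDerivTrace v ((m : ℂ) • v + G) d ∧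
      c + d = S := by
  have ex : ∀ {r : ℝ}, r ≠ 0 → ∀ X : LHalf, ∃ y e, HasDerivTrace y ((r : ℂ) • y + X) e := by
    intro r hr X
    rcases hr.lt_or_gt with h | h
    · exact exists_solution_neg h X
    · obtain ⟨y, hy⟩ := exists_solution_pos h X 0
      exact ⟨y, 0, hy⟩
  -- An equation with positive rate has a free boundary value, which is used to adjust the sum. Only
  -- when both rates are negative are the two boundary values forced, and then `hc` is needed.
  rcases hl.lt_or_gt with hl' | hl'
  · obtain ⟨w, c, hw⟩ := exists_solution_neg hl' F
    rcases hm.lt_or_gt with hm' | hm'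
    · obtain ⟨v, d, hv⟩ := exists_solution_neg hm' G
      refine ⟨w, v, c, d, hw, hv, ?_⟩
      rw [hw.trace_eq_inner_expHalf hl', hv.trace_eq_inner_expHalf hm', hc hl' hm']
    · obtain ⟨v, hv⟩ := exists_solution_pos hm' G (S - c)
      exact ⟨w, v, c, S - c, hw, hv, by ring⟩
  · obtain ⟨v, d, hv⟩ := ex hm G
    obtain ⟨w, hw⟩ := exists_solution_pos hl' F (S - d)
    exact ⟨w, v, S - d, d, hw, hv, by ring⟩

/-- The negative rate bounds `v` and `d` by `G`; then `c = (c + d) - d` is bounded, and with it `w`.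
The lemma is used with `r = |k|`, and the powers of `r` are those that match `H^{1/2}` and `H¹`
data. -/
lemma solution_pair_estimate {l m r : ℝ} (hr : 0 < r) (hl : r ≤ l) (hm : m ≤ -r)
    {w v F G : LHalf} {c d : ℂ} (hw : HasDerivTrace w ((l : ℂ) • w + F) c)
    (hv : HasDerivTrace v ((m : ℂ) • v + G) d) :
    r ^ 4 * (‖w‖ ^ 2 + ‖v‖ ^ 2) ≤
      2 * r ^ 3 * ‖c + d‖ ^ 2 + 5 * r ^ 2 * (‖F‖ ^ 2 + ‖G‖ ^ 2) := by
  have hm0 : m < 0 := by linarith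
  have hl0 : 0 < l := by linarith
  have hma : r ≤ |m| := by rw [abs_of_neg hm0]; linarith
  have n1 : r * ‖v‖ ≤ ‖G‖ := le_trans (by gcongr)
    (hv.abs_mul_norm_le fun h => absurd h hm0.not_gt)
  have n2 : r * ‖d‖ ^ 2 ≤ 2 * ‖G‖ ^ 2 := le_trans (by gcongr) (hv.abs_mul_norm_trace_sq_le hm0)
  have n3 : ‖c‖ ^ 2 ≤ 2 * ‖c + d‖ ^ 2 + 2 * ‖d‖ ^ 2 := by
    have : ‖c‖ ≤ ‖c + d‖ + ‖d‖ := by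
      calc ‖c‖ = ‖(c + d) - d‖ := by ring_nf
        _ ≤ _ := norm_sub_le _ _
    nlinarith [norm_nonneg c, sq_nonneg (‖c + d‖ - ‖d‖), norm_nonneg d, norm_nonneg (c + d)]
  have n4 := hw.sq_mul_norm_sq_le hl0
  -- Divided by `l²`, the right side of `n4` is decreasing in `l`, so `l` may be replaced by `r`.
  have n5 : r ^ 2 * ‖w‖ ^ 2 ≤ r * ‖c‖ ^ 2 + ‖F‖ ^ 2 := by
    have e1 : ‖w‖ ^ 2 ≤ ‖c‖ ^ 2 / l + ‖F‖ ^ 2 / l ^ 2 := by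
      rw [div_add_div _ _ hl0.ne' (by positivity), le_div_iff₀ (by positivity)]
      nlinarith [mul_le_mul_of_nonneg_left n4 hl0.le]
    have e2 : ‖c‖ ^ 2 / l ≤ ‖c‖ ^ 2 / r := by gcongr
    have e3 : ‖F‖ ^ 2 / l ^ 2 ≤ ‖F‖ ^ 2 / r ^ 2 := by gcongr
    calc r ^ 2 * ‖w‖ ^ 2 ≤ r ^ 2 * (‖c‖ ^ 2 / r + ‖F‖ ^ 2 / r ^ 2) := by gcongr; linarith
      _ = _ := by field_simp
  have n6 : r ^ 2 * ‖v‖ ^ 2 ≤ ‖G‖ ^ 2 := by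
    rw [← mul_pow]; gcongr
  have n7 : r ^ 3 * ‖c‖ ^ 2 ≤ 2 * r ^ 3 * ‖c + d‖ ^ 2 + 4 * r ^ 2 * ‖G‖ ^ 2 := by
    nlinarith [mul_le_mul_of_nonneg_left n3 (by positivity : 0 ≤ r ^ 3),
      mul_le_mul_of_nonneg_left n2 (by positivity : 0 ≤ 2 * r ^ 2)]
  have p1 := mul_le_mul_of_nonneg_left n5 (by positivity : 0 ≤ r ^ 2)
  have p2 := mul_le_mul_of_nonneg_left n6 (by positivity : 0 ≤ r ^ 2)
  nlinarith [sq_nonneg (r * ‖F‖)]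

/-! ### Solvability -/

lemma norm_eig_sq_le {E : Type*} [NormedAddCommGroup E] [NormedSpace ℂ E] (b : ℝ) (k : ℤ)
    (β : Bool) (q p : E) : ‖eig b k β q p‖ ^ 2 ≤ 2 * (‖q‖ ^ 2 + ‖p‖ ^ 2) := by
  have hs : ‖(sg β : ℂ)‖ = 1 := by cases β <;> simp [sg]
  have h : ‖eig b k β q p‖ ≤ ‖q‖ + ‖p‖ := by
    refine (norm_add_le _ _).trans ?_
    rw [norm_smul, norm_mul, hs, norm_zeta, one_mul, one_mul]
  exact (pow_le_pow_left₀ (norm_nonneg _) h 2).trans add_sq_le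

lemma norm_half_smul_sq_le {E : Type*} [NormedAddCommGroup E] [NormedSpace ℂ E] {e : ℂ}
    (he : ‖e‖ = 1 / 2) {x w v : E} (hx : ‖x‖ ≤ ‖w‖ + ‖v‖) :
    ‖e • x‖ ^ 2 ≤ ‖w‖ ^ 2 + ‖v‖ ^ 2 := by
  rw [norm_smul, he]
  have := pow_le_pow_left₀ (norm_nonneg _) hx 2
  nlinarith [sq_nonneg (‖w‖ - ‖v‖), sq_nonneg ‖x‖]

/-- Solution of the equations of a single mode. -/
lemma exists_solution_mode {a b : ℝ} {k : ℤ} (hl : ∀ β, lam a b k β ≠ 0) (f g : LHalf) (S : ℂ)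
    (hc : lam a b k true < 0 → lam a b k false < 0 →
      ⟪expHalf (-lam a b k true), eig b k true f g⟫_ℂ +
        ⟪expHalf (-lam a b k false), eig b k false f g⟫_ℂ = S) :
    ∃ q p d, HasDerivTrace q ((a : ℂ) • q + zmode b k • p + f) (1 / 2 * S) ∧
      HasDerivTrace p (conj (zmode b k) • q + (a : ℂ) • p + g) d ∧
      (k ≠ 0 → |a| ≤ |(k : ℝ)| → ∀ x ∈ ({q, p} : Set LHalf), (k : ℝ) ^ 4 * ‖x‖ ^ 2 ≤
        2 * |(k : ℝ)| ^ 3 * ‖S‖ ^ 2 + 20 * (k : ℝ) ^ 2 * (‖f‖ ^ 2 + ‖g‖ ^ 2)) := by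
  obtain ⟨w, v, c, d, hw, hv, hcd⟩ := exists_solution_pair (hl true) (hl false) _ _ S hc
  obtain ⟨h1, h2⟩ := HasDerivTrace.of_eig hw hv
  rw [hcd] at h1
  refine ⟨_, _, _, h1, h2, fun hk ha => ?_⟩
  have hr : 0 < |(k : ℝ)| := abs_pos.2 (by exact_mod_cast hk)
  have hz := norm_zmode_ge b k
  -- `|z| ≥ 2 |k|` and `|a| ≤ |k|` leave a gap of `|k|` on both sides of zero.
  have hpi : 2 * |(k : ℝ)| ≤ 2 * Real.pi * |(k : ℝ)| := by nlinarith [Real.pi_gt_three]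
  have l1 : |(k : ℝ)| ≤ lam a b k true := by
    rw [lam, sg_true]; linarith [neg_abs_le a]
  have l2 : lam a b k false ≤ -|(k : ℝ)| := by
    rw [lam, sg_false]; linarith [le_abs_self a]
  have E := solution_pair_estimate hr l1 l2 hw hv
  rw [hcd, sq_abs, show |(k : ℝ)| ^ 4 = (k : ℝ) ^ 4 from Even.pow_abs (by decide) _] at E
  have F1 := norm_eig_sq_le b k true f g
  have F2 := norm_eig_sq_le b k false f g
  have key : ∀ x : LHalf, ‖x‖ ^ 2 ≤ ‖w‖ ^ 2 + ‖v‖ ^ 2 → (k : ℝ) ^ 4 * ‖x‖ ^ 2 ≤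
        2 * |(k : ℝ)| ^ 3 * ‖S‖ ^ 2 + 20 * (k : ℝ) ^ 2 * (‖f‖ ^ 2 + ‖g‖ ^ 2) := fun x hx => by
    have := mul_le_mul_of_nonneg_left hx (by positivity : 0 ≤ (k : ℝ) ^ 4)
    have := mul_le_mul_of_nonneg_left (add_le_add F1 F2) (by positivity : 0 ≤ 5 * (k : ℝ) ^ 2)
    linarith
  rintro x (rfl | rfl)
  · exact key _ (norm_half_smul_sq_le (by norm_num) (norm_add_le _ _))
  · refine key _ (norm_half_smul_sq_le ?_ (norm_sub_le _ _))
    rw [norm_div, RCLike.norm_conj, norm_zeta]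
    norm_num

/-- The obstruction to solving `T u = (f, h)` in the mode `k`. -/
def obs (a b : ℝ) (k : ℤ) (f : L2Cyl (PhaseSpace 1)) (h : L2Circ (EuclideanSpace ℝ (Fin 1))) : ℂ :=
  Real.pi * Complex.I * k *
    (⟪expHalf (-lam a b k true), eig b k true (mode k (cq f)) (mode k (cp f))⟫_ℂ +
      ⟪expHalf (-lam a b k false), eig b k false (mode k (cq f)) (mode k (cp f))⟫_ℂ) -
    coordFourier h 0 k

lemma conj_expHalf {l : ℝ} (hl : 0 < l) : conjL2 _ (expHalf l) = expHalf l := by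
  have h := (hasDerivTrace_expHalf hl).conj
  rw [conjL2_smul, Complex.conj_ofReal, map_one] at h
  rw [h.eq_smul_expHalf hl, one_smul]

lemma conjL2_eig (b : ℝ) (k : ℤ) (β : Bool) (q p : LHalf) :
    conjL2 _ (eig b k β q p) = eig b (-k) β (conjL2 _ q) (conjL2 _ p) := by
  rw [eig, eig, map_add, conjL2_smul, map_mul, Complex.conj_ofReal, zeta_neg]

lemma inner_expHalf_conj {l : ℝ} (hl : 0 < l) (u : LHalf) :
    ⟪expHalf l, conjL2 _ u⟫_ℂ = conj ⟪expHalf l, u⟫_ℂ := by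
  nth_rewrite 2 [← conj_expHalf hl]
  rw [inner_conjL2, Complex.conj_conj]

lemma lam_false_le (a b : ℝ) (k : ℤ) : lam a b k false ≤ lam a b k true := by
  rw [lam, lam, sg_true, sg_false]
  linarith [norm_nonneg (zmode b k)]

/-- The negative eigenvalues make the exponentials genuine real functions, so the obstructions in
the modes `k` and `-k` are equivalent and only `k ≥ 1` has to be imposed. -/
lemma obs_neg {a b : ℝ} {k : ℤ} (hk : lam a b k true < 0) (f : L2Cyl (PhaseSpace 1))
    (h : L2Circ (EuclideanSpace ℝ (Fin 1))) : obs a b (-k) f h = conj (obs a b k f h) := by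
  have key : ∀ β, 0 < -lam a b k β →
      ⟪expHalf (-lam a b (-k) β), eig b (-k) β (mode (-k) (cq f)) (mode (-k) (cp f))⟫_ℂ =
      conj ⟪expHalf (-lam a b k β), eig b k β (mode k (cq f)) (mode k (cp f))⟫_ℂ := fun β hβ => by
    rw [mode_neg_coordL2, mode_neg_coordL2, ← conjL2_eig, lam_neg, inner_expHalf_conj hβ]
  rw [obs, obs, key true (by linarith), key false (by linarith [lam_false_le a b k]),
    coordFourier_neg]
  simp

lemma summable_sq_mul_norm_mode {f : L2Cyl (PhaseSpace 1)} (hf : f ∈ H1 (PhaseSpace 1))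
    (i : Fin 1 ⊕ Fin 1) :
    Summable fun k : ℤ => (k : ℝ) ^ 2 * ‖mode k (coordL2 cylMeasure i f)‖ ^ 2 := by
  obtain ⟨V, hV⟩ := (mem_H1_map (coordCLM i) hf).2
  refine Summable.of_nonneg_of_le (fun k => by positivity) (fun k => ?_) (summable_norm_mode_sq V)
  rw [hasWeakT_iff.1 hV k, norm_smul, norm_two_pi_I_mul, ← sq_abs (k : ℝ), ← mul_pow]
  refine pow_le_pow_left₀ (by positivity) ?_ 2
  refine mul_le_mul_of_nonneg_right ?_ (norm_nonneg _)
  nlinarith [Real.pi_gt_three, abs_nonneg (k : ℝ)]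

/-- Solvability of `T u = (f, h)`. -/
lemma exists_modeRel {a b : ℝ} (hl : ∀ k β, lam a b k β ≠ 0) {f : L2Cyl (PhaseSpace 1)}
    {h : L2Circ (EuclideanSpace ℝ (Fin 1))} (hf : f ∈ H1 (PhaseSpace 1)) (hh : h ∈ HHalf 1)
    (h0 : coordFourier h 0 0 = 0) (ho : ∀ k : ℤ, 1 ≤ k → lam a b k true < 0 → obs a b k f h = 0) :
    ∃ u ∈ H2 (PhaseSpace 1), ModeRel a b u f h := by
  have ho' : ∀ k : ℤ, k ≠ 0 → lam a b k true < 0 → obs a b k f h = 0 := fun k hk hk' => by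
    rcases hk.lt_or_gt with h | h
    · have h1 := ho (-k) (by omega) (by rwa [lam_neg])
      rw [obs_neg hk'] at h1
      simpa using h1
    · exact ho k h hk'
  have hpik : ∀ k : ℤ, k ≠ 0 → (Real.pi * Complex.I * k : ℂ) ≠ 0 := fun k hk => by
    simp [hk, Real.pi_ne_zero]
  set I : ℤ → ℂ := fun k =>
    ⟪expHalf (-lam a b k true), eig b k true (mode k (cq f)) (mode k (cp f))⟫_ℂ +
      ⟪expHalf (-lam a b k false), eig b k false (mode k (cq f)) (mode k (cp f))⟫_ℂ with hI
  -- `S k` is the prescribed sum of boundary values. In the mode `0` the boundary condition does not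
  -- see it, so it is taken to be the value forced when both eigenvalues are negative, and
  -- compatibility becomes trivial.
  set S : ℤ → ℂ := fun k =>
    if k = 0 then I k else coordFourier h 0 k / (Real.pi * Complex.I * k) with hS
  choose q p d hq hp hest using fun k => exists_solution_mode (hl k) (mode k (cq f))
    (mode k (cp f)) (S k) (fun h1 h2 => by
      by_cases hk : k = 0
      · simp only [hS, if_pos hk, hI]
      · simp only [hS, if_neg hk]
        rw [eq_div_iff (hpik k hk), mul_comm]
        exact sub_eq_zero.1 (ho' k hk h1))
  -- The estimate fails to apply only to finitely many modes, which are irrelevant for summability.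
  have hfin : {k : ℤ | ¬ (k ≠ 0 ∧ |a| ≤ |(k : ℝ)|)}.Finite := by
    refine (Set.finite_Icc (-⌈|a|⌉) ⌈|a|⌉).subset fun k hk => ?_
    have ha : (0 : ℤ) ≤ ⌈|a|⌉ := Int.ceil_nonneg (abs_nonneg a)
    have h1 : |k| ≤ ⌈|a|⌉ := by
      by_cases h : k = 0
      · simpa [h] using ha
      · have h2 : |(k : ℝ)| < |a| := by
          by_contra hc
          exact hk ⟨h, not_lt.1 hc⟩
        have h3 : ((|k| : ℤ) : ℝ) ≤ (⌈|a|⌉ : ℝ) := by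
          push_cast
          exact h2.le.trans (Int.le_ceil _)
        exact_mod_cast h3
    exact abs_le.1 h1
  have hbig : Summable fun k : ℤ => 2 * (|(k : ℝ)| * ‖coordFourier h 0 k‖ ^ 2) +
      20 * ((k : ℝ) ^ 2 * ‖mode k (cq f)‖ ^ 2 + (k : ℝ) ^ 2 * ‖mode k (cp f)‖ ^ 2) :=
    ((hh 0).mul_left 2).add
      (((summable_sq_mul_norm_mode hf iq).add (summable_sq_mul_norm_mode hf ip)).mul_left 20)
  have sum4 : ∀ x : ℤ → LHalf, (∀ k, x k ∈ ({q k, p k} : Set LHalf)) →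
      Summable fun k : ℤ => (k : ℝ) ^ 4 * ‖x k‖ ^ 2 := fun x hx => by
    refine Summable.of_norm_bounded_eventually hbig ?_
    rw [Filter.Eventually, mem_cofinite]
    refine hfin.subset fun k hk hk' => hk ?_
    have hk0 : 0 < |(k : ℝ)| := abs_pos.2 (by exact_mod_cast hk'.1)
    -- Dividing by `πik` gains two powers of `|k|`; what remains is the general term of the
    -- `H^{1/2}` norm.
    have hS2 : |(k : ℝ)| ^ 3 * ‖S k‖ ^ 2 ≤ |(k : ℝ)| * ‖coordFourier h 0 k‖ ^ 2 := by
      simp only [hS, if_neg hk'.1]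
      rw [norm_div, norm_mul, norm_mul, Complex.norm_I, Complex.norm_intCast, Complex.norm_real,
        Real.norm_of_nonneg Real.pi_pos.le, mul_one, div_pow, mul_pow, ← mul_div_assoc,
        div_le_iff₀ (by positivity)]
      have : 1 ≤ Real.pi ^ 2 := by nlinarith [Real.pi_gt_three]
      nlinarith [mul_le_mul_of_nonneg_left this
        (by positivity : 0 ≤ |(k : ℝ)| ^ 3 * ‖coordFourier h 0 k‖ ^ 2)]
    have := hest k hk'.1 hk'.2 _ (hx k)
    rw [Set.mem_ofPred_eq, Real.norm_of_nonneg (by positivity)]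
    linarith
  have sum0 : ∀ x : ℤ → LHalf, (Summable fun k : ℤ => (k : ℝ) ^ 4 * ‖x k‖ ^ 2) →
      Summable fun k : ℤ => ‖x k‖ ^ 2 := fun x hx => by
    refine Summable.of_norm_bounded_eventually hx ?_
    rw [Filter.Eventually, mem_cofinite]
    refine (Set.finite_singleton (0 : ℤ)).subset fun k hk => ?_
    by_contra hk0
    refine hk ?_
    have h1 : 0 < k ^ 4 := Even.pow_pos (by decide) hk0
    replace h1 : 1 ≤ k ^ 4 := h1
    have h2 : (1 : ℝ) ≤ (k : ℝ) ^ 4 := by exact_mod_cast h1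
    rw [Set.mem_ofPred_eq, Real.norm_of_nonneg (by positivity)]
    nlinarith [sq_nonneg ‖x k‖]
  have sq4 := sum4 q fun k => Or.inl rfl
  have sp4 := sum4 p fun k => Or.inr rfl
  obtain ⟨U, hU⟩ := exists_mode_eq (sum0 q sq4)
  obtain ⟨V, hV⟩ := exists_mode_eq (sum0 p sp4)
  have hUV := mem_H2_of_modes (a := a) (b := b) (U := U) (V := V) (mem_H1_map (coordCLM iq) hf)
    (mem_H1_map (coordCLM ip) hf) (fun k => ⟨_, by rw [hU, hV]; exact hq k⟩)
    (fun k => ⟨_, by rw [hU, hV]; exact hp k⟩) (by simpa only [hU] using sq4)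
    (by simpa only [hV] using sp4)
  refine ⟨realPair U V, mem_H2_realPair hUV.1 hUV.2, modeRel_realPair fun k => ?_⟩
  refine ⟨1 / 2 * S k, d k, by rw [hU, hV]; exact hq k, by rw [hU, hV]; exact hp k, ?_⟩
  by_cases hk : k = 0
  · rw [hk, h0]
    simp
  · simp only [hS, if_neg hk]
    have := hpik k hk
    field_simp

/-! ### The kernel -/

lemma mode_real_smul (k : ℤ) (r : ℝ) (U : L2Cyl ℂ) : mode k (r • U) = (r : ℂ) • mode k U := by
  rw [← ofReal_smul_L2, map_smul]

lemma eig_add {E : Type*} [AddCommGroup E] [Module ℂ E] (b : ℝ) (k : ℤ) (β : Bool)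
    (q p q' p' : E) : eig b k β (q + q') (p + p') = eig b k β q p + eig b k β q' p' := by
  simp only [eig, smul_add]
  abel

lemma eig_smul {E : Type*} [AddCommGroup E] [Module ℂ E] (b : ℝ) (k : ℤ) (β : Bool) (r : ℂ)
    (q p : E) : eig b k β (r • q) (r • p) = r • eig b k β q p := by
  simp only [eig, smul_add, smul_comm r]

lemma eig_zero {E : Type*} [AddCommGroup E] [Module ℂ E] (b : ℝ) (k : ℤ) (β : Bool) :
    eig b k β (0 : E) 0 = 0 := by simp [eig]

lemma eig_true_add_eig_false {E : Type*} [AddCommGroup E] [Module ℂ E] (b : ℝ) (k : ℤ) (q p : E) :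
    eig b k true q p + eig b k false q p = (2 : ℂ) • q := by
  simp only [eig, sg_true, sg_false]
  push_cast
  module

lemma eq_zero_of_eig_eq_zero {E : Type*} [AddCommGroup E] [Module ℂ E] {b : ℝ} {k : ℤ} {q p : E}
    (h : ∀ β, eig b k β q p = 0) : q = 0 ∧ p = 0 := by
  have hq : q = 0 := by
    have := eig_true_add_eig_false b k q p
    rw [h, h, add_zero] at this
    exact (smul_eq_zero.1 this.symm).resolve_left two_ne_zero
  refine ⟨hq, ?_⟩
  have h1 := h true
  rw [eig, hq, zero_add] at h1
  refine (smul_eq_zero.1 h1).resolve_left fun h0 => ?_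
  have h2 := congrArg norm h0
  rw [norm_mul, norm_zeta] at h2
  simp [sg] at h2

/-- The eigencomponent of a function in a mode. -/
def comp (b : ℝ) (k : ℤ) (β : Bool) (u : L2Cyl (PhaseSpace 1)) : LHalf :=
  eig b k β (mode k (cq u)) (mode k (cp u))

lemma comp_add (b : ℝ) (k : ℤ) (β : Bool) (u v : L2Cyl (PhaseSpace 1)) :
    comp b k β (u + v) = comp b k β u + comp b k β v := by
  simp only [comp, map_add, eig_add]

lemma comp_smul (b : ℝ) (k : ℤ) (β : Bool) (r : ℝ) (u : L2Cyl (PhaseSpace 1)) :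
    comp b k β (r • u) = (r : ℂ) • comp b k β u := by
  simp only [comp, map_smul, mode_real_smul, eig_smul]

lemma comp_zero (b : ℝ) (k : ℤ) (β : Bool) : comp b k β 0 = 0 := by
  simp only [comp, map_zero, eig_zero]

lemma conjL2_comp (b : ℝ) (k : ℤ) (β : Bool) (u : L2Cyl (PhaseSpace 1)) :
    conjL2 _ (comp b k β u) = comp b (-k) β u := by
  rw [comp, conjL2_eig, ← mode_neg_coordL2, ← mode_neg_coordL2, comp]

lemma eq_zero_of_comp_eq_zero {b : ℝ} {u : L2Cyl (PhaseSpace 1)}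
    (h : ∀ k : ℤ, 0 ≤ k → ∀ β, comp b k β u = 0) : u = 0 := by
  have h' : ∀ k β, comp b k β u = 0 := fun k β => by
    rcases le_total 0 k with hk | hk
    · exact h k hk β
    · rw [← neg_neg k, ← conjL2_comp, h (-k) (by omega), map_zero]
  refine coordL2_ext (coord_cases (ext_mode fun k => ?_) (ext_mode fun k => ?_))
  · rw [(eq_zero_of_eig_eq_zero (h' k)).1, map_zero, map_zero]
  · rw [(eq_zero_of_eig_eq_zero (h' k)).2, map_zero, map_zero]

lemma ModeRel.comp {a b : ℝ} {u f : L2Cyl (PhaseSpace 1)} {h : L2Circ (EuclideanSpace ℝ (Fin 1))}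
    (H : ModeRel a b u f h) (k : ℤ) : ∃ c : Bool → ℂ,
      (∀ β, HasDerivTrace (comp b k β u) ((lam a b k β : ℂ) • HalfCylinder.comp b k β u +
        HalfCylinder.comp b k β f) (c β)) ∧
      coordFourier h 0 k = Real.pi * Complex.I * k * (c true + c false) := by
  obtain ⟨c, d, h1, h2, h3⟩ := H k
  refine ⟨fun β => eig b k β c d, fun β => HasDerivTrace.eig h1 h2 β, ?_⟩
  rw [eig_true_add_eig_false, h3, smul_eq_mul]
  ring

lemma inner_expHalf_ne_zero {l : ℝ} (hl : 0 < l) : ⟪expHalf l, expHalf l⟫_ℂ ≠ 0 := fun h => by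
  have h0 : expHalf l = 0 := inner_self_eq_zero.1 h
  have h1 := hasDerivTrace_expHalf hl
  rw [h0, smul_zero] at h1
  exact one_ne_zero (h1.unique HasDerivTrace.zero).2

/-- A homogeneous solution is a multiple of the exponential, and the pairing detects the multiple.
Unlike the trace, the pairing is defined on all of `L²`, so it can serve as a linear coordinate in
`kerMap`. -/
lemma HasDerivTrace.eq_zero_of_inner {w : LHalf} {c : ℂ} {l : ℝ}
    (h : HasDerivTrace w ((l : ℂ) • w) c) (hl : 0 < l) (hi : ⟪expHalf l, w⟫_ℂ = 0) :
    w = 0 ∧ c = 0 := by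
  have h1 := h.eq_smul_expHalf hl
  have hc : c = 0 := by
    rw [h1, inner_smul_right] at hi
    exact (mul_eq_zero.1 hi).resolve_right (inner_expHalf_ne_zero hl)
  rw [hc, zero_smul] at h1
  exact ⟨h1, hc⟩

/-- The indices of the kernel in the mode zero. -/
abbrev PosZero (a b : ℝ) := {β : Bool // 0 < lam a b 0 β}

/-- The coordinates on the kernel. -/
def kerMap (a b : ℝ) (K : Finset ℤ) :
    L2Cyl (PhaseSpace 1) →ₗ[ℝ] (PosZero a b → ℝ) × (K → ℂ) where
  toFun u := (fun β => (⟪expHalf (lam a b 0 β), comp b 0 β u⟫_ℂ).re,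
    fun k => ⟪expHalf (lam a b k true), comp b k true u⟫_ℂ)
  map_add' u v := by
    ext <;> simp [comp_add, inner_add_right]
  map_smul' r u := by
    ext <;> simp only [comp_smul, inner_smul_right] <;> simp

/-- In the mode `0` the components are real, so the real part of the pairing suffices. For `k ≥ 1`
the boundary values satisfy `c₊ + c₋ = 0`. If the lower eigenvalue is negative then `c₋ = 0`;
otherwise the coordinate in the mode `k` gives `c₊ = 0`. Either way both vanish. -/
lemma kerMap_injective {a b : ℝ} {K : Finset ℤ} (hl : ∀ k β, lam a b k β ≠ 0)
    (hK : ∀ k, k ∈ K ↔ 1 ≤ k ∧ 0 < lam a b k false) {u : L2Cyl (PhaseSpace 1)}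
    (H : ModeRel a b u 0 0) (h0 : kerMap a b K u = 0) : u = 0 := by
  refine eq_zero_of_comp_eq_zero (b := b) fun k hk => ?_
  obtain ⟨c, h1, h2⟩ := H.comp k
  simp only [comp_zero, add_zero] at h1
  rw [coordFourier_zero] at h2
  rcases hk.eq_or_lt with rfl | hk
  · intro β
    rcases (hl 0 β).lt_or_gt with hβ | hβ
    · exact (h1 β).eq_zero (hl 0 β) fun h => absurd h hβ.not_gt
    · refine ((h1 β).eq_zero_of_inner hβ (Complex.ext ?_ ?_)).1
      · exact congrFun (congrArg Prod.fst h0) ⟨β, hβ⟩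
      · have := inner_expHalf_conj hβ (comp b 0 β u)
        rw [conjL2_comp, neg_zero] at this
        exact Complex.conj_eq_iff_im.1 this.symm
  · have hc : c true + c false = 0 := by
      have : (Real.pi * Complex.I * k : ℂ) ≠ 0 := by simp [hk.ne', Real.pi_ne_zero]
      exact (mul_eq_zero.1 h2.symm).resolve_left this
    have key : c true = 0 ∧ c false = 0 := by
      rcases (hl k false).lt_or_gt with hf | hf
      · have e : comp b k false u = 0 := (h1 false).eq_zero (hl k false) fun h => absurd h hf.not_gt
        have h3 := h1 false
        rw [e, smul_zero] at h3
        have h4 := (h3.unique HasDerivTrace.zero).2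
        rw [h4, add_zero] at hc
        exact ⟨hc, h4⟩
      · have hK' : k ∈ K := (hK k).2 ⟨hk, hf⟩
        have h3 := ((h1 true).eq_zero_of_inner (hf.trans_le (lam_false_le a b k))
          (congrFun (congrArg Prod.snd h0) ⟨k, hK'⟩)).2
        rw [h3, zero_add] at hc
        exact ⟨h3, hc⟩
    intro β
    refine (h1 β).eq_zero (hl k β) fun _ => ?_
    cases β
    exacts [key.2, key.1]

/-- Solutions of the homogeneous equation with finitely many modes. -/
lemma exists_ker {a b : ℝ} {w : ℤ → Bool → LHalf} {c : ℤ → Bool → ℂ}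
    (hw : ∀ k β, HasDerivTrace (w k β) ((lam a b k β : ℂ) • w k β) (c k β))
    (hc : ∀ k, k ≠ 0 → c k true + c k false = 0) {s : Finset ℤ} (hs : ∀ k ∉ s, ∀ β, w k β = 0) :
    ∃ u ∈ H2 (PhaseSpace 1), ModeRel a b u 0 0 ∧
      ∀ k β, comp b k β u = (1 / 2 : ℂ) • (w k β + conjL2 _ (w (-k) β)) := by
  have sum : ∀ {x : ℤ → LHalf}, (∀ k ∉ s, x k = 0) → ∀ n : ℕ,
      Summable fun k : ℤ => (k : ℝ) ^ n * ‖x k‖ ^ 2 := fun {x} hx n =>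
    summable_of_ne_finset_zero (s := s) fun k hk => by rw [hx k hk]; simp
  set q : ℤ → LHalf := fun k => (1 / 2 : ℂ) • (w k true + w k false) with hq
  set p : ℤ → LHalf := fun k => (conj (zeta b k) / 2) • (w k true - w k false) with hp
  have hq0 : ∀ k ∉ s, q k = 0 := fun k hk => by simp [hq, hs k hk]
  have hp0 : ∀ k ∉ s, p k = 0 := fun k hk => by simp [hp, hs k hk]
  obtain ⟨U, hU⟩ := exists_mode_eq (y := q) (by simpa using sum hq0 0)
  obtain ⟨V, hV⟩ := exists_mode_eq (y := p) (by simpa using sum hp0 0)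
  have E := fun k => HasDerivTrace.of_eig (a := a) (b := b) (k := k) (f := 0) (g := 0)
    (by rw [eig_zero, add_zero]; exact hw k true) (by rw [eig_zero, add_zero]; exact hw k false)
  have hUV := mem_H2_of_modes (a := a) (b := b) (U := U) (V := V) (F := 0) (G := 0) (zero_mem _)
    (zero_mem _) (fun k => ⟨_, by rw [hU, hV, map_zero]; exact (E k).1⟩)
    (fun k => ⟨_, by rw [hU, hV, map_zero]; exact (E k).2⟩) (by simpa only [hU] using sum hq0 4)
    (by simpa only [hV] using sum hp0 4)
  refine ⟨realPair U V, mem_H2_realPair hUV.1 hUV.2, modeRel_realPair fun k => ?_, fun k β => ?_⟩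
  · refine ⟨_, _, by rw [hU, hV, map_zero, map_zero]; exact (E k).1,
      by rw [hU, hV, map_zero, map_zero]; exact (E k).2, ?_⟩
    rw [coordFourier_zero]
    by_cases hk : k = 0
    · simp [hk]
    · rw [hc k hk]
      simp
  · have back : ∀ k, eig b k β (q k) (p k) = w k β := fun k => by
      have hz := zeta_mul_conj b k
      simp only [hq, hp, eig, smul_smul]
      rw [show (sg β * zeta b k * (conj (zeta b k) / 2) : ℂ) = sg β / 2 by
        linear_combination (sg β / 2 : ℂ) * hz]
      cases β
      · rw [sg_false]; push_cast; module
      · rw [sg_true]; push_cast; module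
    -- Taking the real part averages the mode `k` with the conjugate of the mode `-k`.
    rw [comp, mode_cq_realPair, mode_cp_realPair, eig_smul, eig_add, hU, hV, hU, hV, back]
    congr 2
    nth_rewrite 1 [← neg_neg k]
    rw [← conjL2_eig, back]

lemma kerMap_surjective {a b : ℝ} {K : Finset ℤ}
    (hK : ∀ k, k ∈ K ↔ 1 ≤ k ∧ 0 < lam a b k false) (y : (PosZero a b → ℝ) × (K → ℂ)) :
    ∃ u ∈ H2 (PhaseSpace 1), ModeRel a b u 0 0 ∧ kerMap a b K u = y := by
  classical
  have hK0 : (0 : ℤ) ∉ K := fun h => absurd ((hK 0).1 h).1 (by norm_num)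
  set e : ℤ → Bool → LHalf := fun k β => expHalf (lam a b k β) with he
  -- The signs make the boundary values cancel. The factor `2` compensates the average with the mode
  -- `-k`, where nothing is placed because `-k ∉ K`; the mode `0` is averaged with itself and needs
  -- no such factor.
  set c : ℤ → Bool → ℂ := fun k β =>
    if k = 0 then (if h : 0 < lam a b 0 β then (y.1 ⟨β, h⟩ : ℂ) / ⟪e 0 β, e 0 β⟫_ℂ else 0)
    else if h : k ∈ K then sg β * (2 * y.2 ⟨k, h⟩ / ⟪e k true, e k true⟫_ℂ) else 0 with hc
  have hpos : ∀ k ∈ K, ∀ β, 0 < lam a b k β := fun k hk β => by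
    have := ((hK k).1 hk).2
    cases β
    exacts [this, this.trans_le (lam_false_le a b k)]
  have hcz : ∀ k β, ¬ 0 < lam a b k β → c k β = 0 := fun k β h => by
    simp only [hc]
    split_ifs with h1 h2 h3
    · subst h1; exact absurd h2 h
    · rfl
    · exact absurd (hpos k h3 β) h
    · rfl
  obtain ⟨u, hu, hu0, hcomp⟩ := exists_ker (a := a) (b := b) (w := fun k β => c k β • e k β) (c := c)
    (s := insert 0 K) (fun k β => by
      by_cases h : 0 < lam a b k β
      · have := (hasDerivTrace_expHalf h).smul (c k β)
        rwa [smul_comm, mul_one] at this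
      · rw [hcz k β h, zero_smul, smul_zero]
        exact HasDerivTrace.zero) (fun k hk => by
      simp only [hc, if_neg hk, sg_true, sg_false]
      split_ifs
      · push_cast; ring
      · ring) (fun k hk β => by
      rw [Finset.mem_insert, not_or] at hk
      simp only [hc, if_neg hk.1, dif_neg hk.2, zero_smul])
  refine ⟨u, hu, hu0, Prod.ext (funext fun β => ?_) (funext fun k => ?_)⟩
  · have hβ := β.2
    have hi := inner_expHalf_ne_zero hβ
    have hr : conj ⟪e 0 β, e 0 β⟫_ℂ = ⟪e 0 β, e 0 β⟫_ℂ := inner_conj_symm _ _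
    have hcc : conj (c 0 β) = c 0 β := by
      simp only [hc, if_pos, dif_pos hβ, map_div₀, hr, Complex.conj_ofReal]
    change (⟪e 0 β, comp b 0 β u⟫_ℂ).re = y.1 β
    rw [hcomp, neg_zero, conjL2_smul, hcc, he, conj_expHalf hβ, ← two_smul ℂ, smul_smul]
    simp only [hc, if_pos, dif_pos hβ]
    rw [show (1 / 2 * 2 : ℂ) = 1 by norm_num, one_smul, inner_smul_right, div_mul_cancel₀ _ hi,
      Complex.ofReal_re]
  · have hk := k.2
    have hk1 := ((hK k).1 hk).1
    have hk' : (k : ℤ) ≠ 0 := by omega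
    have hi := inner_expHalf_ne_zero (hpos k hk true)
    change ⟪e k true, comp b k true u⟫_ℂ = y.2 k
    have hn : c (-k) true = 0 := by
      have h1 : -(k : ℤ) ∉ K := fun h => by have := ((hK _).1 h).1; omega
      simp only [hc, neg_eq_zero, if_neg hk', dif_neg h1]
    rw [hcomp, hn, zero_smul, map_zero, add_zero, inner_smul_right, inner_smul_right]
    simp only [hc, if_neg hk', dif_pos hk, sg_true]
    have hi' : ⟪e k true, e k true⟫_ℂ ≠ 0 := hi
    push_cast
    field_simp

/-! ### The cokernel -/

lemma obs_eq (a b : ℝ) (k : ℤ) (f : L2Cyl (PhaseSpace 1))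
    (h : L2Circ (EuclideanSpace ℝ (Fin 1))) : obs a b k f h =
      Real.pi * Complex.I * k * (⟪expHalf (-lam a b k true), comp b k true f⟫_ℂ +
        ⟪expHalf (-lam a b k false), comp b k false f⟫_ℂ) - coordFourier h 0 k := rfl

/-- The functionals whose common zeros are the image. -/
def cokerMap (a b : ℝ) (K : Finset ℤ) :
    L2Cyl (PhaseSpace 1) × L2Circ (EuclideanSpace ℝ (Fin 1)) →ₗ[ℝ] ℝ × (K → ℂ) where
  toFun y := ((coordFourier y.2 0 0).re, fun k => obs a b k y.1 y.2)
  map_add' x y := by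
    ext k
    · simp [coordFourier_add]
    · simp only [obs_eq, Prod.fst_add, Prod.snd_add, comp_add, inner_add_right,
        coordFourier_add, Pi.add_apply]
      ring
  map_smul' r x := by
    ext k
    · simp [coordFourier_smul]
    · simp only [obs_eq, Prod.smul_fst, Prod.smul_snd, comp_smul, inner_smul_right,
        coordFourier_smul, Pi.smul_apply, RingHom.id_apply, Complex.real_smul]
      ring

/-- In the mode `0` the boundary condition carries the factor `k = 0`. In the modes of `K` both
boundary values are forced by `f`, so `obs` compares `ĥ(k)` with the only value it can take. -/
lemma ModeRel.cokerMap_eq_zero {a b : ℝ} {K : Finset ℤ}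
    (hK : ∀ k ∈ K, lam a b k true < 0) {u f : L2Cyl (PhaseSpace 1)}
    {h : L2Circ (EuclideanSpace ℝ (Fin 1))} (H : ModeRel a b u f h) :
    cokerMap a b K (f, h) = 0 := by
  refine Prod.ext ?_ (funext fun k => ?_)
  · obtain ⟨c, -, h2⟩ := H.comp 0
    change (coordFourier h 0 0).re = 0
    rw [h2]
    simp
  · obtain ⟨c, h1, h2⟩ := H.comp k
    have ht := hK k k.2
    have hf := (lam_false_le a b k).trans_lt ht
    change obs a b k f h = 0
    rw [obs_eq, h2, (h1 true).trace_eq_inner_expHalf ht, (h1 false).trace_eq_inner_expHalf hf,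
      sub_self]

lemma coordFourier_zero_im (h : L2Circ (EuclideanSpace ℝ (Fin 1))) : (coordFourier h 0 0).im = 0 :=
  Complex.conj_eq_iff_im.1 (by rw [← coordFourier_neg, neg_zero])

/-- Trigonometric polynomials with given coefficients. -/
lemma exists_coordFourier_eq (y : ℤ → ℂ) (s : Finset ℤ) (hs : ∀ k ∉ s, y k = 0) :
    ∃ h ∈ HHalf 1, ∀ k, coordFourier h 0 k = 1 / 2 * (y k + conj (y (-k))) := by
  have hm : Memℓp y 2 := memℓp_gen (summable_of_ne_finset_zero (s := s) fun k hk => by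
    simp [hs k hk])
  set g : L2Circ ℂ := (fourierBasis (T := (1 : ℝ))).repr.symm ⟨y, hm⟩ with hg
  have hgk : ∀ k, fourierCoeff g k = y k := fun k => by
    rw [← fourierBasis_repr, hg, LinearIsometryEquiv.apply_symm_apply]
  have key : ∀ k, coordFourier (ofCoordL2 _ (0 : Fin 1) g) 0 k =
      1 / 2 * (y k + conj (y (-k))) := fun k => by
    rw [coordFourier_eq, coordL2_ofCoordL2, if_pos rfl, ← hgk, ← hgk, ← fourierCoeff_conjL2,
      ← fourierBasis_repr, ← fourierBasis_repr, ← fourierBasis_repr, map_smul, map_add]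
    rfl
  refine ⟨_, fun i => ?_, key⟩
  rw [Subsingleton.elim i 0]
  classical
  refine summable_of_ne_finset_zero (s := s ∪ s.image Neg.neg) fun k hk => ?_
  rw [Finset.mem_union, not_or] at hk
  have h2 : -k ∉ s := fun h => hk.2 (Finset.mem_image.2 ⟨-k, h, neg_neg k⟩)
  rw [key, hs k hk.1, hs _ h2]
  simp

lemma cokerMap_surjective {a b : ℝ} {K : Finset ℤ} (hK : ∀ k ∈ K, 1 ≤ k) (y : ℝ × (K → ℂ)) :
    ∃ h ∈ HHalf 1, cokerMap a b K (0, h) = y := by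
  classical
  obtain ⟨h, hh, hk⟩ := exists_coordFourier_eq
    -- With `f = 0` the obstruction is `-ĥ(k)`, which gives the sign; the `2` compensates the
    -- average with the empty mode `-k`.
    (fun k => if k = 0 then (y.1 : ℂ) else if h : k ∈ K then -2 * y.2 ⟨k, h⟩ else 0) (insert 0 K)
    (fun k hk => by
      rw [Finset.mem_insert, not_or] at hk
      simp [hk.1, hk.2])
  refine ⟨h, hh, Prod.ext ?_ (funext fun k => ?_)⟩
  · change (coordFourier h 0 0).re = y.1
    rw [hk]
    simp
    ring
  · have h1 := hK k k.2
    have h2 : (k : ℤ) ≠ 0 := by omega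
    have h3 : -(k : ℤ) ∉ K := fun h => by have := hK _ h; omega
    change obs a b k 0 h = y.2 k
    rw [obs_eq, hk, if_neg h2, dif_pos k.2, if_neg (neg_ne_zero.2 h2), dif_neg h3,
      comp_zero, comp_zero]
    simp

/-- The dimensions of the kernel and of the cokernel. -/
theorem finrank_ker_coker {a b : ℝ} (hl : ∀ k β, lam a b k β ≠ 0) {Kp Km : Finset ℤ}
    (hp : ∀ k, k ∈ Kp ↔ 1 ≤ k ∧ 0 < lam a b k false)
    (hm : ∀ k, k ∈ Km ↔ 1 ≤ k ∧ lam a b k true < 0)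
    {T : H2 (PhaseSpace 1) →ₗ[ℝ] H1 (PhaseSpace 1) × HHalf 1}
    (hT : ∀ u w, T u = w ↔ ModeRel a b u.1 w.1.1 w.2.1) :
    FiniteDimensional ℝ (LinearMap.ker T) ∧ FiniteDimensional ℝ (Coker T) ∧
      Module.finrank ℝ (LinearMap.ker T) = Fintype.card (PosZero a b) + 2 * Kp.card ∧
      Module.finrank ℝ (Coker T) = 1 + 2 * Km.card := by
  have hker : ∀ u, u ∈ LinearMap.ker T ↔ ModeRel a b u.1 0 0 := fun u => by
    rw [LinearMap.mem_ker, hT]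
    rfl
  have dim : ∀ K : Finset ℤ, Module.finrank ℝ (K → ℂ) = 2 * K.card := fun K => by
    rw [Module.finrank_pi_fintype]
    simp [Complex.finrank_real_complex, mul_comm]
  let Φ : LinearMap.ker T →ₗ[ℝ] (PosZero a b → ℝ) × (Kp → ℂ) :=
    (kerMap a b Kp ∘ₗ (H2 (PhaseSpace 1)).subtype).domRestrict (LinearMap.ker T)
  let e1 := LinearEquiv.ofBijective Φ ⟨(injective_iff_map_eq_zero Φ).2 fun u hu =>
    Subtype.ext (Subtype.ext (kerMap_injective hl hp ((hker _).1 u.2) hu)), fun y => by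
      obtain ⟨u, hu, h1, h2⟩ := kerMap_surjective hp y
      exact ⟨⟨⟨u, hu⟩, (hker _).2 h1⟩, h2⟩⟩
  let Λ : H1 (PhaseSpace 1) × HHalf 1 →ₗ[ℝ] ℝ × (Km → ℂ) :=
    cokerMap a b Km ∘ₗ ((H1 (PhaseSpace 1)).subtype.prodMap (HHalf 1).subtype)
  -- The functionals are necessary by the forced boundary values and sufficient by `exists_modeRel`,
  -- so the cokernel is their target space.
  have hΛ : LinearMap.range T = LinearMap.ker Λ := by
    ext w
    constructor
    · rintro ⟨u, hu⟩
      exact ((hT _ _).1 hu).cokerMap_eq_zero fun k hk => ((hm k).1 hk).2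
    · intro hw
      have hw' : cokerMap a b Km (w.1.1, w.2.1) = 0 := hw
      obtain ⟨u, hu, h⟩ := exists_modeRel hl w.1.2 w.2.2
        (Complex.ext (congrArg Prod.fst hw') (coordFourier_zero_im _))
        (fun k h1 h2 => congrFun (congrArg Prod.snd hw') ⟨k, (hm k).2 ⟨h1, h2⟩⟩)
      exact ⟨⟨u, hu⟩, (hT _ _).2 h⟩
  have hΛs : Function.Surjective Λ := fun y => by
    obtain ⟨h, hh, e⟩ := cokerMap_surjective (a := a) (b := b) (fun k hk => ((hm k).1 hk).1) y
    exact ⟨(0, ⟨h, hh⟩), e⟩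
  let e2 : Coker T ≃ₗ[ℝ] ℝ × (Km → ℂ) :=
    (Submodule.quotEquivOfEq _ _ hΛ).trans (Λ.quotKerEquivOfSurjective hΛs)
  refine ⟨e1.symm.finiteDimensional, e2.symm.finiteDimensional, ?_, ?_⟩
  · rw [e1.finrank_eq, Module.finrank_prod, Module.finrank_fintype_fun_eq_card, dim]
  · rw [e2.finrank_eq, Module.finrank_prod, dim, Module.finrank_self]

/-! ### Planar symplectic matrices -/

lemma complexDet_eq (M : PhaseMatrix 1) :
    complexDet M = ⟨(M iq iq + M ip ip) / 2, (M ip iq - M iq ip) / 2⟩ := by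
  rw [complexDet, Matrix.det_fin_one]
  rfl

lemma mem_symplecticGroup_iff (M : PhaseMatrix 1) :
    M ∈ Matrix.symplecticGroup (Fin 1) ℝ ↔ M iq iq * M ip ip - M iq ip * M ip iq = 1 := by
  rw [SymplecticGroup.mem_iff]
  constructor
  · intro h
    have := congrFun (congrFun h ip) iq
    simp [Matrix.J, Matrix.mul_apply, iq, ip] at this
    simp only [iq, ip]
    linarith
  · intro h
    simp only [iq, ip] at h
    ext i j
    revert i j
    refine fun i => coord_cases ?_ ?_ <;> revert i <;> refine coord_cases ?_ ?_ <;>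
      simp [Matrix.J, Matrix.mul_apply, iq, ip] <;> linarith

lemma det_phaseMatrix (M : PhaseMatrix 1) :
    M.det = M iq iq * M ip ip - M iq ip * M ip iq := by
  rw [← Matrix.det_reindex_self finSumFinEquiv M, Matrix.det_fin_two]
  rfl

/-- For `2 × 2` matrices `det (M - 1) = det M - tr M + 1`, and the trace is twice the real part of
the complex determinant. -/
lemma det_sub_one {M : PhaseMatrix 1} (h : M ∈ Matrix.symplecticGroup (Fin 1) ℝ) :
    (M - 1).det = 2 - 2 * (complexDet M).re := by
  rw [mem_symplecticGroup_iff] at h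
  rw [det_phaseMatrix, complexDet_eq]
  simp only [Matrix.sub_apply, Matrix.one_apply, iq, ip] at h ⊢
  simp
  linarith

/-- For entries `α, β, γ, δ` with `αδ - βγ = 1`, the squared modulus is `1 + ((α - δ)² + (β + γ)²) /
4`. -/
lemma one_le_norm_complexDet {M : PhaseMatrix 1} (h : M ∈ Matrix.symplecticGroup (Fin 1) ℝ) :
    1 ≤ ‖complexDet M‖ := by
  rw [mem_symplecticGroup_iff] at h
  rw [← one_le_sq_iff₀ (norm_nonneg _), ← Complex.normSq_eq_norm_sq, complexDet_eq,
    Complex.normSq_mk]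
  nlinarith [sq_nonneg (M iq iq - M ip ip), sq_nonneg (M iq ip + M ip iq)]

lemma continuousOn_complexDet {γ : ℝ → PhaseMatrix 1} {s : Set ℝ} (h : ContinuousOn γ s) :
    ContinuousOn (fun t => (complexDet (γ t)).re) s := by
  simp only [complexDet_eq]
  have e : ∀ i j, ContinuousOn (fun t => γ t i j) s := fun i j =>
    ((continuous_apply_apply i j).comp_continuousOn h : _)
  exact ((e _ _).add (e _ _)).div_const 2

/-! ### Continuous arguments -/

lemma lt_of_forall_ne {f : ℝ → ℝ} {x y c : ℝ} (hxy : x ≤ y) (hf : ContinuousOn f (Icc x y))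
    (hc : ∀ t ∈ Icc x y, f t ≠ c) (h : f x < c) : f y < c := by
  by_contra hn
  obtain ⟨t, ht, e⟩ := intermediate_value_Icc hxy hf ⟨h.le, not_lt.1 hn⟩
  exact hc t ht e

lemma gt_of_forall_ne {f : ℝ → ℝ} {x y c : ℝ} (hxy : x ≤ y) (hf : ContinuousOn f (Icc x y))
    (hc : ∀ t ∈ Icc x y, f t ≠ c) (h : c < f x) : c < f y := by
  by_contra hn
  obtain ⟨t, ht, e⟩ := intermediate_value_Icc' hxy hf ⟨not_lt.1 hn, h.le⟩
  exact hc t ht e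

/-- Such a function avoids the odd multiples of `π`, which separate the multiples of `2π`. -/
lemma eq_of_mem_int_mul {f : ℝ → ℝ} {x y : ℝ} (hxy : x ≤ y) (hf : ContinuousOn f (Icc x y))
    (h : ∀ t ∈ Icc x y, ∃ n : ℤ, f t = n * (2 * Real.pi)) : f y = f x := by
  have hpi := Real.pi_pos
  obtain ⟨n, hn⟩ := h x ⟨le_rfl, hxy⟩
  obtain ⟨m, hm⟩ := h y ⟨hxy, le_rfl⟩
  have odd : ∀ e : ℤ, ∀ t ∈ Icc x y, f t ≠ (2 * e + 1 : ℤ) * Real.pi := fun e t ht he => by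
    obtain ⟨l, hl⟩ := h t ht
    have : ((2 * l : ℤ) : ℝ) = (2 * e + 1 : ℤ) := by
      refine mul_right_cancel₀ hpi.ne' ?_
      rw [← he, hl]
      push_cast
      ring
    have := Int.cast_injective this
    omega
  have h1 := lt_of_forall_ne hxy hf (odd n) (by rw [hn]; push_cast; nlinarith)
  have h2 := gt_of_forall_ne hxy hf (odd (n - 1)) (by rw [hn]; push_cast; nlinarith)
  have h3 : (m : ℝ) < n + 1 := by
    rw [hm] at h1; push_cast at h1; nlinarith
  have h4 : (n : ℝ) < m + 1 := by
    rw [hm] at h2; push_cast at h2; nlinarith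
  have h5 : m < n + 1 := by exact_mod_cast h3
  have h6 : n < m + 1 := by exact_mod_cast h4
  rw [hn, hm, show m = n by omega]

lemma exists_int_of_exp {x : ℝ} (h : Complex.exp (x * Complex.I) = 1) :
    ∃ n : ℤ, x = n * (2 * Real.pi) := by
  obtain ⟨n, hn⟩ := Complex.exp_eq_one_iff.1 h
  refine ⟨n, ?_⟩
  have := congrArg Complex.im hn
  simpa using this

/-! ### The final value of the argument along an extension. -/

/-- The extensions to `[0,2]` which compute the Conley-Zehnder index of a path in the plane. -/
structure IsCZExtension (γ : ℝ → PhaseMatrix 1) (θ : ℝ → ℝ) : Prop where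
  continuousOn : ContinuousOn γ (Icc 0 2)
  continuousOn_arg : ContinuousOn θ (Icc 0 2)
  symplectic : ∀ t ∈ Icc (0 : ℝ) 2, γ t ∈ Matrix.symplecticGroup (Fin 1) ℝ
  nondegenerate : ∀ t ∈ Icc (1 : ℝ) 2, (γ t - 1).det ≠ 0
  endpoint : γ 2 = -1 ∨ γ 2 = refMatrix 1
  arg : ∀ t ∈ Icc (0 : ℝ) 2,
    complexDet (γ t) = (‖complexDet (γ t)‖ : ℂ) * Complex.exp (θ t * Complex.I)

lemma hasConleyZehnderIndex_iff {W : ℝ → PhaseMatrix 1} {k : ℤ} :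
    HasConleyZehnderIndex W k ↔ W 0 = 1 ∧ ∃ γ θ, IsCZExtension γ θ ∧
      (∀ t ∈ Icc (0 : ℝ) 1, γ t = W t) ∧ θ 2 - θ 0 = -(k : ℝ) * Real.pi := by
  refine and_congr_right fun _ => ⟨?_, ?_⟩
  · rintro ⟨γ, θ, h1, h2, h3, h4, h5, h6, h7, h8⟩
    exact ⟨γ, θ, ⟨h1, h2, h4, h5, h6, h7⟩, h3, h8⟩
  · rintro ⟨γ, θ, ⟨h1, h2, h4, h5, h6, h7⟩, h3, h8⟩
    exact ⟨γ, θ, h1, h2, h3, h4, h5, h6, h7, h8⟩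

lemma complexDet_neg_one : complexDet (-1 : PhaseMatrix 1) = -1 := by
  rw [complexDet_eq]
  apply Complex.ext <;> simp [iq, ip]

lemma complexDet_refMatrix : complexDet (refMatrix 1) = (5 / 4 : ℝ) := by
  rw [complexDet_eq]
  apply Complex.ext <;> simp [refMatrix, iq, ip]
  norm_num

namespace IsCZExtension

variable {γ : ℝ → PhaseMatrix 1} {θ : ℝ → ℝ}

lemma re_complexDet (H : IsCZExtension γ θ) {t : ℝ} (ht : t ∈ Icc (0 : ℝ) 2) :
    (complexDet (γ t)).re = ‖complexDet (γ t)‖ * Real.cos (θ t) := by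
  have := congrArg Complex.re (H.arg t ht)
  rwa [Complex.re_ofReal_mul, Complex.exp_ofReal_mul_I_re] at this

lemma re_complexDet_ne_one (H : IsCZExtension γ θ) {t : ℝ} (ht : t ∈ Icc (1 : ℝ) 2) :
    (complexDet (γ t)).re ≠ 1 := fun h =>
  H.nondegenerate t ht (by
    rw [det_sub_one (H.symplectic t ⟨by linarith [ht.1], ht.2⟩), h]; norm_num)

/-- The real part of the complex determinant stays below `1` on `[1,2]`. At an argument in `2πℤ` it
would equal the modulus, which is at least `1`, so the argument stays between two consecutive
multiples of `2π`. The endpoint must be `-1`, and the only possible argument is the midpoint. -/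
lemma arg_end_of_lt_one (H : IsCZExtension γ θ) (h1 : (complexDet (γ 1)).re < 1) {n : ℤ}
    (hn : n * (2 * Real.pi) < θ 1) (hn' : θ 1 < (n + 1) * (2 * Real.pi)) : θ 2 = n * (2 * Real.pi) + Real.pi := by
  have sub : Icc (1 : ℝ) 2 ⊆ Icc 0 2 := Icc_subset_Icc_left zero_le_one
  have hlt : ∀ t ∈ Icc (1 : ℝ) 2, (complexDet (γ t)).re < 1 := fun t ht => by
    have sub' : Icc (1 : ℝ) t ⊆ Icc 1 2 := Icc_subset_Icc_right ht.2
    exact lt_of_forall_ne (f := fun t => (complexDet (γ t)).re) ht.1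
      ((continuousOn_complexDet H.continuousOn).mono (sub'.trans sub))
      (fun s hs => H.re_complexDet_ne_one (sub' hs)) h1
  have hne : ∀ t ∈ Icc (1 : ℝ) 2, ∀ m : ℤ, θ t ≠ m * (2 * Real.pi) := fun t ht m hm => by
    have h := hlt t ht
    rw [H.re_complexDet (sub ht), hm, Real.cos_int_mul_two_pi, mul_one] at h
    exact absurd (one_le_norm_complexDet (H.symplectic t (sub ht))) (not_le.2 h)
  have m2 : (2 : ℝ) ∈ Icc (1 : ℝ) 2 := by norm_num
  have b1 := gt_of_forall_ne one_le_two (H.continuousOn_arg.mono sub) (fun t ht => hne t ht n) hn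
  have b2 := lt_of_forall_ne one_le_two (H.continuousOn_arg.mono sub) (fun t ht => hne t ht (n + 1))
    (by push_cast; exact hn')
  push_cast at b2
  have hD : complexDet (γ 2) = -1 := by
    rcases H.endpoint with h | h
    · rw [h, complexDet_neg_one]
    · have := hlt 2 m2
      rw [h, complexDet_refMatrix, Complex.ofReal_re] at this
      norm_num at this
  have hE := H.arg 2 (sub m2)
  rw [hD, norm_neg, norm_one, Complex.ofReal_one, one_mul] at hE
  obtain ⟨m, hm⟩ := exists_int_of_exp (x := θ 2 - Real.pi) (by
    rw [Complex.ofReal_sub, sub_mul, Complex.exp_sub, ← hE, Complex.exp_pi_mul_I, div_self]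
    norm_num)
  have hpi := Real.pi_pos
  have h3 : (m : ℝ) < n + 1 := by nlinarith
  have h4 : (n : ℝ) < m + 1 := by nlinarith
  have h5 : m < n + 1 := by exact_mod_cast h3
  have h6 : n < m + 1 := by exact_mod_cast h4
  rw [show n = m by omega, ← hm]
  ring

/-- The real part stays above `1`, so the argument never reaches an odd multiple of `π`. The
endpoint is then `refMatrix 1`, whose complex determinant is positive, and the argument returns to
the same multiple of `2π`. -/
lemma arg_end_of_one_lt (H : IsCZExtension γ θ) (h1 : 1 < (complexDet (γ 1)).re) {n : ℤ}
    (hn : θ 1 = n * (2 * Real.pi)) :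
    θ 2 = θ 1 := by
  have sub : Icc (1 : ℝ) 2 ⊆ Icc 0 2 := Icc_subset_Icc_left zero_le_one
  have hgt : ∀ t ∈ Icc (1 : ℝ) 2, 1 < (complexDet (γ t)).re := fun t ht => by
    have sub' : Icc (1 : ℝ) t ⊆ Icc 1 2 := Icc_subset_Icc_right ht.2
    exact gt_of_forall_ne (f := fun t => (complexDet (γ t)).re) ht.1
      ((continuousOn_complexDet H.continuousOn).mono (sub'.trans sub))
      (fun s hs => H.re_complexDet_ne_one (sub' hs)) h1
  have hne : ∀ t ∈ Icc (1 : ℝ) 2, ∀ m : ℤ, θ t ≠ m * (2 * Real.pi) + Real.pi := fun t ht m hm => by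
    have h := hgt t ht
    rw [H.re_complexDet (sub ht), hm, add_comm, Real.cos_add_int_mul_two_pi, Real.cos_pi] at h
    linarith [norm_nonneg (complexDet (γ t))]
  have hpi := Real.pi_pos
  have m2 : (2 : ℝ) ∈ Icc (1 : ℝ) 2 := by norm_num
  have b1 := gt_of_forall_ne one_le_two (H.continuousOn_arg.mono sub) (fun t ht => hne t ht (n - 1))
    (by rw [hn]; push_cast; linarith)
  have b2 := lt_of_forall_ne one_le_two (H.continuousOn_arg.mono sub) (fun t ht => hne t ht n)
    (by rw [hn]; linarith)
  push_cast at b1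
  have hD : complexDet (γ 2) = (5 / 4 : ℝ) := by
    rcases H.endpoint with h | h
    · have := hgt 2 m2
      rw [h, complexDet_neg_one] at this
      norm_num at this
    · rw [h, complexDet_refMatrix]
  have hE := H.arg 2 (sub m2)
  rw [hD, Complex.norm_real, Real.norm_of_nonneg (by norm_num)] at hE
  obtain ⟨m, hm⟩ := exists_int_of_exp (x := θ 2) (by
    refine (mul_left_cancel₀ ?_ (hE.symm.trans (mul_one _).symm))
    norm_num)
  have h3 : (m : ℝ) < n + 1 := by nlinarith
  have h4 : (n : ℝ) < m + 1 := by nlinarith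
  have h5 : m < n + 1 := by exact_mod_cast h3
  have h6 : n < m + 1 := by exact_mod_cast h4
  rw [hn, hm, show n = m by omega]

end IsCZExtension

/-! ### Fundamental solutions -/

/-- `U(-t) W(t)` has zero derivative because `A` commutes with `U`, so it stays equal to `1`. -/
lemma eq_of_isFundamentalSolution {n : ℕ} {A : PhaseMatrix n} {U W : ℝ → PhaseMatrix n}
    (hU : ∀ t i j, HasDerivAt (fun τ => U τ i j) ((A * U t) i j) t)
    (hc : ∀ t, A * U t = U t * A) (h0 : U 0 = 1) (hinv : ∀ t, U t * U (-t) = 1)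
    (hW : IsFundamentalSolution (fun _ => A) W) : ∀ t ∈ Icc (0 : ℝ) 1, W t = U t := by
  have key : ∀ i j, ∀ t ∈ Icc (0 : ℝ) 1,
      HasDerivWithinAt (fun τ => (U (-τ) * W τ) i j) 0 (Icc 0 1) t := fun i j t ht => by
    have h1 : ∀ k, HasDerivAt (fun τ => U (-τ) i k) (-(A * U (-t)) i k) t := fun k => by
      rw [← mul_neg_one]
      exact (hU (-t) i k).comp t (hasDerivAt_neg t)
    have h2 := HasDerivWithinAt.fun_sum (u := Finset.univ) fun k _ =>
      (h1 k).hasDerivWithinAt.mul (hW.2 t ht k j)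
    have e : ∑ k, (-(A * U (-t)) i k * W t k j + U (-t) i k * (A * W t) k j) = 0 := by
      have : (-(A * U (-t)) * W t + U (-t) * (A * W t)) i j = 0 := by
        rw [hc, neg_mul, mul_assoc, neg_add_cancel, Matrix.zero_apply]
      rw [← this, Matrix.add_apply, Matrix.mul_apply, Matrix.mul_apply, Finset.sum_add_distrib]
      rfl
    rw [e] at h2
    exact h2
  intro t ht
  have h1 : U (-t) * W t = 1 := by
    ext i j
    rw [constant_of_derivWithin_zero (fun s hs => (key i j s hs).differentiableWithinAt)
      (fun s hs => (key i j s (Ico_subset_Icc_self hs)).derivWithin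
        (uniqueDiffOn_Icc one_pos s (Ico_subset_Icc_self hs))) t ht, neg_zero, h0, hW.1, mul_one]
  calc W t = U t * U (-t) * W t := by rw [hinv, one_mul]
    _ = U t := by rw [mul_assoc, h1, mul_one]

/-- The rotation by the angle `x`. -/
def rot (x : ℝ) : PhaseMatrix 1 :=
  Real.cos x • (1 : PhaseMatrix 1) + Real.sin x • Matrix.J (Fin 1) ℝ

/-- The matrix `diag(1, -1)`. -/
abbrev flipMatrix : PhaseMatrix 1 := Matrix.fromBlocks 1 0 0 (-1)

/-- The matrix `diag(e^x, e^{-x})`. -/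
def hyp (x : ℝ) : PhaseMatrix 1 := Real.cosh x • (1 : PhaseMatrix 1) + Real.sinh x • flipMatrix

lemma rot_add (x y : ℝ) : rot (x + y) = rot x * rot y := by
  simp only [rot, Real.cos_add, Real.sin_add, add_mul, mul_add, smul_mul_smul_comm, one_mul,
    mul_one, Matrix.J_squared]
  module

lemma flipMatrix_mul_self : flipMatrix * flipMatrix = 1 := by
  rw [Matrix.fromBlocks_multiply]
  simp

lemma hyp_add (x y : ℝ) : hyp (x + y) = hyp x * hyp y := by
  simp only [hyp, Real.cosh_add, Real.sinh_add, add_mul, mul_add, smul_mul_smul_comm, one_mul,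
    mul_one, flipMatrix_mul_self]
  module

lemma rot_zero : rot 0 = 1 := by simp [rot]

lemma hyp_zero : hyp 0 = 1 := by simp [hyp]

lemma complexDet_rot (x : ℝ) : complexDet (rot x) = Complex.exp (x * Complex.I) := by
  rw [complexDet_eq]
  apply Complex.ext
  · rw [Complex.exp_ofReal_mul_I_re]; simp [rot, Matrix.J, iq, ip]
  · rw [Complex.exp_ofReal_mul_I_im]; simp [rot, Matrix.J, iq, ip]

lemma complexDet_hyp (x : ℝ) : complexDet (hyp x) = (Real.cosh x : ℝ) := by
  rw [complexDet_eq]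
  apply Complex.ext
  · rw [Complex.ofReal_re]
    simp [hyp, iq, ip, -Real.cosh_add_sinh]
    ring
  · rw [Complex.ofReal_im]; simp [hyp, iq, ip]

lemma rot_mem (x : ℝ) : rot x ∈ Matrix.symplecticGroup (Fin 1) ℝ := by
  rw [mem_symplecticGroup_iff]
  simp [rot, Matrix.J, iq, ip]
  linarith [Real.sin_sq_add_cos_sq x]

lemma hyp_mem (x : ℝ) : hyp x ∈ Matrix.symplecticGroup (Fin 1) ℝ := by
  rw [mem_symplecticGroup_iff]
  simp [hyp, iq, ip, -Real.cosh_add_sinh]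
  linarith [Real.cosh_sq x]

lemma continuous_rot : Continuous rot := by
  unfold rot
  fun_prop

lemma continuous_hyp : Continuous hyp := by
  unfold hyp
  fun_prop

lemma hasDerivAt_rot (a t : ℝ) (i j) : HasDerivAt (fun τ => rot (-a * τ) i j)
    ((-a • Matrix.J (Fin 1) ℝ * rot (-a * t)) i j) t := by
  have h0 : HasDerivAt (fun τ : ℝ => -a * τ) (-a) t := by
    simpa using (hasDerivAt_id t).const_mul (-a)
  have h1 := (h0.cos.mul_const ((1 : PhaseMatrix 1) i j)).add
    (h0.sin.mul_const (Matrix.J (Fin 1) ℝ i j))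
  have e : -a • Matrix.J (Fin 1) ℝ * rot (-a * t) =
      (-Real.sin (-a * t) * -a) • (1 : PhaseMatrix 1) +
        (Real.cos (-a * t) * -a) • Matrix.J (Fin 1) ℝ := by
    simp only [rot, mul_add, smul_mul_smul_comm, mul_one, Matrix.J_squared]
    module
  rw [e]
  exact h1

lemma hasDerivAt_hyp (t : ℝ) (i j) : HasDerivAt (fun τ => hyp τ i j)
    ((flipMatrix * hyp t) i j) t := by
  have h1 := ((Real.hasDerivAt_cosh t).mul_const ((1 : PhaseMatrix 1) i j)).add
    ((Real.hasDerivAt_sinh t).mul_const (flipMatrix i j))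
  have e : flipMatrix * hyp t = Real.sinh t • (1 : PhaseMatrix 1) + Real.cosh t • flipMatrix := by
    simp only [hyp, mul_add, mul_smul_comm, mul_one, flipMatrix_mul_self]
    module
  rw [e]
  exact h1

lemma isFundamentalSolution_rot (a : ℝ) :
    IsFundamentalSolution (fun _ => -a • Matrix.J (Fin 1) ℝ) fun t => rot (-a * t) :=
  ⟨by simp [rot_zero], fun t _ i j => (hasDerivAt_rot a t i j).hasDerivWithinAt⟩

lemma isFundamentalSolution_hyp : IsFundamentalSolution (fun _ => flipMatrix) hyp :=
  ⟨hyp_zero, fun t _ i j => (hasDerivAt_hyp t i j).hasDerivWithinAt⟩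

lemma eq_rot {a : ℝ} {W : ℝ → PhaseMatrix 1}
    (hW : IsFundamentalSolution (fun _ => -a • Matrix.J (Fin 1) ℝ) W) :
    ∀ t ∈ Icc (0 : ℝ) 1, W t = rot (-a * t) := by
  refine eq_of_isFundamentalSolution (U := fun t => rot (-a * t)) (hasDerivAt_rot a)
    (fun t => ?_) (by simp [rot_zero]) (fun t => ?_) hW
  · simp only [rot, mul_add, add_mul, smul_mul_smul_comm, mul_one, one_mul, mul_comm (-a)]
  · rw [← rot_add, mul_neg, add_neg_cancel, rot_zero]

lemma eq_hyp {W : ℝ → PhaseMatrix 1} (hW : IsFundamentalSolution (fun _ => flipMatrix) W) :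
    ∀ t ∈ Icc (0 : ℝ) 1, W t = hyp t := by
  refine eq_of_isFundamentalSolution hasDerivAt_hyp (fun t => ?_) hyp_zero (fun t => ?_) hW
  · simp only [hyp, mul_add, add_mul, smul_mul_assoc, mul_smul_comm, mul_one, one_mul]
  · rw [← hyp_add, add_neg_cancel, hyp_zero]

/-! ### The Conley-Zehnder indices -/

lemma exp_eq_one_of_arg {z : ℂ} {x y : ℝ} (hz : ‖z‖ ≠ 0) (h : z = ‖z‖ * Complex.exp (x * Complex.I))
    (h' : z = ‖z‖ * Complex.exp (y * Complex.I)) : ∃ n : ℤ, x - y = n * (2 * Real.pi) := by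
  refine exists_int_of_exp ?_
  have e := mul_left_cancel₀ (Complex.ofReal_ne_zero.2 hz) (h.symm.trans h')
  rw [Complex.ofReal_sub, sub_mul, Complex.exp_sub, e, div_self (Complex.exp_ne_zero _)]

/-- The path which equals `v t` up to time one and then moves linearly to `w`. -/
def ext01 (v w t : ℝ) : ℝ := v * min t 1 + (max t 1 - 1) * (w - v)

lemma ext01_of_le {v w t : ℝ} (ht : t ≤ 1) : ext01 v w t = v * t := by
  rw [ext01, min_eq_left ht, max_eq_right ht]; ring

lemma ext01_of_ge {v w t : ℝ} (ht : 1 ≤ t) : ext01 v w t = (2 - t) * v + (t - 1) * w := by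
  rw [ext01, min_eq_right ht, max_eq_left ht]; ring

lemma continuous_ext01 (v w : ℝ) : Continuous (ext01 v w) := by
  unfold ext01
  fun_prop

lemma ext01_mem {v w x y t : ℝ} (hv : v ∈ Ioo x y) (hw : w ∈ Ioo x y) (ht : t ∈ Icc (1 : ℝ) 2) :
    ext01 v w t ∈ Ioo x y := by
  rw [ext01_of_ge ht.1]
  exact convex_Ioo x y hv hw (sub_nonneg.2 ht.2) (sub_nonneg.2 ht.1) (by ring)

/-- On `[0,1]` the argument is `2πN - at`, so it reaches the interval between `2π(N - n - 1)` and
`2π(N - n)` and must end at its midpoint. The total change is `-(2n + 1)π`. -/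
lemma hasConleyZehnderIndex_rot {a : ℝ} {n : ℤ} (hn : n * (2 * Real.pi) < a)
    (hn' : a < (n + 1) * (2 * Real.pi)) {W : ℝ → PhaseMatrix 1}
    (hW : ∀ t ∈ Icc (0 : ℝ) 1, W t = rot (-a * t)) (m : ℤ) :
    HasConleyZehnderIndex W m ↔ m = 2 * n + 1 := by
  have hpi := Real.pi_pos
  have hW0 : W 0 = 1 := by rw [hW 0 (by norm_num), mul_zero, rot_zero]
  rw [hasConleyZehnderIndex_iff]
  constructor
  · rintro ⟨-, γ, θ, H, hγ, hk⟩
    have harg : ∀ t ∈ Icc (0 : ℝ) 1, ∃ j : ℤ, θ t - -a * t = j * (2 * Real.pi) := fun t ht => by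
      have h1 := H.arg t ⟨ht.1, by linarith [ht.2]⟩
      rw [hγ t ht, hW t ht, complexDet_rot] at h1
      refine exp_eq_one_of_arg (z := Complex.exp ((-a * t : ℝ) * Complex.I)) ?_ h1 ?_ <;>
        rw [Complex.norm_exp_ofReal_mul_I] <;> simp
    have hconst := eq_of_mem_int_mul zero_le_one
      ((H.continuousOn_arg.mono (Icc_subset_Icc_right one_le_two)).sub
        (by fun_prop : Continuous fun t : ℝ => -a * t).continuousOn) harg
    obtain ⟨N, hN⟩ := harg 0 (by norm_num)
    have h1 : θ 1 = N * (2 * Real.pi) - a := by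
      simp only [Pi.sub_apply] at hconst
      linarith
    have hlt : (complexDet (γ 1)).re < 1 := by
      refine lt_of_le_of_ne ?_ (H.re_complexDet_ne_one (by norm_num))
      rw [hγ 1 (by norm_num), hW 1 (by norm_num), complexDet_rot, Complex.exp_ofReal_mul_I_re]
      exact Real.cos_le_one _
    have h2 := H.arg_end_of_lt_one hlt (n := N - n - 1) (by rw [h1]; push_cast; linarith)
      (by rw [h1]; push_cast; linarith)
    have h3 : (m : ℝ) = (2 * n + 1 : ℤ) := by
      refine mul_right_cancel₀ hpi.ne' ?_
      push_cast at h2 ⊢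
      linarith
    exact_mod_cast h3
  · rintro rfl
    -- The extension keeps rotating until the angle `-(2n + 1)π`, where the rotation is `-1`. Start
    -- and end lie in the same interval free of multiples of `2π`, so it is nondegenerate.
    have hmem : ∀ t ∈ Icc (1 : ℝ) 2, ext01 (-a) (-(2 * n + 1) * Real.pi) t ∈
        Ioo (-(n + 1) * (2 * Real.pi)) (-n * (2 * Real.pi)) := fun t ht =>
      ext01_mem ⟨by linarith, by linarith⟩ ⟨by linarith, by linarith⟩ ht
    refine ⟨hW0, fun t => rot (ext01 (-a) (-(2 * n + 1) * Real.pi) t),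
      ext01 (-a) (-(2 * n + 1) * Real.pi), ⟨?_, ?_, fun t _ => rot_mem _, fun t ht h => ?_, ?_,
      fun t _ => ?_⟩, fun t ht => ?_, ?_⟩
    · exact (continuous_rot.comp (continuous_ext01 _ _)).continuousOn
    · exact (continuous_ext01 _ _).continuousOn
    · rw [det_sub_one (rot_mem _), complexDet_rot, Complex.exp_ofReal_mul_I_re] at h
      obtain ⟨l, hl⟩ := (Real.cos_eq_one_iff _).1 (by linarith :
        Real.cos (ext01 (-a) (-(2 * n + 1) * Real.pi) t) = 1)
      have h1 := hmem t ht
      rw [← hl] at h1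
      have h3 : -((n : ℝ) + 1) < l := lt_of_mul_lt_mul_right h1.1 (by positivity)
      have h4 : (l : ℝ) < -n := lt_of_mul_lt_mul_right h1.2 (by positivity)
      have h5 : -(n + 1) < l := by exact_mod_cast h3
      have h6 : l < -n := by exact_mod_cast h4
      omega
    · left
      rw [ext01_of_ge one_le_two, show (2 - 2) * -a + (2 - 1) * (-(2 * n + 1) * Real.pi) =
        -Real.pi + (-n : ℤ) * (2 * Real.pi) by push_cast; ring, rot, Real.cos_add_int_mul_two_pi,
        Real.sin_add_int_mul_two_pi]
      simp
    · rw [complexDet_rot, Complex.norm_exp_ofReal_mul_I]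
      simp
    · simp only
      rw [ext01_of_le ht.2, hW t ht]
    · rw [ext01_of_ge one_le_two, ext01_of_le zero_le_one]
      push_cast
      ring

lemma hasConleyZehnderIndex_hyp {W : ℝ → PhaseMatrix 1}
    (hW : ∀ t ∈ Icc (0 : ℝ) 1, W t = hyp t) (m : ℤ) : HasConleyZehnderIndex W m ↔ m = 0 := by
  have hpi := Real.pi_pos
  have hW0 : W 0 = 1 := by rw [hW 0 (by norm_num), hyp_zero]
  have hnorm : ∀ x, ‖complexDet (hyp x)‖ = Real.cosh x := fun x => by
    rw [complexDet_hyp, Complex.norm_real, Real.norm_of_nonneg (Real.cosh_pos x).le]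
  rw [hasConleyZehnderIndex_iff]
  constructor
  · rintro ⟨-, γ, θ, H, hγ, hk⟩
    have harg : ∀ t ∈ Icc (0 : ℝ) 1, ∃ j : ℤ, θ t = j * (2 * Real.pi) := fun t ht => by
      have h1 := H.arg t ⟨ht.1, by linarith [ht.2]⟩
      rw [hγ t ht, hW t ht] at h1
      obtain ⟨j, hj⟩ := exp_eq_one_of_arg (y := 0) (by rw [hnorm]; exact (Real.cosh_pos t).ne') h1
        (by rw [hnorm, complexDet_hyp]; simp)
      exact ⟨j, by rw [← hj, sub_zero]⟩
    have hconst := eq_of_mem_int_mul zero_le_one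
      (H.continuousOn_arg.mono (Icc_subset_Icc_right one_le_two)) harg
    obtain ⟨N, hN⟩ := harg 1 (by norm_num)
    have h2 := H.arg_end_of_one_lt (by
      rw [hγ 1 (by norm_num), hW 1 (by norm_num), complexDet_hyp, Complex.ofReal_re]
      exact Real.one_lt_cosh.2 one_ne_zero) hN
    rw [h2, hconst, sub_self] at hk
    have : (m : ℝ) = 0 := by
      have := mul_eq_zero.1 hk.symm
      exact neg_eq_zero.1 (this.resolve_right hpi.ne')
    exact_mod_cast this
  · rintro rfl
    have hlog : 0 < Real.log 2 := Real.log_pos one_lt_two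
    -- The extension moves the parameter from `1` to `log 2`, where `hyp` is `diag(2, 1/2)`. Only
    -- its positivity is used; the upper bound `2` is arbitrary.
    have hmem : ∀ t ∈ Icc (1 : ℝ) 2, ext01 1 (Real.log 2) t ∈ Ioo 0 2 := fun t ht =>
      ext01_mem ⟨by norm_num, by norm_num⟩ ⟨hlog, by linarith [Real.log_two_lt_d9]⟩ ht
    refine ⟨hW0, fun t => hyp (ext01 1 (Real.log 2) t), fun _ => 0, ⟨?_, continuousOn_const,
      fun t _ => hyp_mem _, fun t ht h => ?_, ?_, fun t _ => ?_⟩, fun t ht => ?_, ?_⟩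
    · exact (continuous_hyp.comp (continuous_ext01 _ _)).continuousOn
    · rw [det_sub_one (hyp_mem _), complexDet_hyp, Complex.ofReal_re] at h
      have := Real.one_lt_cosh.2 (hmem t ht).1.ne'
      linarith
    · right
      have e : hyp (Real.log 2) = refMatrix 1 := by
        rw [hyp, Real.cosh_log two_pos, Real.sinh_log two_pos]
        ext i j
        revert i j
        refine fun i => coord_cases ?_ ?_ <;> revert i <;> refine coord_cases ?_ ?_ <;>
          simp [refMatrix, iq, ip] <;> norm_num
      rw [ext01_of_ge one_le_two, ← e]
      congr 1
      ring
    · rw [hnorm, complexDet_hyp]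
      simp
    · simp only
      rw [ext01_of_le ht.2, hW t ht, one_mul]
    · simp

/-! ### The two families of matrices -/

lemma isSwapForm_J (a : ℝ) : IsSwapForm (-a • Matrix.J (Fin 1) ℝ) a 0 := fun x => by
  have h : (-a • Matrix.J (Fin 1) ℝ).toEuclideanLin x =
      -a • (Matrix.J (Fin 1) ℝ).toEuclideanLin x := by
    rw [map_smul, LinearMap.smul_apply]
  rw [(toEuclideanLin_J _).1, (toEuclideanLin_J _).2, h]
  simp only [PiLp.smul_apply, (toEuclideanLin_J _).1, (toEuclideanLin_J _).2, smul_eq_mul]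
  constructor <;> ring

lemma isSwapForm_flipMatrix : IsSwapForm flipMatrix 0 1 := fun x => by
  have h1 : flipMatrix.toEuclideanLin x iq = x iq := by
    simp [Matrix.toLpLin_apply, Matrix.mulVec, dotProduct, iq]
  have h2 : flipMatrix.toEuclideanLin x ip = -x ip := by
    simp [Matrix.toLpLin_apply, Matrix.mulVec, dotProduct, ip]
  rw [(toEuclideanLin_J _).1, (toEuclideanLin_J _).2, h1, h2]
  constructor <;> ring

lemma lam_zero_right (a : ℝ) (k : ℤ) (β : Bool) :
    lam a 0 k β = a + sg β * (2 * Real.pi * |(k : ℝ)|) := by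
  rw [lam, zmode, Complex.ofReal_zero, add_zero, norm_two_pi_I_mul]

lemma norm_zmode_one_pos (k : ℤ) : 0 < ‖zmode 1 k‖ := by
  refine norm_pos_iff.2 fun h => ?_
  have := congrArg Complex.re h
  simp [zmode] at this

/-- The dimensions for `J A = a`. -/
lemma finrank_scalar {a : ℝ} (ha : ∀ k : ℤ, a ≠ 2 * Real.pi * k)
    {T : H2 (PhaseSpace 1) →ₗ[ℝ] H1 (PhaseSpace 1) × HHalf 1}
    (hT : ∀ u w, T u = w ↔ ModeRel a 0 u.1 w.1.1 w.2.1) :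
    FiniteDimensional ℝ (LinearMap.ker T) ∧ FiniteDimensional ℝ (Coker T) ∧
      Module.finrank ℝ (LinearMap.ker T) =
        (if 0 < a then 2 else 0) + 2 * ⌊a / (2 * Real.pi)⌋.toNat ∧
      Module.finrank ℝ (Coker T) = 1 + 2 * ⌊-a / (2 * Real.pi)⌋.toNat := by
  have hpi := Real.two_pi_pos
  have hr : ∀ k β, lam a 0 k β ≠ 0 := fun k β h => by
    rw [lam_zero_right] at h
    have : a = 2 * Real.pi * k ∨ a = 2 * Real.pi * (-k : ℤ) := by
      push_cast
      cases β <;> rcases abs_choice (k : ℝ) with e | e <;> rw [e] at h <;>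
        simp only [sg_true, sg_false] at h
      · left; linarith
      · right; linarith
      · right; linarith
      · left; linarith
    rcases this with e | e
    exacts [ha _ e, ha _ e]
  have hp : ∀ k, k ∈ Finset.Icc 1 ⌊a / (2 * Real.pi)⌋ ↔ 1 ≤ k ∧ 0 < lam a 0 k false := fun k => by
    rw [Finset.mem_Icc, Int.le_floor, le_div_iff₀ hpi, lam_zero_right, sg_false]
    -- The floor counts `2πk ≤ a`, the sign condition is `2πk < a`; they agree because `a` is not a
    -- multiple of `2π`.
    refine and_congr_right fun hk => ?_
    rw [abs_of_pos (by exact_mod_cast hk : (0 : ℝ) < k)]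
    constructor
    · intro h
      have := lt_of_le_of_ne h (by rw [mul_comm]; exact (ha k).symm)
      linarith
    · intro h
      linarith
  have hm : ∀ k, k ∈ Finset.Icc 1 ⌊-a / (2 * Real.pi)⌋ ↔ 1 ≤ k ∧ lam a 0 k true < 0 := fun k => by
    rw [Finset.mem_Icc, Int.le_floor, le_div_iff₀ hpi, lam_zero_right, sg_true]
    refine and_congr_right fun hk => ?_
    rw [abs_of_pos (by exact_mod_cast hk : (0 : ℝ) < k)]
    constructor
    · intro h
      have h' := ha (-k)
      push_cast at h'
      have := lt_of_le_of_ne h fun e => h' (by linarith)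
      linarith
    · intro h
      linarith
  obtain ⟨h1, h2, h3, h4⟩ := finrank_ker_coker hr hp hm hT
  refine ⟨h1, h2, ?_, ?_⟩
  · rw [h3, Int.card_Icc, add_sub_cancel_right]
    congr 1
    -- In the mode `0` both eigenvalues equal `a`, so they contribute `2` or `0`.
    split_ifs with h
    · rw [Fintype.card_subtype]
      simp [lam_zero_right, h]
    · rw [Fintype.card_subtype]
      simp [lam_zero_right, h]
  · rw [h4, Int.card_Icc, add_sub_cancel_right]

/-- The dimensions for `J A = (q ↔ p)`. -/
lemma finrank_swap {T : H2 (PhaseSpace 1) →ₗ[ℝ] H1 (PhaseSpace 1) × HHalf 1}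
    (hT : ∀ u w, T u = w ↔ ModeRel 0 1 u.1 w.1.1 w.2.1) :
    FiniteDimensional ℝ (LinearMap.ker T) ∧ FiniteDimensional ℝ (Coker T) ∧
      Module.finrank ℝ (LinearMap.ker T) = 1 ∧ Module.finrank ℝ (Coker T) = 1 := by
  have hr : ∀ k β, lam 0 1 k β ≠ 0 := fun k β => by
    have := norm_zmode_one_pos k
    cases β <;> simp only [lam, sg_true, sg_false] <;> intro h <;> linarith
  have hp : ∀ k, k ∈ (∅ : Finset ℤ) ↔ 1 ≤ k ∧ 0 < lam 0 1 k false := fun k => by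
    have := norm_zmode_one_pos k
    simp only [Finset.notMem_empty, lam, sg_false, false_iff, not_and]
    intro _
    linarith
  have hm : ∀ k, k ∈ (∅ : Finset ℤ) ↔ 1 ≤ k ∧ lam 0 1 k true < 0 := fun k => by
    have := norm_zmode_one_pos k
    simp only [Finset.notMem_empty, lam, sg_true, false_iff, not_and]
    intro _
    linarith
  obtain ⟨h1, h2, h3, h4⟩ := finrank_ker_coker hr hp hm hT
  refine ⟨h1, h2, ?_, h4⟩
  rw [h3, Finset.card_empty, mul_zero, add_zero, Fintype.card_eq_one_iff]
  refine ⟨⟨true, by rw [lam, sg_true]; linarith [norm_zmode_one_pos 0]⟩, ?_⟩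
  rintro ⟨β, hβ⟩
  cases β
  · rw [lam, sg_false] at hβ
    linarith [norm_zmode_one_pos 0]
  · rfl

lemma floor_bounds {a : ℝ} (ha : ∀ k : ℤ, a ≠ 2 * Real.pi * k) :
    ⌊a / (2 * Real.pi)⌋ * (2 * Real.pi) < a ∧ a < (⌊a / (2 * Real.pi)⌋ + 1) * (2 * Real.pi) := by
  have hpi := Real.two_pi_pos
  refine ⟨lt_of_le_of_ne ((le_div_iff₀ hpi).1 (Int.floor_le _)) ?_,
    (div_lt_iff₀ hpi).1 (Int.lt_floor_add_one _)⟩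
  rw [mul_comm]
  exact (ha _).symm

lemma floor_neg_eq {a : ℝ} (ha : ∀ k : ℤ, a ≠ 2 * Real.pi * k) :
    ⌊-a / (2 * Real.pi)⌋ = -⌊a / (2 * Real.pi)⌋ - 1 := by
  have hpi := Real.two_pi_pos
  obtain ⟨h1, h2⟩ := floor_bounds ha
  rw [Int.floor_eq_iff, le_div_iff₀ hpi, div_lt_iff₀ hpi]
  push_cast
  constructor <;> linarith

lemma ceil_eq {a : ℝ} (ha : ∀ k : ℤ, a ≠ 2 * Real.pi * k) :
    ⌈a / (2 * Real.pi)⌉ = ⌊a / (2 * Real.pi)⌋ + 1 := by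
  have := floor_neg_eq ha
  rw [neg_div, Int.floor_neg] at this
  omega

/-- The kernel, the cokernel and the index for `J A = a`. -/
lemma index_scalar {a : ℝ} (ha : ∀ k : ℤ, a ≠ 2 * Real.pi * k)
    {T : H2 (PhaseSpace 1) →ₗ[ℝ] H1 (PhaseSpace 1) × HHalf 1}
    (hT : ∀ u w, T u = w ↔ ModeRel a 0 u.1 w.1.1 w.2.1) :
    FiniteDimensional ℝ (LinearMap.ker T) ∧ FiniteDimensional ℝ (Coker T) ∧
      (0 < a → (Module.finrank ℝ (LinearMap.ker T) : ℤ) = 2 * ⌈a / (2 * Real.pi)⌉ ∧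
        Module.finrank ℝ (Coker T) = 1) ∧
      (a < 0 → Module.finrank ℝ (LinearMap.ker T) = 0 ∧
        (Module.finrank ℝ (Coker T) : ℤ) = 2 * ⌊-a / (2 * Real.pi)⌋ + 1) ∧
      index T = 2 * ⌊a / (2 * Real.pi)⌋ + 1 := by
  obtain ⟨fk, fc, dk, dc⟩ := finrank_scalar ha hT
  have hneg := floor_neg_eq ha
  have hpi := Real.two_pi_pos
  refine ⟨fk, fc, ?_⟩
  rw [index, ceil_eq ha, dk, dc]
  rcases lt_trichotomy a 0 with h | h | h
  · have h1 : ⌊a / (2 * Real.pi)⌋ < 0 := Int.floor_lt.2 (by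
      rw [Int.cast_zero]; exact div_neg_of_neg_of_pos h hpi)
    rw [if_neg h.not_gt]
    refine ⟨fun h' => absurd h h'.not_gt, fun _ => ?_, ?_⟩ <;> omega
  · exact absurd h (by simpa using ha 0)
  · have h1 : 0 ≤ ⌊a / (2 * Real.pi)⌋ := Int.floor_nonneg.2 (by positivity)
    rw [if_pos h]
    refine ⟨fun _ => ?_, fun h' => absurd h h'.not_gt, ?_⟩ <;> omega

end HalfCylinder

end

/-! ### The two cases of the theorem. -/

theorem mainTheorem11 :
    (∀ a : ℝ, (∀ k : ℤ, a ≠ 2 * Real.pi * k) →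
      ∃ T : H2 (PhaseSpace 1) →ₗ[ℝ] H1 (PhaseSpace 1) × HHalf 1,
        (∀ T', IsOperatorT (fun _ => Matrix.J (Fin 1) ℝ)
          (fun _ => -a • Matrix.J (Fin 1) ℝ) (fun _ => 0) T' ↔
          T' = T) ∧
        FiniteDimensional ℝ (LinearMap.ker T) ∧ FiniteDimensional ℝ (Coker T) ∧
        (0 < a → (Module.finrank ℝ (LinearMap.ker T) : ℤ) = 2 * ⌈a / (2 * Real.pi)⌉ ∧
          Module.finrank ℝ (Coker T) = 1) ∧
        (a < 0 → Module.finrank ℝ (LinearMap.ker T) = 0 ∧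
          (Module.finrank ℝ (Coker T) : ℤ) = 2 * ⌊-a / (2 * Real.pi)⌋ + 1) ∧
        index T = 2 * ⌊a / (2 * Real.pi)⌋ + 1 ∧
        (∃ W : ℝ → PhaseMatrix 1, IsFundamentalSolution (fun _ => -a • Matrix.J (Fin 1) ℝ) W) ∧
        ∀ W : ℝ → PhaseMatrix 1, IsFundamentalSolution (fun _ => -a • Matrix.J (Fin 1) ℝ) W →
          ∀ m : ℤ, HasConleyZehnderIndex W m ↔ m = index T) ∧
    (∃ T : H2 (PhaseSpace 1) →ₗ[ℝ] H1 (PhaseSpace 1) × HHalf 1,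
        (∀ T', IsOperatorT (fun _ => Matrix.J (Fin 1) ℝ)
          (fun _ => Matrix.fromBlocks 1 0 0 (-1)) (fun _ => 0) T' ↔
          T' = T) ∧
        FiniteDimensional ℝ (LinearMap.ker T) ∧ FiniteDimensional ℝ (Coker T) ∧
        Module.finrank ℝ (LinearMap.ker T) = 1 ∧ Module.finrank ℝ (Coker T) = 1 ∧
        index T = 0 ∧
        (∃ W : ℝ → PhaseMatrix 1, IsFundamentalSolution (fun _ => Matrix.fromBlocks 1 0 0 (-1)) W) ∧
        ∀ W : ℝ → PhaseMatrix 1, IsFundamentalSolution (fun _ => Matrix.fromBlocks 1 0 0 (-1)) W →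
          ∀ m : ℤ, HasConleyZehnderIndex W m ↔ m = index T) := by
  constructor
  · intro a ha
    obtain ⟨T, hT, hM⟩ := exists_operatorT (isSwapForm_J a)
    obtain ⟨fk, fc, d1, d2, hi⟩ := index_scalar ha hM
    obtain ⟨b1, b2⟩ := floor_bounds ha
    refine ⟨T, hT, fk, fc, d1, d2, hi, ⟨_, isFundamentalSolution_rot a⟩,
      fun W hW m => ?_⟩
    rw [hi]
    exact hasConleyZehnderIndex_rot b1 b2 (eq_rot hW) m
  · obtain ⟨T, hT, hM⟩ := exists_operatorT isSwapForm_flipMatrix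
    obtain ⟨fk, fc, dk, dc⟩ := finrank_swap hM
    have hi : index T = 0 := by rw [index, dk, dc, sub_self]
    refine ⟨T, hT, fk, fc, dk, dc, hi, ⟨_, isFundamentalSolution_hyp⟩, fun W hW m => ?_⟩
    rw [hi]
    exact hasConleyZehnderIndex_hyp (eq_hyp hW) m
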